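/- **Setting.** An observation is $\mathcal O=(\mathcal X,x_{\rm else})$ with $x_{\rm else}\in\mathbb R^{d_2}$ and $\mathcal X=\{x_1,\dots,x_M\}$ an unordered collection of $M\in\{1,\dots,N\}$ vectors of $\mathbb R^{d_1}$ (repetitions allowed); an action is $a\in\mathbb R^{k}$. The environment has a transition kernel $p(\mathcal O'\mid\mathcal O,a)$ and a reward $r(\mathcal O,a,\mathcal O')$. Let $\gamma\in(0,1)$, $\alpha\in\mathbb R$, and let $\pi$ be any policy, with density $\pi(a\mid\mathcal O)$ with respect to a $\sigma$-finite reference measure on actions. Let $\rho_\pi=(1-\gamma)\sum_{t\ge0}\gamma^t\,\mathrm{Law}(\mathcal O_t,a_t)$ be the observation-action distribution induced by $\pi$ from an initial observation distribution. The true return distribution $\mathcal Z^\pi(\cdot\mid\mathcal O,a)$ is the law of $$r_0+\sum_{t\ge1}\gamma^t\,[\,r_t-\alpha\log\pi(a_t\mid\mathcal O_t)\,],\qquad r_t=r(\mathcal O_t,a_t,\mathcal O_{t+1}),$$ along the trajectory that starts at $(\mathcal O_0,a_0)=(\mathcal O,a)$ and follows $\pi$ afterwards. The distributional Bellman backup $\mathcal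 T^\pi\mathcal Z(\cdot\mid\mathcal O,a)$ is the law of $r(\mathcal O,a,\mathcal O')+\gamma\,(Z'-\alpha\log\pi(a'\mid\mathcal O'))$, where $\mathcal O'\sim p(\cdot\mid\mathcal O,a)$, $a'\sim\pi(\cdot\mid\mathcal O')$, $Z'\sim\mathcal Z(\cdot\mid\mathcal O',a')$. **Networks.** The feature network $h(\cdot;\phi):\mathbb R^{d_1}\to\mathbb R^{d_3}$ and the value network $(Q_\theta,\sigma_\theta):\mathbb R^{d_3+d_2+k}\to\mathbb R^2$ are feedforward networks with a linear output layer; over-parameterized means that the parameters $\phi,\theta$ range over all such networks with at least one hidden layer and any finite number of hidden neurons. The activation function is continuous and asymptotically affine at $+\infty$ and at $-\infty$ with two different asymptotes (e.g. sigmoid, tanh, ReLU, GELU). The state is $U_{\rm ESC}(\mathcal O;\phi)=[\sum_{x\in\mathcal X}h(x;\phi),\,x_{\rm else}]$ and the encoded return distribution is the Gaussian $$\mathcal Z(\cdot\mid s,a;\theta)=\mathcal N(Q_\theta(s,a),\sigma_\theta(s,a)^2),\qquad s=U_{\rm ESC}(\mathcal O;\phi).$$ **Statement.** Let $d_3\ge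 Nd_1+1$. Assume that the random returns are Gaussian, i.e. that $\mathcal Z^\pi(\cdot\mid\mathcal O,a)$ is a (possibly degenerate) Gaussian law for $\rho_\pi$-almost every $(\mathcal O,a)$, that $\log\pi$ is square integrable under $\rho_\pi$ and $r$ is square integrable under $(\mathcal O,a)\sim\rho_\pi$, $\mathcal O'\sim p$. Let $(\theta^i,\phi^i)_{i\ge0}$ be parameters such that for the initial ones, as functions of $(\mathcal O,a)$, the mean $Q_{\theta^0}$ and the deviation $\sigma_{\theta^0}$ are square integrable, $\sigma_{\theta^0}\ne0$ almost everywhere and $\log|\sigma_{\theta^0}|$ is integrable (all under $\rho_\pi$), and such that for every $i\ge 0$, with $\mathcal Z^i(\cdot\mid\mathcal O,a)=\mathcal Z(\cdot\mid U_{\rm ESC}(\mathcal O;\phi^i),a;\theta^i)$, $$(\theta^{i+1},\phi^{i+1})\in\arg\min_{\theta,\phi}\ \mathbb E_{(\mathcal O,a)\sim\rho_\pi}\Big[D_{\rm KL}\big(\mathcal T^\pi\mathcal Z^i(\cdot\mid\mathcal O,a),\ \mathcal Z(\cdot\mid U_{\rm ESC}(\mathcal O;\phi),a;\theta)\big)\Big].$$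 Then, for $\rho_\pi$-almost every $(\mathcal O,a)$, $\mathcal Z^i(\cdot\mid\mathcal O,a)\to\mathcal Z^\pi(\cdot\mid\mathcal O,a)$ as $i\to\infty$, both weakly and in the $p$-Wasserstein distance for every $p\in[1,\infty)$. -/

import Mathlib

open MeasureTheory ProbabilityTheory Filter Topology
open scoped ENNReal NNReal

noncomputable section

namespace EDPE

/-! ### Observations -/

/-- The information sets of the surrounding vehicles: unordered collections
`{x₁, …, x_M}` of vectors in `ℝ^{d₁}`, of variable size `M ∈ [1, N]`. Two different vehicles
may have the same indicators, hence a multiset. -/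
def VehicleSet (N d₁ : ℕ) : Type :=
  {X : Multiset (Fin d₁ → ℝ) // 1 ≤ X.card ∧ X.card ≤ N}

open Classical in
/-- The number of vehicles of `X` whose indicator vector lies in `B`. -/
def VehicleSet.count {N d₁ : ℕ} (B : Set (Fin d₁ → ℝ)) (X : VehicleSet N d₁) : ℕ :=
  X.1.countP (fun x => x ∈ B)

/-- The usual σ-algebra on finite configurations of points: the smallest one for which all the
counts `X ↦ #(X ∩ B)`, `B` a Borel set, are measurable. -/
instance (N d₁ : ℕ) : MeasurableSpace (VehicleSet N d₁) :=
  ⨆ B : {B : Set (Fin d₁ → ℝ) // MeasurableSet B},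
    MeasurableSpace.comap (VehicleSet.count B.1) ⊤

/-- Observations `𝒪 = (𝒳, x_else)`. -/
abbrev Obs (N d₁ d₂ : ℕ) : Type := VehicleSet N d₁ × (Fin d₂ → ℝ)

/-! ### Markov decision processes, policies, trajectories -/

section MDP

variable {O A : Type*} [MeasurableSpace O] [MeasurableSpace A]

/-- An environment: a transition model `p(o' | o, a)` and a reward `r(o, a, o')`. -/
structure Environment (O A : Type*) [MeasurableSpace O] [MeasurableSpace A] where
  trans : Kernel (O × A) O
  markov : IsMarkovKernel trans
  reward : (O × A) × O → ℝ
  measurable_reward : Measurable reward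

instance (env : Environment O A) : IsMarkovKernel env.trans := env.markov

/-- A stochastic policy `π(a | o)`: a Markov kernel with a density with respect to the reference
measure `ν` on actions (Lebesgue measure for continuous actions, a counting measure on a finite
set for discrete ones). -/
structure Policy (O : Type*) {A : Type*} [MeasurableSpace O] [MeasurableSpace A]
    (ν : Measure A) where
  kernel : Kernel O A
  markov : IsMarkovKernel kernel
  density : O × A → ℝ
  measurable_density : Measurable density
  density_nonneg : ∀ x, 0 ≤ density x
  kernel_eq : ∀ o, kernel o = ν.withDensity (fun a => ENNReal.ofReal (density (o, a)))

variable {ν : Measure A}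

instance (π : Policy O ν) : IsMarkovKernel π.kernel := π.markov

/-- One step of the chain of observation-action pairs: `o' ∼ p(· | o, a)`, `a' ∼ π(· | o')`. -/
def step (env : Environment O A) (π : Policy O ν) : Kernel (O × A) (O × A) :=
  env.trans ⊗ₖ Kernel.prodMkLeft (O × A) π.kernel

instance (env : Environment O A) (π : Policy O ν) : IsMarkovKernel (step env π) := by
  unfold step; infer_instance

/-- The law of `(o_t, a_t)` when `o_0 ∼ d₀` and the policy `π` is followed. -/
def marginal (env : Environment O A) (d₀ : Measure O) (π : Policy O ν) : ℕ → Measure (O × A)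
  | 0 => d₀ ⊗ₘ π.kernel
  | t + 1 => (marginal env d₀ π t).bind (step env π)

/-- The (discounted) observation-action distribution `ρ_π` induced by the policy,
`ρ_π = (1 - γ) ∑ₜ γᵗ Law(o_t, a_t)`. It is the stationary law when `d₀` is stationary. -/
def occupancy (env : Environment O A) (d₀ : Measure O) (π : Policy O ν) (γ : ℝ) :
    Measure (O × A) :=
  Measure.sum fun t : ℕ => ENNReal.ofReal ((1 - γ) * γ ^ t) • marginal env d₀ π t

/-- The law of the trajectory `(o_t, a_t)_{t ≥ 0}` started at the pair `x = (o_0, a_0)`, with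
`π` followed from time `1` on. -/
def trajLaw (env : Environment O A) (π : Policy O ν) (x : O × A) : Measure (ℕ → O × A) :=
  Kernel.traj (X := fun _ => O × A)
    (fun n => (step env π).comap
      (fun h : (Π _ : Finset.Iic n, O × A) => h ⟨n, Finset.mem_Iic.2 le_rfl⟩)
      (measurable_pi_apply _)) 0 (fun _ => x)

/-- The soft return of a trajectory:
`r_0 + ∑_{t ≥ 1} γᵗ (r_t - α log π(a_t | o_t))`, with `r_t = r(o_t, a_t, o_{t+1})`. -/
def softReturn (env : Environment O A) (π : Policy O ν) (γ α : ℝ) (w : ℕ → O × A) : ℝ :=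
  ∑' t : ℕ, γ ^ t * (env.reward (w t, (w (t + 1)).1) -
    if t = 0 then 0 else α * Real.log (π.density (w t)))

/-- The true soft state-action return distribution `𝒵^π(· | o, a)`. -/
def trueReturn (env : Environment O A) (π : Policy O ν) (γ α : ℝ) (x : O × A) : Measure ℝ :=
  (trajLaw env π x).map (softReturn env π γ α)

/-- The distributional soft Bellman backup: `𝒯^π 𝒵(· | o, a)` is the law of
`r(o, a, o') + γ (Z' - α log π(a' | o'))`, where `o' ∼ p(· | o, a)`, `a' ∼ π(· | o')` and
`Z' ∼ 𝒵(· | o', a')`. -/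
def backup (env : Environment O A) (π : Policy O ν) (γ α : ℝ) (Z : O × A → Measure ℝ)
    (x : O × A) : Measure ℝ :=
  (step env π x).bind fun y =>
    (Z y).map fun z => env.reward (x, y.1) + γ * (z - α * Real.log (π.density y))

end MDP

/-! ### Networks -/

/-- Activation functions: continuous, asymptotically affine at both ends, with two different
asymptotes. Sigmoid, tanh, arctan, ReLU, leaky ReLU, ELU, softplus, SiLU and GELU are examples. -/
def IsActivation (act : ℝ → ℝ) : Prop :=
  Continuous act ∧ ∃ a₁ b₁ a₂ b₂ : ℝ, (a₁, b₁) ≠ (a₂, b₂) ∧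
    Tendsto (fun x => act x - (a₁ * x + b₁)) atTop (𝓝 0) ∧
    Tendsto (fun x => act x - (a₂ * x + b₂)) atBot (𝓝 0)

/-- An affine map `ℝⁿ → ℝᵐ`: weights and biases of a layer. -/
structure Layer (n m : ℕ) where
  weight : Matrix (Fin m) (Fin n) ℝ
  bias : Fin m → ℝ

/-- The output of a layer before activation. -/
def Layer.eval {n m : ℕ} (l : Layer n m) (x : Fin n → ℝ) : Fin m → ℝ :=
  fun i => (∑ j, l.weight i j * x j) + l.bias i

/-- Parameters of a feedforward network `ℝⁿ → ℝᵐ` with a linear output layer, with at least one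
hidden layer and with any finite number of hidden neurons. -/
inductive MLP : ℕ → ℕ → Type
  | shallow {n k m : ℕ} (hidden : Layer n k) (out : Layer k m) : MLP n m
  | deep {n k m : ℕ} (hidden : Layer n k) (rest : MLP k m) : MLP n m

/-- The function computed by a network. -/
def MLP.eval (act : ℝ → ℝ) : {n m : ℕ} → MLP n m → (Fin n → ℝ) → Fin m → ℝ
  | _, _, .shallow hidden out, x => out.eval fun i => act (hidden.eval x i)
  | _, _, .deep hidden rest, x => rest.eval act fun i => act (hidden.eval x i)

/-! ### Encoded return distributions -/

section Encoding

variable {N d₁ d₂ d₃ k : ℕ}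

/-- The encoding sum and concatenation state
`U_ESC(𝒪; φ) = [∑_{x ∈ 𝒳} h(x; φ), x_else] ∈ ℝ^{d₃ + d₂}`. -/
def esc (act : ℝ → ℝ) (φ : MLP d₁ d₃) (o : Obs N d₁ d₂) : Fin (d₃ + d₂) → ℝ :=
  Fin.append ((o.1.1.map (φ.eval act)).sum) o.2

/-- The two outputs (mean and standard deviation) of the value network at the state
`s = U_ESC(𝒪; φ)` and the action `a`. -/
def valueOut (act : ℝ → ℝ) (θ : MLP (d₃ + d₂ + k) 2) (φ : MLP d₁ d₃)
    (x : Obs N d₁ d₂ × (Fin k → ℝ)) : Fin 2 → ℝ :=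
  θ.eval act (Fin.append (esc act φ x.1) x.2)

/-- The mean `Q_θ(s, a)` of the encoded return distribution. -/
def valueMean (act : ℝ → ℝ) (θ : MLP (d₃ + d₂ + k) 2) (φ : MLP d₁ d₃)
    (x : Obs N d₁ d₂ × (Fin k → ℝ)) : ℝ :=
  valueOut act θ φ x 0

/-- The standard deviation (up to sign) `σ_θ(s, a)` of the encoded return distribution. -/
def valueStd (act : ℝ → ℝ) (θ : MLP (d₃ + d₂ + k) 2) (φ : MLP d₁ d₃)
    (x : Obs N d₁ d₂ × (Fin k → ℝ)) : ℝ :=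
  valueOut act θ φ x 1

/-- The encoded return distribution
`𝒵(· | U_ESC(𝒪; φ), a; θ) = 𝒩(Q_θ(s, a), σ_θ(s, a)²)`, `s = U_ESC(𝒪; φ)`. -/
def encodedReturn (act : ℝ → ℝ) (θ : MLP (d₃ + d₂ + k) 2) (φ : MLP d₁ d₃)
    (x : Obs N d₁ d₂ × (Fin k → ℝ)) : Measure ℝ :=
  gaussianReal (valueMean act θ φ x) ⟨valueStd act θ φ x ^ 2, sq_nonneg _⟩

/-- The policy evaluation objective: the expectation under `ρ_π` of the Kullback-Leibler
divergence from the backup of the old encoded return distribution, with parameters `old`, to the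
one with parameters `new`. A pair of parameters is `(θ, φ)`. -/
def objective (act : ℝ → ℝ) {ν : Measure (Fin k → ℝ)}
    (env : Environment (Obs N d₁ d₂) (Fin k → ℝ)) (d₀ : Measure (Obs N d₁ d₂))
    (π : Policy (Obs N d₁ d₂) ν) (γ α : ℝ)
    (old new : MLP (d₃ + d₂ + k) 2 × MLP d₁ d₃) : ℝ≥0∞ :=
  ∫⁻ x, InformationTheory.klDiv (backup env π γ α (encodedReturn act old.1 old.2) x)
    (encodedReturn act new.1 new.2 x) ∂(occupancy env d₀ π γ)

end Encoding

/-- The `p`-Wasserstein distance of two measures on the real line. -/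
def wasserstein (p : ℝ) (μ ν : Measure ℝ) : ℝ≥0∞ :=
  (⨅ c ∈ {c : Measure (ℝ × ℝ) | c.fst = μ ∧ c.snd = ν},
    ∫⁻ z, edist z.1 z.2 ^ p ∂c) ^ (1 / p)

end EDPE

end

open EDPE

/-! Each exact minimization reproduces the first two moments of the Bellman backup, so the iteration
is an exact affine recursion on moments, and Gaussian laws are determined by their moments.

Projection. For a law `P` with mean `m` and variance `v > 0` at finite divergence from 𝒩(m, v), the
log-ratio of two Gaussian densities is a quadratic polynomial, so KL(P, 𝒩') = KL(P, 𝒩(m, v)) +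
KL(𝒩(m, v), 𝒩') (`klDiv_gaussianReal_pythagoras`). With `P` the backup, the first term does not
depend on the new parameters. Its expectation is finite: the backup of a Gaussian model is a
Gaussian mixture, and convexity bounds the term by half the gap between log v and the mean of the
log-variances of the components (`klDiv_mixture_le`, `lintegral_gaussianKL_mixture`). The second
term has infimum zero by universal approximation, so a minimizer makes it vanish almost everywhere
and has the moments of the backup (`moments_of_isMinOn`). Square integrability, nondegeneracy and
integrability of the log-deviation pass to the new model, which allows iteration.

Universal approximation (`exists_valueOut_approx`). Functions of an observation are approximated by
functions of one integer, the sum over the vehicles of a bounded integer-valued feature: finitely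
many such sums merge into one by positional notation, and sums of indicators generate the σ-algebra.
The feature and the function of the resulting code are then approximated by networks. A final hidden
layer imitates truncation uniformly on the whole line, which keeps the deviation away from zero and
makes dominated convergence available.

Limit. Unrolled along the Markov chain, the recursion expresses the moments of iterate `i` as
expectations of the return truncated at time `i` with the initial model as terminal payoff
(`moments_eq_integral_chain`). A discounted energy with finite expectation dominates all truncated
returns, so the moments converge to those of the full return. The measure ρ need not be invariant,
but its image under one step is at most γ⁻¹ρ (`bind_occupancy_le`), which transports null sets and
integrability. Gaussianity of the true return identifies the limit law; driving all Gaussians by one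
standard normal variable gives weak and Wasserstein convergence. -/

namespace EDPE

/-! ### Markov chains: characterization of the trajectory law and the Markov property at time 1. -/

section MarkovChain

variable {S : Type*} [MeasurableSpace S]

/-- Prepending a state to a trajectory. -/
def consTraj (x : S) (w : ℕ → S) : ℕ → S
  | 0 => x
  | n + 1 => w n

omit [MeasurableSpace S] in
@[simp] lemma consTraj_zero (x : S) (w : ℕ → S) : consTraj x w 0 = x := rfl

omit [MeasurableSpace S] in
@[simp] lemma consTraj_succ (x : S) (w : ℕ → S) (n : ℕ) : consTraj x w (n + 1) = w n := rfl

lemma measurable_consTraj : Measurable fun p : S × (ℕ → S) => consTraj p.1 p.2 := by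
  refine measurable_pi_lambda _ fun n => ?_
  cases n with
  | zero => exact measurable_fst
  | succ n => exact (measurable_pi_apply n).comp measurable_snd

/-- The history-dependent transition kernels of a time-homogeneous Markov chain. -/
noncomputable def histKernel (P : Kernel S S) (n : ℕ) : Kernel (Π _ : Finset.Iic n, S) S :=
  P.comap (fun h : (Π _ : Finset.Iic n, S) => h ⟨n, Finset.mem_Iic.2 le_rfl⟩)
    (measurable_pi_apply _)

instance (P : Kernel S S) [IsMarkovKernel P] (n : ℕ) : IsMarkovKernel (histKernel P n) := by
  unfold histKernel; infer_instance

/-- The law of the trajectory of the Markov chain with transition kernel `P`, as a kernel in the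
starting point. -/
noncomputable def chain (P : Kernel S S) [IsMarkovKernel P] : Kernel S (ℕ → S) :=
  (Kernel.traj (X := fun _ => S) (histKernel P) 0).comap (fun x _ => x)
    (measurable_pi_lambda _ fun _ => measurable_id)

variable (P : Kernel S S) [IsMarkovKernel P]

instance : IsMarkovKernel (chain P) := by unfold chain; infer_instance

/-- The test function sees the whole past and not only the present state; this is what lets
`eq_chain` rebuild all finite-dimensional laws by induction. -/
lemma lintegral_chain_succ (x : S) (n : ℕ) {F : (Π _ : Finset.Iic n, S) × S → ℝ≥0∞}
    (hF : Measurable F) :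
    ∫⁻ w, F (Preorder.frestrictLe n w, w (n + 1)) ∂(chain P x) =
      ∫⁻ w, ∫⁻ y, F (Preorder.frestrictLe n w, y) ∂(P (w n)) ∂(chain P x) := by
  have h := Kernel.partialTraj_compProd_eq_map_traj (X := fun _ => S) (κ := histKernel P)
    (a := 0) (b := n) (Nat.zero_le n) (x₀ := fun _ => x)
  have h1 : ∫⁻ w, F (Preorder.frestrictLe n w, w (n + 1)) ∂(chain P x) =
      ∫⁻ p, F p ∂((chain P x).map fun w => (Preorder.frestrictLe n w, w (n + 1))) := by
    rw [lintegral_map hF (by fun_prop)]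
  rw [h1, chain, Kernel.comap_apply, ← h, Measure.lintegral_compProd hF,
    ← Kernel.traj_map_frestrictLe_apply, lintegral_map]
  · rfl
  · exact hF.lintegral_kernel_prod_right' (κ := histKernel P n)
  · fun_prop

lemma chain_map_zero (x : S) : (chain P x).map (fun w => w 0) = Measure.dirac x := by
  have h := Kernel.traj_map_frestrictLe_apply (X := fun _ => S) (κ := histKernel P) 0 0
    (fun _ => x)
  rw [Kernel.partialTraj_self, Kernel.id_apply] at h
  have h2 := congrArg (fun μ => μ.map fun v : (Π _ : Finset.Iic 0, S) => v ⟨0, by simp⟩) h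
  beta_reduce at h2
  rw [Measure.map_map (by fun_prop) (by fun_prop)] at h2
  exact h2.trans (Measure.map_dirac' (f := fun v : (Π _ : Finset.Iic 0, S) => v ⟨0, by simp⟩)
    (by fun_prop) _)

lemma chain_ae_zero (x : S) {p : S → Prop} (hp : MeasurableSet {y | p y}) (hx : p x) :
    ∀ᵐ w ∂(chain P x), p (w 0) := by
  have : ∀ᵐ y ∂((chain P x).map (fun w => w 0)), p y := by
    rw [chain_map_zero, ae_dirac_iff hp]; exact hx
  exact ae_of_ae_map (measurable_pi_apply 0).aemeasurable this

lemma lintegral_chain_zero (x : S) {f : S → ℝ≥0∞} (hf : Measurable f) :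
    ∫⁻ w, f (w 0) ∂(chain P x) = f x := by
  rw [← lintegral_map (g := fun w : ℕ → S => w 0) hf (by fun_prop), chain_map_zero,
    lintegral_dirac' _ hf]

/-- A law on trajectories with the right initial state and the right one-step transitions is the
law of the Markov chain. -/
lemma eq_chain (x : S) (η : Measure (ℕ → S)) [IsProbabilityMeasure η]
    (h0 : η.map (fun w => w 0) = Measure.dirac x)
    (hs : ∀ n, ∀ F : (Π _ : Finset.Iic n, S) × S → ℝ≥0∞, Measurable F →
      ∫⁻ w, F (Preorder.frestrictLe n w, w (n + 1)) ∂η =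
        ∫⁻ w, ∫⁻ y, F (Preorder.frestrictLe n w, y) ∂(P (w n)) ∂η) :
    η = chain P x := by
  have key : ∀ n, η.map (Preorder.frestrictLe (π := fun _ => S) n) =
      (chain P x).map (Preorder.frestrictLe (π := fun _ => S) n) := by
    intro n
    induction n with
    | zero =>
      let e : S → (Π _ : Finset.Iic 0, S) := fun y _ => y
      have he : Measurable e := measurable_pi_lambda _ fun _ => measurable_id
      have hc : (Preorder.frestrictLe (π := fun _ => S) 0) = e ∘ fun w => w 0 := by
        funext w i
        obtain ⟨i, hi⟩ := i
        obtain rfl : i = 0 := by simpa using hi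
        rfl
      rw [hc, ← Measure.map_map he (by fun_prop), ← Measure.map_map he (by fun_prop), h0,
        chain_map_zero]
    | succ n ih =>
      -- Glues a history up to time `n` and the next state into a history up to time `n + 1`.
      let g : (Π _ : Finset.Iic n, S) × S → (Π _ : Finset.Iic (n + 1), S) := fun q i =>
        if h : (i : ℕ) ≤ n then q.1 ⟨i, Finset.mem_Iic.2 h⟩ else q.2
      have hg : Measurable g := by
        refine measurable_pi_lambda _ fun i => ?_
        by_cases h : (i : ℕ) ≤ n
        · simp only [g, h, dite_true]; fun_prop
        · simp only [g, h, dite_false]; fun_prop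
      have hc : ∀ w, Preorder.frestrictLe (π := fun _ => S) (n + 1) w =
          g (Preorder.frestrictLe n w, w (n + 1)) := by
        intro w
        funext i
        obtain ⟨i, hi⟩ := i
        by_cases h : i ≤ n
        · simp [g, h]
        · obtain rfl : i = n + 1 := by have := Finset.mem_Iic.1 hi; omega
          simp [g]
      ext s hsm
      have hind : Measurable (s.indicator (1 : (Π _ : Finset.Iic (n + 1), S) → ℝ≥0∞)) :=
        measurable_one.indicator hsm
      rw [← lintegral_indicator_one hsm, ← lintegral_indicator_one hsm,
        lintegral_map hind (by fun_prop), lintegral_map hind (by fun_prop)]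
      simp_rw [hc]
      have e1 := hs n _ (hind.comp hg)
      have e2 := lintegral_chain_succ P x n (hind.comp hg)
      simp only [Function.comp_def] at e1 e2
      rw [e1, e2]
      have hm : Measurable fun v : (Π _ : Finset.Iic n, S) =>
          ∫⁻ y, s.indicator (1 : (Π _ : Finset.Iic (n + 1), S) → ℝ≥0∞) (g (v, y))
            ∂(histKernel P n v) :=
        (hind.comp hg).lintegral_kernel_prod_right' (κ := histKernel P n)
      have e3 := congrArg (fun μ => ∫⁻ v, ∫⁻ y,
        s.indicator (1 : (Π _ : Finset.Iic (n + 1), S) → ℝ≥0∞) (g (v, y))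
            ∂(histKernel P n v) ∂μ) ih
      simp only at e3
      rw [lintegral_map hm (by fun_prop), lintegral_map hm (by fun_prop)] at e3
      exact e3
  -- Cylinders over initial segments of times form a π-system generating the product σ-algebra, so
  -- the laws of all initial segments suffice.
  refine ext_of_generate_finite _ generateFrom_measurableCylinders.symm
    isPiSystem_measurableCylinders (fun t ht => ?_) (by simp)
  obtain ⟨n, A, hA, rfl⟩ : ∃ n A, MeasurableSet A ∧
      t = cylinder (α := fun _ : ℕ => S) (Finset.Iic n) A := by
    simpa [measurableCylinders_nat] using ht
  have h := congrArg (fun μ => μ A) (key n)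
  beta_reduce at h
  rwa [Measure.map_apply (by fun_prop) hA, Measure.map_apply (by fun_prop) hA] at h

/-- The Markov property at time `1`. -/
lemma chain_eq_bind (x : S) :
    chain P x = (P x ⊗ₘ chain P).map fun p => consTraj x p.2 := by
  have hm : Measurable fun p : S × (ℕ → S) => consTraj x p.2 :=
    measurable_consTraj.comp (measurable_const.prodMk measurable_snd)
  have : IsProbabilityMeasure ((P x ⊗ₘ chain P).map fun p => consTraj x p.2) :=
    Measure.isProbabilityMeasure_map hm.aemeasurable
  refine (eq_chain P x _ ?_ fun n F hF => ?_).symm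
  · rw [Measure.map_map (by fun_prop) hm]
    have : (fun w : ℕ → S => w 0) ∘ (fun p : S × (ℕ → S) => consTraj x p.2) = fun _ => x := rfl
    rw [this, Measure.map_const]
    simp
  · have hF1 : Measurable fun w : ℕ → S => F (Preorder.frestrictLe n w, w (n + 1)) := by fun_prop
    have hF3 : Measurable fun v : (Π _ : Finset.Iic n, S) => ∫⁻ y, F (v, y) ∂(histKernel P n v) :=
      hF.lintegral_kernel_prod_right' (κ := histKernel P n)
    have hF2 : Measurable fun w : ℕ → S => ∫⁻ y, F (Preorder.frestrictLe n w, y) ∂(P (w n)) :=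
      hF3.comp (Preorder.measurable_frestrictLe (X := fun _ => S) n)
    rw [lintegral_map hF1 hm, lintegral_map hF2 hm]
    refine (Measure.lintegral_compProd (hF1.comp hm)).trans
      (Eq.trans ?_ (Measure.lintegral_compProd (hF2.comp hm)).symm)
    simp only [Function.comp_def]
    cases n with
    | zero =>
      -- The history at time 0 is deterministic, and the transition out of `x` is the initial law of
      -- the shifted chain.
      let e : Π _ : Finset.Iic 0, S := fun _ => x
      have hc : ∀ w : ℕ → S, Preorder.frestrictLe (π := fun _ => S) 0 (consTraj x w) = e := by
        intro w; funext i
        obtain ⟨i, hi⟩ := i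
        obtain rfl : i = 0 := by simpa using hi
        rfl
      simp only [hc, consTraj_succ, consTraj_zero, lintegral_const, measure_univ, mul_one]
      exact lintegral_congr fun y =>
        lintegral_chain_zero P y (f := fun z => F (e, z)) (by fun_prop)
    | succ n =>
      refine lintegral_congr fun y => ?_
      -- The history with `x` put in front. The outer test always succeeds for indices up to `n +
      -- 1`; it only supplies the membership proof. The inner test catches index 0, where `i - 1` is
      -- truncated.
      let g : (Π _ : Finset.Iic n, S) → (Π _ : Finset.Iic (n + 1), S) := fun h i =>
        if hi : (i : ℕ) - 1 ≤ n then if (i : ℕ) = 0 then x else h ⟨i - 1, Finset.mem_Iic.2 hi⟩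
        else x
      have hg : Measurable g := by
        refine measurable_pi_lambda _ fun i => ?_
        by_cases h : (i : ℕ) - 1 ≤ n
        · by_cases h' : (i : ℕ) = 0
          · simp only [g, h', if_true]; fun_prop
          · simp only [g, h, h', dite_true, if_false]; fun_prop
        · simp only [g, h, dite_false]; fun_prop
      have hc : ∀ w : ℕ → S, Preorder.frestrictLe (π := fun _ => S) (n + 1) (consTraj x w) =
          g (Preorder.frestrictLe n w) := by
        intro w; funext i
        obtain ⟨i, hi⟩ := i
        have := Finset.mem_Iic.1 hi
        cases i with
        | zero => simp [g]
        | succ i =>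
          have : i ≤ n := by omega
          simp [g, this]
      simp only [hc, consTraj_succ]
      exact lintegral_chain_succ P y n (F := fun q => F (g q.1, q.2)) (by fun_prop)

end MarkovChain

/-! ### Divergences of Gaussian laws: explicit formula, Pythagorean identity, convexity. -/

section KullbackLeibler

open InformationTheory

lemma klDiv_withDensity {α : Type*} {mα : MeasurableSpace α} (ν : Measure α) [IsFiniteMeasure ν]
    {f : α → ℝ≥0∞} (hf : Measurable f) [IsFiniteMeasure (ν.withDensity f)] :
    klDiv (ν.withDensity f) ν = ∫⁻ x, ENNReal.ofReal (klFun (f x).toReal) ∂ν := by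
  rw [klDiv_eq_lintegral_klFun_of_ac (withDensity_absolutelyContinuous _ _)]
  refine lintegral_congr_ae ?_
  filter_upwards [Measure.rnDeriv_withDensity ν hf] with x hx
  rw [hx]

/-- The density of one nondegenerate Gaussian law with respect to another one. -/
noncomputable def gaussianRatio (m : ℝ) (v : ℝ≥0) (m' : ℝ) (w : ℝ≥0) (z : ℝ) : ℝ≥0∞ :=
  gaussianPDF m v z / gaussianPDF m' w z

lemma measurable_gaussianRatio {Y : Type*} [MeasurableSpace Y] {μ : Y → ℝ} {τ : Y → ℝ≥0}
    (hμ : Measurable μ) (hτ : Measurable τ) (m' : ℝ) (w : ℝ≥0) :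
    Measurable fun p : Y × ℝ => gaussianRatio (μ p.1) (τ p.1) m' w p.2 := by
  unfold gaussianRatio
  have h1 : Measurable fun p : Y × ℝ => gaussianPDF (μ p.1) (τ p.1) p.2 :=
    measurable_uncurry_gaussianPDF.comp
      ((hμ.comp measurable_fst).prodMk ((hτ.comp measurable_fst).prodMk measurable_snd))
  exact h1.div ((measurable_gaussianPDF m' w).comp measurable_snd)

lemma measurable_gaussianRatio' (m : ℝ) (v : ℝ≥0) (m' : ℝ) (w : ℝ≥0) :
    Measurable (gaussianRatio m v m' w) :=
  (measurable_gaussianPDF m v).div (measurable_gaussianPDF m' w)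

lemma withDensity_gaussianRatio (m : ℝ) {v : ℝ≥0} (hv : v ≠ 0) (m' : ℝ) {w : ℝ≥0} (hw : w ≠ 0) :
    (gaussianReal m' w).withDensity (gaussianRatio m v m' w) = gaussianReal m v := by
  rw [gaussianReal_of_var_ne_zero _ hw, gaussianReal_of_var_ne_zero _ hv,
    ← withDensity_mul _ (measurable_gaussianPDF _ _) (measurable_gaussianRatio' _ _ _ _)]
  congr 1
  funext z
  exact ENNReal.mul_div_cancel (gaussianPDF_pos _ hw _).ne' gaussianPDF_ne_top

lemma log_gaussianRatio (m : ℝ) {v : ℝ≥0} (hv : v ≠ 0) (m' : ℝ) {w : ℝ≥0} (hw : w ≠ 0) (z : ℝ) :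
    Real.log (gaussianRatio m v m' w z).toReal =
      Real.log (w / v) / 2 + (z - m') ^ 2 / (2 * w) - (z - m) ^ 2 / (2 * v) := by
  have hv' : (0 : ℝ) < v := by positivity
  have hw' : (0 : ℝ) < w := by positivity
  have hlog : ∀ (m : ℝ) (v : ℝ≥0), v ≠ 0 → Real.log (gaussianPDFReal m v z) =
      -(Real.log (2 * Real.pi) + Real.log v) / 2 - (z - m) ^ 2 / (2 * v) := by
    intro m v hv
    have hv' : (0 : ℝ) < v := by positivity
    rw [gaussianPDFReal, Real.log_mul (by positivity) (by positivity), Real.log_exp, Real.log_inv,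
      Real.log_sqrt (by positivity), Real.log_mul (by positivity) (by positivity)]
    ring
  rw [gaussianRatio, ENNReal.toReal_div, toReal_gaussianPDF, toReal_gaussianPDF,
    Real.log_div (gaussianPDFReal_pos _ _ _ hv).ne' (gaussianPDFReal_pos _ _ _ hw).ne',
    hlog m v hv, hlog m' w hw, Real.log_div hw'.ne' hv'.ne']
  ring

/-- The Kullback-Leibler divergence from `𝒩(m, v)` to `𝒩(m', w)`. -/
noncomputable def gaussianKL (m v m' w : ℝ) : ℝ :=
  (Real.log (w / v) + (v + (m - m') ^ 2) / w - 1) / 2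

lemma llr_gaussianReal (m : ℝ) {v : ℝ≥0} (hv : v ≠ 0) (m' : ℝ) {w : ℝ≥0} (hw : w ≠ 0) :
    llr (gaussianReal m v) (gaussianReal m' w) =ᵐ[gaussianReal m v] fun z =>
      Real.log (w / v) / 2 + (z - m') ^ 2 / (2 * w) - (z - m) ^ 2 / (2 * v) := by
  have hac : gaussianReal m v ≪ gaussianReal m' w :=
    (gaussianReal_absolutelyContinuous m hv).trans (gaussianReal_absolutelyContinuous' m' hw)
  have h := hac.ae_le (Measure.rnDeriv_withDensity (gaussianReal m' w)
    (measurable_gaussianRatio' m v m' w))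
  rw [withDensity_gaussianRatio m hv m' hw] at h
  filter_upwards [h] with z hz
  rw [llr, hz, log_gaussianRatio m hv m' hw]

lemma integrable_of_integrable_sq {P : Measure ℝ} [IsFiniteMeasure P]
    (h2 : Integrable (fun z => z ^ 2) P) : Integrable (fun z => z) P :=
  ((memLp_two_iff_integrable_sq (by fun_prop)).2 h2).integrable (by norm_num)

lemma integrable_quadratic {P : Measure ℝ} [IsFiniteMeasure P]
    (h2 : Integrable (fun z => z ^ 2) P) (m : ℝ) : Integrable (fun z => (z - m) ^ 2) P := by
  have h1 := integrable_of_integrable_sq h2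
  have : (fun z : ℝ => (z - m) ^ 2) = fun z => z ^ 2 - 2 * m * z + m ^ 2 := by funext z; ring
  rw [this]
  exact (h2.sub (h1.const_mul _)).add (integrable_const _)

lemma integral_quadratic {P : Measure ℝ} [IsProbabilityMeasure P]
    (h2 : Integrable (fun z => z ^ 2) P) {m v : ℝ} (hm : ∫ z, z ∂P = m)
    (hv : ∫ z, z ^ 2 ∂P = m ^ 2 + v) (m' : ℝ) : ∫ z, (z - m') ^ 2 ∂P = v + (m - m') ^ 2 := by
  have h1 := integrable_of_integrable_sq h2
  have : (fun z : ℝ => (z - m') ^ 2) = fun z => z ^ 2 - 2 * m' * z + m' ^ 2 := by funext z; ring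
  have hA : Integrable (fun z : ℝ => z ^ 2 - 2 * m' * z) P := h2.sub (h1.const_mul _)
  rw [this, integral_add hA (integrable_const _),
    integral_sub h2 (h1.const_mul _), integral_const_mul, hm, hv]
  simp
  ring

/-- The integrand is quadratic, so only the first two moments of `P` matter. With `P` Gaussian this
computes the divergence; with general `P` it is the cross term of the Pythagorean identity. -/
lemma integral_log_gaussianRatio {P : Measure ℝ} [IsProbabilityMeasure P]
    (h2 : Integrable (fun z => z ^ 2) P) {m : ℝ} {v : ℝ≥0} (hv0 : v ≠ 0) (hm : ∫ z, z ∂P = m)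
    (hv : ∫ z, z ^ 2 ∂P = m ^ 2 + v) (m' : ℝ) (w : ℝ≥0) :
    ∫ z, (Real.log (w / v) / 2 + (z - m') ^ 2 / (2 * w) - (z - m) ^ 2 / (2 * v)) ∂P =
      gaussianKL m v m' w := by
  have hv' : (v : ℝ) ≠ 0 := by positivity
  have hA : Integrable (fun z : ℝ => Real.log (w / v) / 2 + (z - m') ^ 2 / (2 * w)) P :=
    (integrable_const _).add ((integrable_quadratic h2 m').div_const _)
  rw [integral_sub hA ((integrable_quadratic h2 m).div_const _),
    integral_add (integrable_const _) ((integrable_quadratic h2 m').div_const _),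
    integral_div, integral_div, integral_div, integral_quadratic h2 hm hv, integral_quadratic h2 hm hv, gaussianKL]
  simp only [integral_const, probReal_univ, smul_eq_mul, one_mul, sub_self]
  have e : ((v : ℝ) + 0 ^ 2) / (2 * v) = 1 / 2 := by field_simp; ring
  rw [e]
  ring

lemma integrable_sq_gaussianReal (m : ℝ) (v : ℝ≥0) :
    Integrable (fun z => z ^ 2) (gaussianReal m v) :=
  (memLp_two_iff_integrable_sq (by fun_prop)).1 (memLp_id_gaussianReal 2)

lemma integral_sq_gaussianReal (m : ℝ) (v : ℝ≥0) :
    ∫ z, z ^ 2 ∂(gaussianReal m v) = m ^ 2 + v := by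
  have h := variance_fun_id_gaussianReal (μ := m) (v := v)
  rw [variance_eq_sub (by exact memLp_id_gaussianReal 2)] at h
  have h2 : ∫ x, x ∂(gaussianReal m v) = m := integral_id_gaussianReal
  rw [h2] at h
  simp only [Pi.pow_apply] at h
  linarith

lemma klDiv_gaussianReal (m : ℝ) {v : ℝ≥0} (hv : v ≠ 0) (m' : ℝ) {w : ℝ≥0} (hw : w ≠ 0) :
    klDiv (gaussianReal m v) (gaussianReal m' w) = ENNReal.ofReal (gaussianKL m v m' w) := by
  have hac : gaussianReal m v ≪ gaussianReal m' w :=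
    (gaussianReal_absolutelyContinuous m hv).trans (gaussianReal_absolutelyContinuous' m' hw)
  have h2 := integrable_sq_gaussianReal m v
  have hint : Integrable (llr (gaussianReal m v) (gaussianReal m' w)) (gaussianReal m v) := by
    refine Integrable.congr ?_ (llr_gaussianReal m hv m' hw).symm
    exact ((integrable_const _).add ((integrable_quadratic h2 m').div_const _)).sub
      ((integrable_quadratic h2 m).div_const _)
  rw [klDiv_of_ac_of_integrable hac hint, integral_congr_ae (llr_gaussianReal m hv m' hw),
    integral_log_gaussianRatio h2 hv integral_id_gaussianReal (integral_sq_gaussianReal m v)]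
  simp

/-- Follows from log t ≤ t - 1 at t = v / w. -/
lemma gaussianKL_nonneg {m v m' w : ℝ} (hv : 0 < v) (hw : 0 < w) : 0 ≤ gaussianKL m v m' w := by
  have h := Real.log_le_sub_one_of_pos (div_pos hv hw)
  rw [← inv_div, Real.log_inv] at h
  have : 0 ≤ (m - m') ^ 2 / w := by positivity
  rw [gaussianKL, add_div]
  have e : (w / v)⁻¹ = v / w := inv_div _ _
  rw [e] at h
  linarith

/-- The inequality log t ≤ t - 1 is strict away from t = 1, which forces equal variances; the
squared difference of the means is then all that remains. -/
lemma gaussianKL_eq_zero {m v m' w : ℝ} (hv : 0 < v) (hw : 0 < w) (h : gaussianKL m v m' w ≤ 0) :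
    m' = m ∧ w = v := by
  have e : (w / v)⁻¹ = v / w := inv_div _ _
  have h0 : 0 ≤ (m - m') ^ 2 / w := by positivity
  rw [gaussianKL, add_div] at h
  by_cases hvw : v / w = 1
  · have hvw' : w = v := by field_simp at hvw; exact hvw.symm
    subst hvw'
    refine ⟨?_, rfl⟩
    rw [div_self hv.ne', Real.log_one] at h
    have h1 : (m - m') ^ 2 / w = 0 := by linarith
    have h2 : (m - m') ^ 2 = 0 := by
      rcases div_eq_zero_iff.1 h1 with h | h
      · exact h
      · exact absurd h hw.ne'
    have : m - m' = 0 := by simpa using h2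
    linarith
  · have h1 := Real.log_lt_sub_one_of_pos (div_pos hv hw) hvw
    rw [← e, Real.log_inv, e] at h1
    linarith

/-- The Pythagorean identity for the moment projection on Gaussian laws. -/
lemma klDiv_gaussianReal_pythagoras {P : Measure ℝ} [IsProbabilityMeasure P]
    (h2 : Integrable (fun z => z ^ 2) P) {m : ℝ} {v : ℝ≥0} (hv0 : v ≠ 0) (hm : ∫ z, z ∂P = m)
    (hv : ∫ z, z ^ 2 ∂P = m ^ 2 + v) (hfin : klDiv P (gaussianReal m v) ≠ ∞) (m' : ℝ) (w : ℝ≥0) :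
    klDiv P (gaussianReal m' w) =
      klDiv P (gaussianReal m v) + klDiv (gaussianReal m v) (gaussianReal m' w) := by
  obtain ⟨hac, hint⟩ := klDiv_ne_top_iff.1 hfin
  have hvol : P ≪ volume := hac.trans (gaussianReal_absolutelyContinuous m hv0)
  -- A degenerate target is a Dirac mass, while `P` and the nondegenerate Gaussian have no atoms:
  -- both sides are infinite.
  by_cases hw : w = 0
  · subst hw
    have hdirac : ∀ Q : Measure ℝ, IsProbabilityMeasure Q → Q ≪ volume →
        klDiv Q (gaussianReal m' 0) = ∞ := by
      intro Q _ hQ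
      refine klDiv_of_not_ac fun h => ?_
      rw [gaussianReal_zero_var] at h
      have h1 : Q {m'} = 0 := hQ (by simp)
      have h2 : Q {m'}ᶜ = 0 := h (by simp)
      have h3 := measure_add_measure_compl (μ := Q) (measurableSet_singleton m')
      rw [h1, h2, measure_univ] at h3
      simp at h3
    rw [hdirac P inferInstance hvol, hdirac _ inferInstance (gaussianReal_absolutelyContinuous m hv0)]
    simp
  · have hac' : gaussianReal m v ≪ gaussianReal m' w :=
      (gaussianReal_absolutelyContinuous m hv0).trans (gaussianReal_absolutelyContinuous' m' hw)
    -- Chain rule for Radon-Nikodym derivatives; positivity and finiteness `P`-almost everywhere let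
    -- the logarithm split the product.
    have hllr : llr P (gaussianReal m' w) =ᵐ[P] fun z => llr P (gaussianReal m v) z +
        (Real.log (w / v) / 2 + (z - m') ^ 2 / (2 * w) - (z - m) ^ 2 / (2 * v)) := by
      have h1 := (hac.trans hac').ae_le (Measure.rnDeriv_mul_rnDeriv (κ := gaussianReal m' w) hac)
      filter_upwards [h1, hac.ae_le (llr_gaussianReal m hv0 m' hw), Measure.rnDeriv_pos hac,
        hac.ae_le (Measure.rnDeriv_lt_top P (gaussianReal m v)), hac.ae_le (Measure.rnDeriv_pos hac'),
        (hac.trans hac').ae_le (Measure.rnDeriv_lt_top (gaussianReal m v) (gaussianReal m' w))]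
        with z e1 e2 e3 e4 e5 e6
      rw [← e2, llr, llr, llr, ← e1, Pi.mul_apply, ENNReal.toReal_mul, Real.log_mul]
      · exact (ENNReal.toReal_pos e3.ne' e4.ne).ne'
      · exact (ENNReal.toReal_pos e5.ne' e6.ne).ne'
    have hq : Integrable (fun z => Real.log (w / v) / 2 + (z - m') ^ 2 / (2 * w) -
        (z - m) ^ 2 / (2 * v)) P :=
      ((integrable_const _).add ((integrable_quadratic h2 m').div_const _)).sub
        ((integrable_quadratic h2 m).div_const _)
    have hv' : (0 : ℝ) < v := by positivity
    have hw' : (0 : ℝ) < w := by positivity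
    rw [klDiv_gaussianReal m hv0 m' hw, klDiv_of_ac_of_integrable hac hint,
      klDiv_of_ac_of_integrable (hac.trans hac') ((hint.add hq).congr hllr.symm),
      integral_congr_ae hllr, integral_add hint hq, integral_log_gaussianRatio h2 hv0 hm hv,
      ← ENNReal.ofReal_add _ (gaussianKL_nonneg hv' hw')]
    · simp
    · exact integral_llr_add_sub_measure_univ_nonneg hac hint

/-- Convexity of the Kullback-Leibler divergence, for mixtures of Gaussian laws. -/
lemma klDiv_mixture_le {Y : Type*} [MeasurableSpace Y] (κ : Measure Y) [IsProbabilityMeasure κ]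
    {μ : Y → ℝ} {τ : Y → ℝ≥0} (hμ : Measurable μ) (hτ : Measurable τ) (hτ0 : ∀ᵐ y ∂κ, τ y ≠ 0)
    (m : ℝ) {v : ℝ≥0} (hv : v ≠ 0) :
    klDiv (κ.bind fun y => gaussianReal (μ y) (τ y)) (gaussianReal m v) ≤
      ∫⁻ y, ENNReal.ofReal (gaussianKL (μ y) (τ y) m v) ∂κ := by
  have hG : Measurable fun y => gaussianReal (μ y) (τ y) :=
    measurable_gaussianReal.comp (hμ.prodMk hτ)
  let G : Kernel Y ℝ := ⟨fun y => gaussianReal (μ y) (τ y), hG⟩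
  have : IsMarkovKernel G := ⟨fun y => by
    change IsProbabilityMeasure (gaussianReal (μ y) (τ y)); infer_instance⟩
  have hr := measurable_gaussianRatio hμ hτ m v
  -- The joint law of index and sample has the Gaussian ratio as density with respect to the product
  -- measure. Projecting to the sample decreases the divergence, and the joint divergence is the
  -- average of those of the components.
  have hjoint : (κ.prod (gaussianReal m v)).withDensity
      (fun p => gaussianRatio (μ p.1) (τ p.1) m v p.2) = κ ⊗ₘ G := by
    ext s hs
    rw [withDensity_apply _ hs, Measure.compProd_apply hs, ← lintegral_indicator hs,
      lintegral_prod _ (hr.indicator hs).aemeasurable]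
    refine lintegral_congr_ae ?_
    filter_upwards [hτ0] with y hy
    change _ = gaussianReal (μ y) (τ y) (Prod.mk y ⁻¹' s)
    rw [← withDensity_gaussianRatio (μ y) hy m hv, withDensity_apply _ (measurable_prodMk_left hs),
      ← lintegral_indicator (measurable_prodMk_left hs)]
    rfl
  have h1 : κ.bind (fun y => gaussianReal (μ y) (τ y)) = (κ ⊗ₘ G).map Prod.snd :=
    (Measure.snd_compProd κ G).symm
  have h2 : gaussianReal m v = (κ.prod (gaussianReal m v)).map Prod.snd := by
    rw [← Measure.snd, Measure.snd_prod]
  have hfin : IsFiniteMeasure ((κ.prod (gaussianReal m v)).withDensity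
      (fun p => gaussianRatio (μ p.1) (τ p.1) m v p.2)) := by rw [hjoint]; infer_instance
  calc klDiv (κ.bind fun y => gaussianReal (μ y) (τ y)) (gaussianReal m v)
      = klDiv ((κ ⊗ₘ G).map Prod.snd) ((κ.prod (gaussianReal m v)).map Prod.snd) := by
        rw [h1, ← h2]
    _ ≤ klDiv (κ ⊗ₘ G) (κ.prod (gaussianReal m v)) := klDiv_map_le _ _ measurable_snd
    _ = ∫⁻ p, ENNReal.ofReal (klFun (gaussianRatio (μ p.1) (τ p.1) m v p.2).toReal)
          ∂(κ.prod (gaussianReal m v)) := by rw [← hjoint, klDiv_withDensity _ hr]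
    _ = ∫⁻ y, ∫⁻ z, ENNReal.ofReal (klFun (gaussianRatio (μ y) (τ y) m v z).toReal)
          ∂(gaussianReal m v) ∂κ := by
        rw [lintegral_prod]
        exact (ENNReal.measurable_ofReal.comp
          (measurable_klFun.comp hr.ennreal_toReal)).aemeasurable
    _ = ∫⁻ y, ENNReal.ofReal (gaussianKL (μ y) (τ y) m v) ∂κ := by
        refine lintegral_congr_ae ?_
        filter_upwards [hτ0] with y hy
        have : IsFiniteMeasure ((gaussianReal m v).withDensity
            (gaussianRatio (μ y) (τ y) m v)) := by
          rw [withDensity_gaussianRatio _ hy _ hv]; infer_instance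
        rw [← klDiv_gaussianReal _ hy _ hv, ← withDensity_gaussianRatio (μ y) hy m hv,
          klDiv_withDensity _ (measurable_gaussianRatio' _ _ _ _)]

end KullbackLeibler

/-! ### Density criteria by orthogonality, and families of sets that determine a function. -/

section Density

variable {Ω : Type*} [MeasurableSpace Ω]

/-- A linear space of square integrable functions which no nonzero function is orthogonal to is
dense in `L¹`-distance. -/
lemma exists_lintegral_sub_lt_of_orthogonal (μ : Measure Ω) [IsFiniteMeasure μ]
    (V : Submodule ℝ (Ω → ℝ)) (hV : ∀ g ∈ V, MemLp g 2 μ)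
    (hsep : ∀ f : Ω → ℝ, Measurable f → MemLp f 2 μ → (∀ g ∈ V, ∫ x, f x * g x ∂μ = 0) →
      f =ᵐ[μ] 0)
    {F : Ω → ℝ} (hF : MemLp F 2 μ) {ε : ℝ≥0∞} (hε : ε ≠ 0) :
    ∃ g ∈ V, ∫⁻ x, ‖g x - F x‖ₑ ∂μ < ε := by
  let K : Submodule ℝ (Lp ℝ 2 μ) :=
    { carrier := {u | ∃ g ∈ V, u =ᵐ[μ] g}
      zero_mem' := ⟨0, V.zero_mem, Lp.coeFn_zero ..⟩
      add_mem' := by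
        rintro u u' ⟨g, hg, hu⟩ ⟨g', hg', hu'⟩
        exact ⟨g + g', V.add_mem hg hg', (Lp.coeFn_add u u').trans (hu.add hu')⟩
      smul_mem' := by
        rintro c u ⟨g, hg, hu⟩
        exact ⟨c • g, V.smul_mem c hg, (Lp.coeFn_smul c u).trans (hu.const_smul c)⟩ }
  have hK : K.topologicalClosure = ⊤ := by
    rw [Submodule.topologicalClosure_eq_top_iff, Submodule.eq_bot_iff]
    intro u hu
    obtain ⟨f, hfm, hf⟩ := (Lp.aestronglyMeasurable u)
    have h0 : f =ᵐ[μ] 0 := by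
      refine hsep f hfm.measurable ((memLp_congr_ae hf).1 (Lp.memLp u)) fun g hg => ?_
      have h := (Submodule.mem_orthogonal K u).1 hu ((hV g hg).toLp g) ⟨g, hg, (hV g hg).coeFn_toLp⟩
      rw [L2.inner_def] at h
      rw [← h]
      refine integral_congr_ae ?_
      filter_upwards [hf, (hV g hg).coeFn_toLp] with x h1 h2
      rw [h1, h2]; simp
    exact (Lp.eq_zero_iff_ae_eq_zero).2 (hf.trans h0)
  have hmem : hF.toLp F ∈ closure (K : Set (Lp ℝ 2 μ)) := by
    rw [← Submodule.topologicalClosure_coe, hK]; trivial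
  -- The constant comparing the `L¹` norm with the `L²` norm. Below, `C + 1` replaces `C` since `C`
  -- vanishes for the zero measure.
  set C : ℝ≥0∞ := μ Set.univ ^ (1 / (1 : ℝ≥0∞).toReal - 1 / (2 : ℝ≥0∞).toReal) with hC
  have hCtop : C ≠ ∞ := ENNReal.rpow_ne_top_of_nonneg (by norm_num) (measure_ne_top μ _)
  have hε' : ε / (C + 1) ≠ 0 := (ENNReal.div_pos hε (by finiteness)).ne'
  obtain ⟨u, ⟨g, hg, hu⟩, hd⟩ := EMetric.mem_closure_iff.1 hmem _ (pos_iff_ne_zero.2 hε')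
  refine ⟨g, hg, ?_⟩
  rw [edist_comm, edist_eq_enorm_sub, Lp.enorm_def] at hd
  have e : eLpNorm (u - hF.toLp F : Lp ℝ 2 μ) 2 μ = eLpNorm (g - F) 2 μ :=
    eLpNorm_congr_ae ((Lp.coeFn_sub _ _).trans (hu.sub hF.coeFn_toLp))
  have e2 : eLpNorm (fun x => g x - F x) 1 μ ≤ eLpNorm (fun x => g x - F x) 2 μ * C :=
    eLpNorm_le_eLpNorm_mul_rpow_measure_univ (by norm_num) ((hV g hg).1.sub hF.1)
  rw [eLpNorm_one_eq_lintegral_enorm] at e2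
  refine e2.trans_lt (lt_of_le_of_lt ?_ (ENNReal.mul_lt_of_lt_div (e ▸ hd)))
  gcongr
  · exact le_rfl
  · exact le_self_add

/-- Encodes the signed measure of density `f` as a pair of finite measures, so that uniqueness
theorems for finite measures apply. -/
lemma withDensity_pos_eq_neg_iff (μ : Measure Ω) {f : Ω → ℝ} (hf : Integrable f μ)
    {s : Set Ω} (hs : MeasurableSet s) :
    μ.withDensity (fun x => ENNReal.ofReal (f x)) s =
      μ.withDensity (fun x => ENNReal.ofReal (-f x)) s ↔ ∫ x in s, f x ∂μ = 0 := by
  rw [withDensity_apply _ hs, withDensity_apply _ hs,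
    integral_eq_lintegral_pos_part_sub_lintegral_neg_part hf.integrableOn, sub_eq_zero,
    ENNReal.toReal_eq_toReal_iff']
  · exact (hf.integrableOn.lintegral_lt_top).ne
  · exact (hf.integrableOn.neg.lintegral_lt_top).ne

lemma isFiniteMeasure_withDensity_pos (μ : Measure Ω) {f : Ω → ℝ} (hf : Integrable f μ) :
    IsFiniteMeasure (μ.withDensity fun x => ENNReal.ofReal (f x)) :=
  isFiniteMeasure_withDensity (hf.lintegral_lt_top).ne

lemma ae_eq_zero_of_withDensity_pos_eq_neg (μ : Measure Ω) {f : Ω → ℝ} (hf : Integrable f μ)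
    (h : μ.withDensity (fun x => ENNReal.ofReal (f x)) =
      μ.withDensity (fun x => ENNReal.ofReal (-f x))) : f =ᵐ[μ] 0 :=
  hf.ae_eq_zero_of_forall_setIntegral_eq_zero fun _ hs _ =>
    (withDensity_pos_eq_neg_iff μ hf hs).1 (by rw [h])

lemma ae_eq_zero_of_forall_piSystem (μ : Measure Ω) {f : Ω → ℝ} (hf : Integrable f μ)
    {C : Set (Set Ω)} (hgen : ‹MeasurableSpace Ω› = MeasurableSpace.generateFrom C)
    (hC : IsPiSystem C) (huniv : Set.univ ∈ C) (h : ∀ s ∈ C, ∫ x in s, f x ∂μ = 0) :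
    f =ᵐ[μ] 0 := by
  have hm : ∀ s ∈ C, MeasurableSet s := fun s hs => by
    rw [hgen]; exact MeasurableSpace.measurableSet_generateFrom hs
  have := isFiniteMeasure_withDensity_pos μ hf
  refine ae_eq_zero_of_withDensity_pos_eq_neg μ hf (ext_of_generate_finite C hgen hC ?_ ?_)
  · exact fun s hs => (withDensity_pos_eq_neg_iff μ hf (hm s hs)).2 (h s hs)
  · exact (withDensity_pos_eq_neg_iff μ hf (hm _ huniv)).2 (h _ huniv)

/-- The Cramér-Wold argument: half-spaces determine the image of a finite measure under every linear
form, hence its characteristic function, hence the measure. -/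
lemma ae_eq_zero_of_forall_halfspace {n : ℕ} (μ : Measure (Fin n → ℝ)) {f : (Fin n → ℝ) → ℝ}
    (hf : Integrable f μ)
    (h : ∀ (w : Fin n → ℝ) (b : ℝ), ∫ x in {x | 0 ≤ ∑ j, w j * x j + b}, f x ∂μ = 0) :
    f =ᵐ[μ] 0 := by
  have := isFiniteMeasure_withDensity_pos μ hf
  have := isFiniteMeasure_withDensity_pos μ hf.neg
  simp only [Pi.neg_apply] at this
  refine ae_eq_zero_of_withDensity_pos_eq_neg μ hf (Measure.ext_of_charFunDual ?_)
  funext L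
  rw [charFunDual_eq_charFun_map_one, charFunDual_eq_charFun_map_one]
  congr 1
  have hL : Measurable L := L.continuous.measurable
  refine Measure.ext_of_Ici _ _ fun a => ?_
  rw [Measure.map_apply hL measurableSet_Ici, Measure.map_apply hL measurableSet_Ici,
    withDensity_pos_eq_neg_iff μ hf (hL measurableSet_Ici)]
  rw [← h (fun j => L (Pi.single j 1)) (-a)]
  congr 2
  ext x
  have : L x = ∑ j, L (Pi.single j 1) * x j := by
    conv_lhs => rw [pi_eq_sum_univ' x, map_sum]
    refine Finset.sum_congr rfl fun j _ => ?_
    rw [map_smul, smul_eq_mul, mul_comm]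
  simp only [Set.mem_preimage, Set.mem_Ici, Set.mem_ofPred_eq, this]
  constructor <;> intro h <;> linarith

end Density

/-! ### Networks: closure properties, sigmoids, truncation, approximation by one hidden layer. -/

section Networks

/-- Functions of one variable computed by one hidden layer. -/
noncomputable def scalarNets (act : ℝ → ℝ) : Submodule ℝ (ℝ → ℝ) :=
  Submodule.span ℝ (Set.range fun p : ℝ × ℝ => fun t => act (p.1 * t + p.2))

/-- Functions of `n` variables computed by one hidden layer. -/
noncomputable def shallowNets (act : ℝ → ℝ) (n : ℕ) : Submodule ℝ ((Fin n → ℝ) → ℝ) :=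
  Submodule.span ℝ (Set.range fun p : (Fin n → ℝ) × ℝ => fun x => act (∑ j, p.1 j * x j + p.2))

variable {act : ℝ → ℝ}

lemma mem_scalarNets (w b : ℝ) : (fun t => act (w * t + b)) ∈ scalarNets act :=
  Submodule.subset_span ⟨(w, b), rfl⟩

lemma comp_affine_mem_scalarNets {f : ℝ → ℝ} (hf : f ∈ scalarNets act) (w b : ℝ) :
    (fun t => f (w * t + b)) ∈ scalarNets act := by
  have h : (scalarNets act).map (LinearMap.funLeft ℝ ℝ fun t => w * t + b) ≤ scalarNets act := by
    rw [scalarNets, Submodule.map_span_le]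
    rintro _ ⟨p, rfl⟩
    refine Submodule.subset_span ⟨(p.1 * w, p.1 * b + p.2), ?_⟩
    funext t
    simp only [LinearMap.funLeft_apply]
    congr 1; ring
  exact h ⟨f, hf, rfl⟩

lemma comp_affine_mem_shallowNets {n : ℕ} {f : ℝ → ℝ} (hf : f ∈ scalarNets act) (w : Fin n → ℝ)
    (b : ℝ) : (fun x : Fin n → ℝ => f (∑ j, w j * x j + b)) ∈ shallowNets act n := by
  have h : (scalarNets act).map (LinearMap.funLeft ℝ ℝ fun x : Fin n → ℝ => ∑ j, w j * x j + b) ≤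
      shallowNets act n := by
    rw [scalarNets, Submodule.map_span_le]
    rintro _ ⟨p, rfl⟩
    refine Submodule.subset_span ⟨(fun j => p.1 * w j, p.1 * b + p.2), ?_⟩
    funext x
    simp only [LinearMap.funLeft_apply, mul_add, Finset.mul_sum]
    congr 1
    rw [add_assoc]
    congr 1
    exact Finset.sum_congr rfl fun _ _ => by ring
  exact h ⟨f, hf, rfl⟩

lemma continuous_of_mem_shallowNets {n : ℕ} (hact : Continuous act) {f : (Fin n → ℝ) → ℝ}
    (hf : f ∈ shallowNets act n) : Continuous f := by
  induction hf using Submodule.span_induction with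
  | mem f hf => obtain ⟨p, rfl⟩ := hf; fun_prop
  | zero => exact continuous_const
  | add f g _ _ hf hg => exact hf.add hg
  | smul c f _ hf => exact hf.const_smul c

/-- A family of functions in the span of the neurons is computed by a common hidden layer. -/
lemma exists_layers {n m : ℕ} (g : (Fin n → ℝ) → Fin m → ℝ)
    (hg : ∀ i, (fun x => g x i) ∈ shallowNets act n) :
    ∃ (K : ℕ) (hidden : Layer n K) (out : Layer K m),
      ∀ x, g x = out.eval fun i => act (hidden.eval x i) := by
  classical
  have h : ∀ i, ∃ c : ((Fin n → ℝ) × ℝ) →₀ ℝ, (c.sum fun p a => a •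
      fun x : Fin n → ℝ => act (∑ j, p.1 j * x j + p.2)) = fun x => g x i := fun i =>
    Finsupp.mem_span_range_iff_exists_finsupp.1 (hg i)
  choose c hc using h
  -- One hidden neuron for every weight-bias pair used by some output; outputs that do not use a
  -- pair give it coefficient zero.
  let s : Finset ((Fin n → ℝ) × ℝ) := Finset.univ.biUnion fun i => (c i).support
  let e := s.equivFin
  refine ⟨s.card, ⟨fun l j => (e.symm l).1.1 j, fun l => (e.symm l).1.2⟩,
    ⟨fun i l => c i (e.symm l).1, 0⟩, fun x => ?_⟩
  funext i
  rw [← congrFun (hc i) x, Finsupp.sum_of_support_subset (s := s)]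
  · simp only [Finset.sum_apply, Pi.smul_apply, smul_eq_mul, Layer.eval, Pi.zero_apply, add_zero]
    rw [← Finset.sum_coe_sort s]
    exact (Equiv.sum_comp e.symm fun p : s => c i p.1 * act (∑ j, p.1.1 j * x j + p.1.2)).symm
  · exact Finset.subset_biUnion_of_mem (fun i => (c i).support) (Finset.mem_univ i)
  · simp

lemma exists_shallow {n m : ℕ} (g : (Fin n → ℝ) → Fin m → ℝ)
    (hg : ∀ i, (fun x => g x i) ∈ shallowNets act n) :
    ∃ net : MLP n m, ∀ x, net.eval act x = g x := by
  obtain ⟨K, hidden, out, h⟩ := exists_layers g hg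
  exact ⟨.shallow hidden out, fun x => (h x).symm⟩

/-- Composition of affine maps. -/
def Layer.comp {n m k : ℕ} (l' : Layer m k) (l : Layer n m) : Layer n k :=
  ⟨l'.weight * l.weight, l'.eval l.bias⟩

lemma Layer.eval_comp {n m k : ℕ} (l' : Layer m k) (l : Layer n m) (x : Fin n → ℝ) :
    (l'.comp l).eval x = l'.eval (l.eval x) := by
  funext i
  simp only [Layer.eval, Layer.comp, Matrix.mul_apply, Finset.sum_mul, mul_add, Finset.mul_sum,
    Finset.sum_add_distrib]
  rw [Finset.sum_comm]
  simp only [mul_assoc, add_assoc]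

/-- The linear output layer computing `g` is absorbed into the hidden layer of `f`, because affine
maps compose. -/
lemma exists_deep {n m k : ℕ} (g : (Fin n → ℝ) → Fin m → ℝ)
    (hg : ∀ i, (fun x => g x i) ∈ shallowNets act n) (f : (Fin m → ℝ) → Fin k → ℝ)
    (hf : ∀ i, (fun x => f x i) ∈ shallowNets act m) :
    ∃ net : MLP n k, ∀ x, net.eval act x = f (g x) := by
  obtain ⟨K, h1, o1, e1⟩ := exists_layers g hg
  obtain ⟨K', h2, o2, e2⟩ := exists_layers f hf
  refine ⟨.deep h1 (.shallow (h2.comp o1) o2), fun x => ?_⟩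
  simp only [MLP.eval, Layer.eval_comp, e2, e1]

lemma continuous_layer {n m : ℕ} (l : Layer n m) : Continuous l.eval := by
  unfold Layer.eval; fun_prop

lemma continuous_mlp (hact : Continuous act) : ∀ {n m : ℕ} (net : MLP n m),
    Continuous (net.eval act)
  | _, _, .shallow hidden out => by
    have h1 := continuous_layer hidden
    have h2 := continuous_layer out
    exact h2.comp (continuous_pi fun i => hact.comp ((continuous_apply i).comp h1))
  | _, _, .deep hidden rest => by
    have h1 := continuous_layer hidden
    have h2 := continuous_mlp hact rest
    exact h2.comp (continuous_pi fun i => hact.comp ((continuous_apply i).comp h1))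

/-- The zero function has the zero asymptote at both ends, against the assumption that the
asymptotes differ. -/
lemma IsActivation.exists_ne_zero (hact : IsActivation act) : ∃ t, act t ≠ 0 := by
  obtain ⟨-, a₁, b₁, a₂, b₂, hne, h1, h2⟩ := hact
  by_contra! h
  simp only [h, zero_sub] at h1 h2
  have key : ∀ (a b : ℝ) (l : Filter ℝ) [l.NeBot], Tendsto (fun x => -(a * x + b)) l (𝓝 0) →
      Tendsto (fun x : ℝ => x + 1) l l → a = 0 ∧ b = 0 := by
    intro a b l _ h hl
    -- Differencing by a unit shift isolates the slope.
    have h3 := (h.sub (h.comp hl))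
    have h4 : (fun x : ℝ => -(a * x + b) - ((fun x : ℝ => -(a * x + b)) ∘ fun x => x + 1) x) =
        fun _ => a := by funext x; simp only [Function.comp]; ring
    rw [h4, sub_zero] at h3
    have ha : a = 0 := tendsto_nhds_unique tendsto_const_nhds h3
    subst ha
    simp only [zero_mul, zero_add] at h
    exact ⟨rfl, neg_eq_zero.1 (tendsto_nhds_unique tendsto_const_nhds h)⟩
  have e1 := key a₁ b₁ _ h1 (tendsto_atTop_add_const_right _ _ tendsto_id)
  have e2 := key a₂ b₂ _ h2 (tendsto_atBot_add_const_right _ _ tendsto_id)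
  exact hne (by rw [e1.1, e1.2, e2.1, e2.2])

/-- A neuron with input weight zero is constant, and its bias can be chosen to make it nonzero. -/
lemma const_mem_scalarNets (hact : IsActivation act) (c : ℝ) : (fun _ => c) ∈ scalarNets act := by
  obtain ⟨t₀, ht₀⟩ := hact.exists_ne_zero
  have := Submodule.smul_mem (scalarNets act) (c * (act t₀)⁻¹) (mem_scalarNets 0 t₀)
  convert this using 1
  funext t
  simp [ht₀]

/-- The neurons of any admissible activation function span a sigmoidal function. -/
lemma exists_sigmoid (hact : IsActivation act) : ∃ σ ∈ scalarNets act, Continuous σ ∧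
    Tendsto σ atTop (𝓝 1) ∧ Tendsto σ atBot (𝓝 0) := by
  have hconst := const_mem_scalarNets hact
  obtain ⟨hc, a₁, b₁, a₂, b₂, hne, h1, h2⟩ := hact
  -- A combination of two neurons whose linear growth cancels at both ends but whose limits differ.
  -- For equal slopes, 2 act(t) - act(2t) has the two intercepts as limits; for different slopes,
  -- act(t + 1) - act(t) has the two slopes as limits.
  obtain ⟨w, hw, b, c, d, hcd⟩ : ∃ w : ℝ, 0 < w ∧ ∃ b c d : ℝ,
      c * a₁ * w + d * a₁ = 0 ∧ c * a₂ * w + d * a₂ = 0 ∧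
      c * (a₁ * b + b₁) + d * b₁ ≠ c * (a₂ * b + b₂) + d * b₂ := by
    by_cases ha : a₁ = a₂
    · subst ha
      have hb : b₁ ≠ b₂ := fun h => hne (by rw [h])
      refine ⟨2, by norm_num, 0, -1, 2, by ring, by ring, fun h => hb ?_⟩
      linarith
    · refine ⟨1, one_pos, 1, 1, -1, by ring, by ring, fun h => ha ?_⟩
      linarith
  obtain ⟨e1, e2, e3⟩ := hcd
  set L₁ := c * (a₁ * b + b₁) + d * b₁ with hL₁
  set L₂ := c * (a₂ * b + b₂) + d * b₂ with hL₂
  let p : ℝ → ℝ := fun t => c * act (w * t + b) + d * act (1 * t + 0)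
  have hp : p ∈ scalarNets act :=
    Submodule.add_mem _ (Submodule.smul_mem _ c (mem_scalarNets w b))
      (Submodule.smul_mem _ d (mem_scalarNets 1 0))
  have ht : ∀ t, p t = c * (act (w * t + b) - (a₁ * (w * t + b) + b₁)) +
      d * (act t - (a₁ * t + b₁)) + L₁ := by
    intro t
    simp only [p, one_mul, add_zero, hL₁]
    linear_combination t * e1
  have hb : ∀ t, p t = c * (act (w * t + b) - (a₂ * (w * t + b) + b₂)) +
      d * (act t - (a₂ * t + b₂)) + L₂ := by
    intro t
    simp only [p, one_mul, add_zero, hL₂]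
    linear_combination t * e2
  have lt : Tendsto p atTop (𝓝 L₁) := by
    have hs : Tendsto (fun t => w * t + b) atTop atTop :=
      tendsto_atTop_add_const_right _ _ (tendsto_id.const_mul_atTop hw)
    have := (((h1.comp hs).const_mul c).add (h1.const_mul d)).add_const L₁
    simp only [mul_zero, zero_add] at this
    exact this.congr fun t => (ht t).symm
  have lb : Tendsto p atBot (𝓝 L₂) := by
    have hs : Tendsto (fun t => w * t + b) atBot atBot :=
      tendsto_atBot_add_const_right _ _ (tendsto_id.const_mul_atBot hw)
    have := (((h2.comp hs).const_mul c).add (h2.const_mul d)).add_const L₂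
    simp only [mul_zero, zero_add] at this
    exact this.congr fun t => (hb t).symm
  have h12 : L₁ - L₂ ≠ 0 := sub_ne_zero.2 e3
  refine ⟨fun t => (L₁ - L₂)⁻¹ * (p t + -L₂), Submodule.smul_mem _ _
    (Submodule.add_mem _ hp (hconst _)), by fun_prop, ?_, ?_⟩
  · have := (lt.add_const (-L₂)).const_mul (L₁ - L₂)⁻¹
    rwa [← sub_eq_add_neg, inv_mul_cancel₀ h12] at this
  · have := (lb.add_const (-L₂)).const_mul (L₁ - L₂)⁻¹
    rwa [← sub_eq_add_neg, sub_self, mul_zero] at this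

lemma exists_bound_of_sigmoid {σ : ℝ → ℝ} (hc : Continuous σ) (h1 : Tendsto σ atTop (𝓝 1))
    (h0 : Tendsto σ atBot (𝓝 0)) : ∃ M, 0 < M ∧ ∀ t, |σ t| ≤ M := by
  obtain ⟨a, ha⟩ := (h1.eventually (Metric.ball_mem_nhds 1 one_pos)).exists_forall_of_atTop
  obtain ⟨b, hb⟩ := (h0.eventually (Metric.ball_mem_nhds 0 one_pos)).exists_forall_of_atBot
  obtain ⟨M, hM⟩ := (isCompact_Icc (a := b) (b := a)).exists_bound_of_continuousOn hc.continuousOn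
  refine ⟨max M 2, by positivity, fun t => ?_⟩
  by_cases h : a ≤ t
  · have := ha t h
    rw [Real.dist_eq, abs_lt] at this
    exact le_max_of_le_right (abs_le.2 ⟨by linarith, by linarith⟩)
  · by_cases h' : t ≤ b
    · have := hb t h'
      rw [Real.dist_eq, abs_lt] at this
      exact le_max_of_le_right (abs_le.2 ⟨by linarith, by linarith⟩)
    · exact le_max_of_le_left (hM t ⟨by linarith, by linarith⟩)

/-- Consecutive unit ramps add up to one long ramp; this cuts the truncation to `[0, 1]` into `K`
small steps, each replaced by a sigmoid. -/
lemma sum_clamp (s : ℝ) (K : ℕ) :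
    ∑ j ∈ Finset.range K, max 0 (min (s - j) 1) = max 0 (min s K) := by
  induction K with
  | zero => simp
  | succ K ih =>
    rw [Finset.sum_range_succ, ih]
    have : (0 : ℝ) ≤ K := Nat.cast_nonneg K
    push_cast
    rcases le_total s K with h | h
    · rw [min_eq_left h, min_eq_left (by linarith : s ≤ K + 1),
        min_eq_left (by linarith : s - K ≤ 1), max_eq_left (by linarith : s - K ≤ 0), add_zero]
    · rw [min_eq_right h, max_eq_right this, max_eq_right (le_min (by linarith) zero_le_one),
        max_eq_right (le_min (by linarith) (by linarith)), ← min_add_add_left]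
      congr 1
      ring

/-- The truncation to `[0, 1]` is uniformly approximated on the real line by one hidden layer. -/
lemma exists_unit_clamp (hact : IsActivation act) {δ : ℝ} (hδ : 0 < δ) :
    ∃ g ∈ scalarNets act, ∀ t, |g t - max 0 (min t 1)| ≤ δ := by
  obtain ⟨σ, hσ, hc, h1, h0⟩ := exists_sigmoid hact
  obtain ⟨M, hM0, hM⟩ := exists_bound_of_sigmoid hc h1 h0
  obtain ⟨a, ha⟩ := (h1.eventually
    (Metric.closedBall_mem_nhds 1 (half_pos hδ))).exists_forall_of_atTop
  obtain ⟨b, hb⟩ := (h0.eventually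
    (Metric.closedBall_mem_nhds 0 (half_pos hδ))).exists_forall_of_atBot
  simp only [Real.dist_eq, sub_zero] at ha hb
  -- For each `t` only the step of index `⌊K * t⌋₊` can be in transition, where the error is at most
  -- `M + 1`; division by `K` brings this below `δ / 2`.
  obtain ⟨K, hK⟩ := exists_nat_gt ((M + 1) / (δ / 2))
  have hK0 : (0 : ℝ) < K := lt_trans (by positivity) hK
  have hKδ : M + 1 ≤ K * (δ / 2) := by
    rw [div_lt_iff₀ (half_pos hδ)] at hK; exact hK.le
  -- The steepness: at distance at least 1/2 from its centre `j + 1/2`, the rescaled sigmoid is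
  -- already beyond the threshold `a` or `b`.
  set L : ℝ := 2 * (|a| + |b|) with hL
  have hL0 : 0 ≤ L := by positivity
  refine ⟨fun t => (K : ℝ)⁻¹ * ∑ j ∈ Finset.range K, σ (L * K * t + -(L * (j + 1 / 2))), ?_, ?_⟩
  · have : (fun t => (K : ℝ)⁻¹ * ∑ j ∈ Finset.range K, σ (L * K * t + -(L * (j + 1 / 2)))) =
        (K : ℝ)⁻¹ • ∑ j ∈ Finset.range K, fun t => σ (L * K * t + -(L * (j + 1 / 2))) := by
      funext t; simp [Finset.sum_apply]
    rw [this]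
    exact Submodule.smul_mem _ _ (Submodule.sum_mem _ fun j _ => comp_affine_mem_scalarNets hσ _ _)
  · intro t
    have hterm : ∀ j : ℕ, |σ (L * K * t + -(L * (j + 1 / 2))) - max 0 (min (K * t - j) 1)| ≤
        δ / 2 + if j = ⌊K * t⌋₊ then M + 1 else 0 := by
      intro j
      have hite : (0 : ℝ) ≤ if j = ⌊K * t⌋₊ then M + 1 else 0 := by split_ifs <;> positivity
      have earg : L * K * t + -(L * (j + 1 / 2)) = L * (K * t - j - 1 / 2) := by ring
      rw [earg]
      rcases le_or_gt 1 (K * t - j) with h | h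
      · rw [min_eq_right h, max_eq_right zero_le_one]
        have : a ≤ L * (K * t - j - 1 / 2) := by
          have h3 : L * (1 / 2) ≤ L * (K * t - j - 1 / 2) :=
            mul_le_mul_of_nonneg_left (by linarith) hL0
          have := le_abs_self a
          have := abs_nonneg b
          linarith
        linarith [ha _ this]
      · rcases le_or_gt (K * t - j) 0 with h' | h'
        · rw [min_eq_left h.le, max_eq_left h', sub_zero]
          have : L * (K * t - j - 1 / 2) ≤ b := by
            have h3 : L * (K * t - j - 1 / 2) ≤ L * (-(1 / 2)) :=
              mul_le_mul_of_nonneg_left (by linarith) hL0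
            have := neg_abs_le b
            have := abs_nonneg a
            linarith
          linarith [hb _ this]
        · have hj : j = ⌊K * t⌋₊ := by
            symm
            rw [Nat.floor_eq_iff (by have : (0 : ℝ) ≤ j := Nat.cast_nonneg j; linarith)]
            constructor <;> linarith
          rw [if_pos hj, min_eq_left h.le, max_eq_right h'.le]
          have := abs_le.1 (hM (L * (K * t - j - 1 / 2)))
          rw [abs_le]
          constructor <;> linarith
    have hcl : max 0 (min t 1) = (K : ℝ)⁻¹ * ∑ j ∈ Finset.range K, max 0 (min (K * t - j) 1) := by
      rw [sum_clamp, mul_max_of_nonneg _ _ (by positivity), mul_min_of_nonneg _ _ (by positivity)]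
      field_simp
      simp
    rw [hcl, ← mul_sub, ← Finset.sum_sub_distrib, abs_mul, abs_of_pos (inv_pos.2 hK0),
      inv_mul_le_iff₀ hK0]
    refine (Finset.abs_sum_le_sum_abs _ _).trans ((Finset.sum_le_sum fun j _ => hterm j).trans ?_)
    rw [Finset.sum_add_distrib, Finset.sum_const, Finset.card_range, nsmul_eq_mul,
      Finset.sum_ite_eq']
    split_ifs <;> linarith [mul_pos hK0 hδ]

/-- An affine rescaling of the unit case. Uniformity on the whole line, not just on compact sets, is
what later bounds a network at every input. -/
lemma exists_clamp (hact : IsActivation act) {lo hi : ℝ} (h : lo < hi) {δ : ℝ} (hδ : 0 < δ) :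
    ∃ g ∈ scalarNets act, ∀ t, |g t - max lo (min t hi)| ≤ δ := by
  have hd : 0 < hi - lo := sub_pos.2 h
  obtain ⟨g, hg, hgδ⟩ := exists_unit_clamp hact (div_pos hδ hd)
  refine ⟨fun t => (hi - lo) * g ((hi - lo)⁻¹ * t + -(lo / (hi - lo))) + lo,
    Submodule.add_mem _ (Submodule.smul_mem _ _ (comp_affine_mem_scalarNets hg _ _))
      (const_mem_scalarNets hact _), fun t => ?_⟩
  set s := (hi - lo)⁻¹ * t + -(lo / (hi - lo)) with hs
  have hts : t = (hi - lo) * s + lo := by rw [hs]; field_simp; ring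
  have e : max lo (min t hi) = (hi - lo) * max 0 (min s 1) + lo := by
    rw [mul_max_of_nonneg _ _ hd.le, mul_min_of_nonneg _ _ hd.le, ← max_add_add_right,
      ← min_add_add_right, ← hts]
    simp
  rw [e, add_sub_add_right_eq_sub, ← mul_sub, abs_mul, abs_of_pos hd]
  have := mul_le_mul_of_nonneg_left (hgδ s) hd.le
  rwa [mul_div_cancel₀ _ hd.ne'] at this

/-- One hidden layer is enough to approximate square integrable functions. -/
lemma exists_shallowNets_lintegral_lt (hact : IsActivation act) {n : ℕ} (μ : Measure (Fin n → ℝ))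
    [IsFiniteMeasure μ] {F : (Fin n → ℝ) → ℝ} (hF : MemLp F 2 μ) {ε : ℝ≥0∞} (hε : ε ≠ 0) :
    ∃ g ∈ shallowNets act n, ∫⁻ x, ‖g x - F x‖ₑ ∂μ < ε := by
  obtain ⟨σ, hσ, hc, h1, h0⟩ := exists_sigmoid hact
  obtain ⟨M, hM0, hM⟩ := exists_bound_of_sigmoid hc h1 h0
  -- Spanned by the bounded sigmoid and not by `act`, so that its elements are square integrable for
  -- every finite measure.
  let V : Submodule ℝ ((Fin n → ℝ) → ℝ) := Submodule.span ℝ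
    (Set.range fun p : (Fin n → ℝ) × ℝ => fun x => σ (∑ j, p.1 j * x j + p.2))
  have hVle : V ≤ shallowNets act n := by
    refine Submodule.span_le.2 ?_
    rintro _ ⟨p, rfl⟩
    exact comp_affine_mem_shallowNets hσ _ _
  suffices h : (∀ g ∈ V, MemLp g 2 μ) ∧ ∀ f : (Fin n → ℝ) → ℝ, Measurable f → MemLp f 2 μ →
      (∀ g ∈ V, ∫ x, f x * g x ∂μ = 0) → f =ᵐ[μ] 0 by
    obtain ⟨g, hg, hgε⟩ := exists_lintegral_sub_lt_of_orthogonal μ V h.1 h.2 hF hε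
    exact ⟨g, hVle hg, hgε⟩
  refine ⟨fun g hg => ?_, ?_⟩
  · induction hg using Submodule.span_induction with
    | mem f hf =>
      obtain ⟨p, rfl⟩ := hf
      refine MemLp.of_bound (Continuous.aestronglyMeasurable (by fun_prop)) M (ae_of_all _ fun x => ?_)
      exact hM _
    | zero => exact MemLp.zero
    | add f g _ _ hf hg => exact hf.add hg
    | smul c f _ hf => exact hf.const_smul c
  · intro f hfm hf2 horth
    have hf1 : Integrable f μ := hf2.integrable (by norm_num)
    refine ae_eq_zero_of_forall_halfspace μ hf1 fun w b => ?_
    let ℓ : (Fin n → ℝ) → ℝ := fun x => ∑ j, w j * x j + b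
    have hℓ : Continuous ℓ := by fun_prop
    -- The argument tends to +∞ where `ℓ ≥ 0`, the lower-order term `k` taking care of the boundary
    -- `ℓ = 0`, and to -∞ where `ℓ < 0`. Hence the sigmoid converges to the indicator of the closed
    -- half-space.
    have hzero : ∀ k : ℕ, ∫ x, f x * σ ((k : ℝ) ^ 2 * ℓ x + k) ∂μ = 0 := by
      intro k
      have := horth (fun x => σ (∑ j, ((k : ℝ) ^ 2 * w j) * x j + ((k : ℝ) ^ 2 * b + k)))
        (Submodule.subset_span ⟨(_, _), rfl⟩)
      rw [← this]
      congr 1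
      funext x
      simp only [ℓ, mul_add, Finset.mul_sum, mul_assoc, add_assoc]
    have hlim : Tendsto (fun k : ℕ => ∫ x, f x * σ ((k : ℝ) ^ 2 * ℓ x + k) ∂μ) atTop
        (𝓝 (∫ x, {x | 0 ≤ ℓ x}.indicator f x ∂μ)) := by
      refine tendsto_integral_of_dominated_convergence (fun x => ‖f x‖ * M) ?_
        (hf1.norm.mul_const M) ?_ ?_
      · intro k
        exact (hfm.mul (by fun_prop)).aestronglyMeasurable
      · intro k
        refine ae_of_all _ fun x => ?_
        rw [norm_mul]
        exact mul_le_mul_of_nonneg_left (hM _) (norm_nonneg _)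
      · refine ae_of_all _ fun x => ?_
        have hk : Tendsto (fun k : ℕ => (k : ℝ)) atTop atTop := tendsto_natCast_atTop_atTop
        by_cases hx : 0 ≤ ℓ x
        · rw [Set.indicator_of_mem (by exact hx)]
          have : Tendsto (fun k : ℕ => (k : ℝ) ^ 2 * ℓ x + k) atTop atTop :=
            tendsto_atTop_mono (fun k => by have : 0 ≤ (k : ℝ) ^ 2 * ℓ x := by positivity
                                            linarith) hk
          simpa using (h1.comp this).const_mul (f x)
        · rw [Set.indicator_of_notMem (by exact hx)]
          have hx' : ℓ x < 0 := not_le.1 hx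
          have : Tendsto (fun k : ℕ => (k : ℝ) ^ 2 * ℓ x + k) atTop atBot := by
            have e : (fun k : ℕ => (k : ℝ) ^ 2 * ℓ x + k) = fun k : ℕ => (k : ℝ) * (k * ℓ x + 1) := by
              funext k; ring
            rw [e]
            exact hk.atTop_mul_atBot₀ (tendsto_atBot_add_const_right _ _ (hk.atTop_mul_const_of_neg hx'))
          simpa using (h0.comp this).const_mul (f x)
    simp only [hzero] at hlim
    have hset : MeasurableSet {x | 0 ≤ ℓ x} := measurableSet_le measurable_const hℓ.measurable
    rw [integral_indicator hset] at hlim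
    exact (tendsto_nhds_unique tendsto_const_nhds hlim).symm

end Networks

/-! ### Vehicle sets: measurability of sums and codes with integer values. -/

section Observations

variable {N d₁ d₂ d₃ k : ℕ}

lemma measurable_count {B : Set (Fin d₁ → ℝ)} (hB : MeasurableSet B) :
    Measurable (VehicleSet.count (N := N) B) := by
  rw [measurable_iff_comap_le]
  exact le_iSup (fun B : {B : Set (Fin d₁ → ℝ) // MeasurableSet B} =>
    MeasurableSpace.comap (VehicleSet.count (N := N) B.1) ⊤) ⟨B, hB⟩

/-- The counting measure of the vehicles. -/
noncomputable def countMeasure (X : VehicleSet N d₁) : Measure (Fin d₁ → ℝ) :=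
  (X.1.map fun x => Measure.dirac x).sum

lemma multiset_dirac_apply (X : Multiset (Fin d₁ → ℝ)) {B : Set (Fin d₁ → ℝ)}
    (hB : MeasurableSet B) [DecidablePred fun x => x ∈ B] :
    (X.map fun x => Measure.dirac x).sum B = (X.countP fun x => x ∈ B : ℕ) := by
  induction X using Multiset.induction_on with
  | empty => simp
  | cons a X ih =>
    rw [Multiset.map_cons, Multiset.sum_cons, Measure.add_apply, ih, Multiset.countP_cons,
      Measure.dirac_apply' _ hB]
    by_cases h : a ∈ B <;> simp [h, add_comm]

lemma countMeasure_apply (X : VehicleSet N d₁) {B : Set (Fin d₁ → ℝ)} (hB : MeasurableSet B) :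
    countMeasure X B = (VehicleSet.count B X : ℕ) := by
  classical
  rw [countMeasure, multiset_dirac_apply _ hB, VehicleSet.count]

lemma countMeasure_univ (X : VehicleSet N d₁) : countMeasure X Set.univ = X.1.card := by
  rw [countMeasure_apply X MeasurableSet.univ, VehicleSet.count]
  simp

/-- The counting measures of the vehicles, as a kernel. -/
noncomputable def countKernel (N d₁ : ℕ) : Kernel (VehicleSet N d₁) (Fin d₁ → ℝ) where
  toFun := countMeasure
  measurable' := by
    refine Measure.measurable_of_measurable_coe _ fun B hB => ?_
    simp only [countMeasure_apply _ hB]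
    exact (measurable_of_countable fun n : ℕ => (n : ℝ≥0∞)).comp (measurable_count hB)

instance : IsFiniteKernel (countKernel N d₁) :=
  ⟨N, ENNReal.natCast_lt_top N, fun X => by
    change countMeasure X Set.univ ≤ _
    rw [countMeasure_univ]; exact_mod_cast X.2.2⟩

lemma lintegral_countKernel (X : VehicleSet N d₁) (f : (Fin d₁ → ℝ) → ℝ≥0∞) :
    ∫⁻ x, f x ∂(countKernel N d₁ X) = (X.1.map f).sum := by
  change ∫⁻ x, f x ∂(countMeasure X) = _
  rw [countMeasure]
  induction X.1 using Multiset.induction_on with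
  | empty => simp
  | cons a X ih =>
    rw [Multiset.map_cons, Multiset.sum_cons, lintegral_add_measure, ih, lintegral_dirac]; simp

lemma integral_countKernel (X : VehicleSet N d₁) (f : (Fin d₁ → ℝ) → ℝ) :
    ∫ x, f x ∂(countKernel N d₁ X) = (X.1.map f).sum := by
  change ∫ x, f x ∂(countMeasure X) = _
  have h : Integrable f (X.1.map fun x => Measure.dirac x).sum ∧
      ∫ x, f x ∂(X.1.map fun x => Measure.dirac x).sum = (X.1.map f).sum := by
    induction X.1 using Multiset.induction_on with
    | empty => simp
    | cons a X ih =>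
      have ha : Integrable f (Measure.dirac a) := integrable_dirac (by simp)
      rw [Multiset.map_cons, Multiset.sum_cons]
      exact ⟨ha.add_measure ih.1, by rw [integral_add_measure ha ih.1, ih.2, integral_dirac]; simp⟩
  exact h.2

/-- The σ-algebra only makes counts measurable; writing the sum as an integral against the counting
kernel extends this to all measurable features. -/
lemma measurable_multiset_sum {f : (Fin d₁ → ℝ) → ℝ} (hf : Measurable f) :
    Measurable fun X : VehicleSet N d₁ => (X.1.map f).sum := by
  simp only [← integral_countKernel]
  exact (StronglyMeasurable.integral_kernel (κ := countKernel N d₁)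
    hf.stronglyMeasurable).measurable

lemma multiset_sum_apply {m : ℕ} (X : Multiset (Fin d₁ → ℝ)) (f : (Fin d₁ → ℝ) → Fin m → ℝ)
    (i : Fin m) : (X.map f).sum i = (X.map fun x => f x i).sum := by
  have := map_multiset_sum (Pi.evalAddMonoidHom (fun _ : Fin m => ℝ) i) (X.map f)
  simpa [Multiset.map_map, Function.comp_def] using this

lemma measurable_append {Ω : Type*} [MeasurableSpace Ω] {m n : ℕ} {f : Ω → Fin m → ℝ}
    {g : Ω → Fin n → ℝ} (hf : Measurable f) (hg : Measurable g) :
    Measurable fun x => Fin.append (f x) (g x) := by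
  refine measurable_pi_lambda _ fun i => ?_
  induction i using Fin.addCases with
  | left i => simp only [Fin.append_left]; exact (measurable_pi_apply i).comp hf
  | right i => simp only [Fin.append_right]; exact (measurable_pi_apply i).comp hg

lemma tendsto_append {ι : Type*} {l : Filter ι} {m n : ℕ} {f : ι → Fin m → ℝ} {a : Fin m → ℝ}
    {b : Fin n → ℝ} (hf : Tendsto f l (𝓝 a)) :
    Tendsto (fun x => Fin.append (f x) b) l (𝓝 (Fin.append a b)) := by
  rw [tendsto_pi_nhds] at hf ⊢
  intro i
  induction i using Fin.addCases with
  | left i => simpa only [Fin.append_left] using hf i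
  | right i => simp only [Fin.append_right]; exact tendsto_const_nhds

variable {act : ℝ → ℝ}

lemma measurable_esc (hact : Continuous act) (φ : MLP d₁ d₃) :
    Measurable (esc (N := N) (d₂ := d₂) act φ) := by
  refine measurable_append (measurable_pi_lambda _ fun i => ?_) measurable_snd
  simp only [multiset_sum_apply]
  exact (measurable_multiset_sum ((continuous_apply i).comp
    (continuous_mlp hact φ)).measurable).comp measurable_fst

lemma measurable_valueOut (hact : Continuous act) (θ : MLP (d₃ + d₂ + k) 2) (φ : MLP d₁ d₃)
    (j : Fin 2) : Measurable fun x : Obs N d₁ d₂ × (Fin k → ℝ) => valueOut act θ φ x j :=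
  ((continuous_apply j).comp (continuous_mlp hact θ)).measurable.comp
    (measurable_append ((measurable_esc hact φ).comp measurable_fst) measurable_snd)

/-! ### Coding of observations by sums -/

/-- The sum of a natural number valued feature of the vehicles. -/
def code (h : (Fin d₁ → ℝ) → ℕ) (X : VehicleSet N d₁) : ℕ := (X.1.map h).sum

lemma cast_code (h : (Fin d₁ → ℝ) → ℕ) (X : VehicleSet N d₁) :
    (code h X : ℝ) = (X.1.map fun x => (h x : ℝ)).sum := by
  rw [code, Nat.cast_multiset_sum, Multiset.map_map]; rfl

lemma code_le {h : (Fin d₁ → ℝ) → ℕ} {b : ℕ} (hb : ∀ x, h x ≤ b) (X : VehicleSet N d₁) :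
    code h X ≤ N * b := by
  refine (Multiset.sum_le_card_nsmul (X.1.map h) b ?_).trans ?_
  · intro y hy
    obtain ⟨x, -, rfl⟩ := Multiset.mem_map.1 hy
    exact hb x
  · rw [Multiset.card_map, smul_eq_mul]
    exact Nat.mul_le_mul_right _ X.2.2

lemma measurable_code {h : (Fin d₁ → ℝ) → ℕ} (hh : Measurable h) :
    Measurable (code (N := N) h) := by
  have h1 : Measurable fun X : VehicleSet N d₁ => (code h X : ℝ) := by
    simp only [cast_code]
    exact measurable_multiset_sum ((measurable_of_countable _).comp hh)
  have h2 : code (N := N) h = fun X => ⌊(code h X : ℝ)⌋₊ := by funext X; simp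
  rw [h2]
  exact Nat.measurable_floor.comp h1

/-- Two features can be recovered from the sum of a third one. -/
lemma exists_code_merge (N : ℕ) {h₁ h₂ : (Fin d₁ → ℝ) → ℕ} (m₁ : Measurable h₁)
    (m₂ : Measurable h₂) {b₁ b₂ : ℕ} (hb₁ : ∀ x, h₁ x ≤ b₁) (hb₂ : ∀ x, h₂ x ≤ b₂) :
    ∃ h : (Fin d₁ → ℝ) → ℕ, Measurable h ∧ (∃ b, ∀ x, h x ≤ b) ∧ ∃ u v : ℕ → ℕ,
      ∀ X : VehicleSet N d₁, code h₁ X = u (code h X) ∧ code h₂ X = v (code h X) := by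
  -- A base larger than any value of the first code, so both sums are the digits of the merged sum:
  -- no carry occurs.
  set q := N * b₁ + 1 with hq
  refine ⟨fun x => h₁ x + q * h₂ x, m₁.add (m₂.const_mul q), ⟨b₁ + q * b₂, fun x =>
    add_le_add (hb₁ x) (Nat.mul_le_mul_left _ (hb₂ x))⟩, fun n => n % q, fun n => n / q, fun X => ?_⟩
  have e : code (fun x => h₁ x + q * h₂ x) X = code h₁ X + q * code h₂ X := by
    simp only [code, Multiset.sum_map_add, Multiset.sum_map_mul_left]
  have hlt : code h₁ X < q := Nat.lt_succ_of_le (code_le hb₁ X)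
  rw [e]
  beta_reduce
  exact ⟨by rw [Nat.add_mul_mod_self_left, Nat.mod_eq_of_lt hlt],
    by rw [Nat.add_mul_div_left _ _ (by omega), Nat.div_eq_of_lt hlt, zero_add]⟩

/-- What remains of an observation-action pair when the vehicles are summed up by a code. -/
def coded (h : (Fin d₁ → ℝ) → ℕ) (x : Obs N d₁ d₂ × (Fin k → ℝ)) :
    ℕ × (Fin d₂ → ℝ) × (Fin k → ℝ) := (code h x.1.1, x.1.2, x.2)

lemma measurable_coded {h : (Fin d₁ → ℝ) → ℕ} (hh : Measurable h) :
    Measurable (coded (N := N) (d₂ := d₂) (k := k) h) := by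
  unfold coded
  exact ((measurable_code hh).comp (measurable_fst.comp measurable_fst)).prodMk
    ((measurable_snd.comp measurable_fst).prodMk measurable_snd)

/-- Functions of an observation-action pair that only depend on a code. -/
def IsCoded (g : Obs N d₁ d₂ × (Fin k → ℝ) → ℝ) : Prop :=
  ∃ h : (Fin d₁ → ℝ) → ℕ, Measurable h ∧ (∃ b, ∀ x, h x ≤ b) ∧
    ∃ G : ℕ × (Fin d₂ → ℝ) × (Fin k → ℝ) → ℝ, Measurable G ∧ ∀ x, g x = G (coded h x)

lemma IsCoded.exists_common {g₁ g₂ : Obs N d₁ d₂ × (Fin k → ℝ) → ℝ} (hg₁ : IsCoded g₁)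
    (hg₂ : IsCoded g₂) :
    ∃ h : (Fin d₁ → ℝ) → ℕ, Measurable h ∧ (∃ b, ∀ x, h x ≤ b) ∧
      ∃ G₁ G₂ : ℕ × (Fin d₂ → ℝ) × (Fin k → ℝ) → ℝ, Measurable G₁ ∧ Measurable G₂ ∧
        (∀ x, g₁ x = G₁ (coded h x)) ∧ ∀ x, g₂ x = G₂ (coded h x) := by
  obtain ⟨h₁, m₁, ⟨b₁, hb₁⟩, G₁, hG₁, e₁⟩ := hg₁
  obtain ⟨h₂, m₂, ⟨b₂, hb₂⟩, G₂, hG₂, e₂⟩ := hg₂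
  obtain ⟨h, hm, hb, u, v, huv⟩ := exists_code_merge N m₁ m₂ hb₁ hb₂
  have hmap : ∀ u : ℕ → ℕ, Measurable fun p : ℕ × (Fin d₂ → ℝ) × (Fin k → ℝ) => (u p.1, p.2) :=
    fun u => ((measurable_of_countable u).comp measurable_fst).prodMk measurable_snd
  refine ⟨h, hm, hb, fun p => G₁ (u p.1, p.2), fun p => G₂ (v p.1, p.2), hG₁.comp (hmap u),
    hG₂.comp (hmap v), fun x => ?_, fun x => ?_⟩
  · rw [e₁, coded, (huv x.1.1).1]; rfl
  · rw [e₂, coded, (huv x.1.1).2]; rfl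

lemma IsCoded.add {g₁ g₂ : Obs N d₁ d₂ × (Fin k → ℝ) → ℝ} (hg₁ : IsCoded g₁) (hg₂ : IsCoded g₂) :
    IsCoded (g₁ + g₂) := by
  obtain ⟨h, hm, hb, G₁, G₂, hG₁, hG₂, e₁, e₂⟩ := hg₁.exists_common hg₂
  exact ⟨h, hm, hb, fun p => G₁ p + G₂ p, hG₁.add hG₂, fun x => by rw [Pi.add_apply, e₁, e₂]⟩

lemma IsCoded.smul {g : Obs N d₁ d₂ × (Fin k → ℝ) → ℝ} (hg : IsCoded g) (c : ℝ) :
    IsCoded (c • g) := by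
  obtain ⟨h, hm, hb, G, hG, e⟩ := hg
  exact ⟨h, hm, hb, fun p => c * G p, hG.const_mul c, fun x => by
    rw [Pi.smul_apply, e, smul_eq_mul]⟩

/-- The events that are determined by a code. -/
def codedSets (N d₁ d₂ k : ℕ) : Set (Set (Obs N d₁ d₂ × (Fin k → ℝ))) :=
  {E | ∃ h : (Fin d₁ → ℝ) → ℕ, Measurable h ∧ (∃ b, ∀ x, h x ≤ b) ∧
    ∃ T : Set (ℕ × (Fin d₂ → ℝ) × (Fin k → ℝ)), MeasurableSet T ∧ E = coded h ⁻¹' T}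

lemma isCoded_indicator {E : Set (Obs N d₁ d₂ × (Fin k → ℝ))} (hE : E ∈ codedSets N d₁ d₂ k) :
    IsCoded (E.indicator fun _ => 1) := by
  obtain ⟨h, hm, hb, T, hT, rfl⟩ := hE
  exact ⟨h, hm, hb, T.indicator fun _ => 1, measurable_const.indicator hT, fun x => rfl⟩

/-- Two events read off different codes can both be read off a merged code. -/
lemma isPiSystem_codedSets : IsPiSystem (codedSets N d₁ d₂ k) := by
  rintro _ ⟨h₁, m₁, ⟨b₁, hb₁⟩, T₁, hT₁, rfl⟩ _ ⟨h₂, m₂, ⟨b₂, hb₂⟩, T₂, hT₂, rfl⟩ -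
  obtain ⟨h, hm, hb, u, v, huv⟩ := exists_code_merge N m₁ m₂ hb₁ hb₂
  have hmap : ∀ u : ℕ → ℕ, Measurable fun p : ℕ × (Fin d₂ → ℝ) × (Fin k → ℝ) => (u p.1, p.2) :=
    fun u => ((measurable_of_countable u).comp measurable_fst).prodMk measurable_snd
  refine ⟨h, hm, hb, (fun p => (u p.1, p.2)) ⁻¹' T₁ ∩ (fun p => (v p.1, p.2)) ⁻¹' T₂,
    (hmap u hT₁).inter (hmap v hT₂), ?_⟩
  ext x
  simp only [Set.mem_inter_iff, Set.mem_preimage, coded, (huv x.1.1).1, (huv x.1.1).2]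

lemma univ_mem_codedSets : Set.univ ∈ codedSets N d₁ d₂ k :=
  ⟨fun _ => 0, measurable_const, ⟨0, fun _ => le_rfl⟩, Set.univ, MeasurableSet.univ, by simp⟩

lemma measurableSet_of_mem_codedSets {E : Set (Obs N d₁ d₂ × (Fin k → ℝ))}
    (hE : E ∈ codedSets N d₁ d₂ k) : MeasurableSet E := by
  obtain ⟨h, hm, -, T, hT, rfl⟩ := hE
  exact measurable_coded hm hT

/-- The count of vehicles in `B` is the code of the indicator of `B`, and such counts generate; the
other coordinates are visible under the zero code. -/
lemma generateFrom_codedSets :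
    (inferInstance : MeasurableSpace (Obs N d₁ d₂ × (Fin k → ℝ))) =
      MeasurableSpace.generateFrom (codedSets N d₁ d₂ k) := by
  classical
  refine le_antisymm ?_ (MeasurableSpace.generateFrom_le fun E hE =>
    measurableSet_of_mem_codedSets hE)
  have h2 : ∀ T : Set (ℕ × (Fin d₂ → ℝ) × (Fin k → ℝ)), MeasurableSet T →
      ∀ h : (Fin d₁ → ℝ) → ℕ, Measurable h → (∃ b, ∀ x, h x ≤ b) →
      MeasurableSet[MeasurableSpace.generateFrom (codedSets N d₁ d₂ k)] (coded h ⁻¹' T) :=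
    fun T hT h hm hb => MeasurableSpace.measurableSet_generateFrom ⟨h, hm, hb, T, hT, rfl⟩
  have h3 : ∀ B : Set (Fin d₁ → ℝ), MeasurableSet B → ∀ s : Set ℕ,
      MeasurableSet[MeasurableSpace.generateFrom (codedSets N d₁ d₂ k)]
        ((fun x : Obs N d₁ d₂ × (Fin k → ℝ) => VehicleSet.count B x.1.1) ⁻¹' s) := by
    intro B hB s
    have hm : Measurable (B.indicator fun _ => (1 : ℕ)) := measurable_const.indicator hB
    have hs : MeasurableSet s := MeasurableSet.of_discrete
    convert h2 _ (measurable_fst hs) (B.indicator fun _ => 1) hm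
      ⟨1, fun x => Set.indicator_le_self' (by simp) x⟩ using 1
    ext x
    simp only [Set.mem_preimage, coded, code, VehicleSet.count]
    have : ∀ X : Multiset (Fin d₁ → ℝ), (X.map (B.indicator fun _ => 1)).sum =
        X.countP (fun y => y ∈ B) := by
      intro X
      induction X using Multiset.induction_on with
      | empty => simp
      | cons a X ih =>
        rw [Multiset.map_cons, Multiset.sum_cons, ih, Multiset.countP_cons]
        by_cases h : a ∈ B <;> simp [h, add_comm]
    rw [this]
  refine sup_le ?_ ?_
  · rw [MeasurableSpace.comap_le_iff_le_map]
    refine sup_le ?_ ?_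
    · rw [MeasurableSpace.comap_le_iff_le_map]
      refine iSup_le fun B => ?_
      rintro _ ⟨s, -, rfl⟩
      exact h3 B.1 B.2 s
    · rintro _ ⟨s, hs, rfl⟩
      exact h2 ((fun p => p.2.1) ⁻¹' s) (measurable_fst.comp measurable_snd hs) (fun _ => 0)
        measurable_const ⟨0, fun _ => le_rfl⟩
  · rintro _ ⟨s, hs, rfl⟩
    exact h2 ((fun p => p.2.2) ⁻¹' s) (measurable_snd.comp measurable_snd hs) (fun _ => 0)
      measurable_const ⟨0, fun _ => le_rfl⟩

/-- Functions that only depend on a code are dense. -/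
lemma exists_isCoded_lintegral_lt (ρ : Measure (Obs N d₁ d₂ × (Fin k → ℝ))) [IsFiniteMeasure ρ]
    {F : Obs N d₁ d₂ × (Fin k → ℝ) → ℝ} (hF : MemLp F 2 ρ) {ε : ℝ≥0∞} (hε : ε ≠ 0) :
    ∃ g, IsCoded g ∧ Measurable g ∧ ∫⁻ x, ‖g x - F x‖ₑ ∂ρ < ε := by
  let V : Submodule ℝ (Obs N d₁ d₂ × (Fin k → ℝ) → ℝ) := Submodule.span ℝ
    (Set.range fun E : codedSets N d₁ d₂ k => E.1.indicator fun _ => 1)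
  have hV : ∀ g ∈ V, IsCoded g ∧ Measurable g ∧ MemLp g 2 ρ := by
    intro g hg
    induction hg using Submodule.span_induction with
    | mem f hf =>
      obtain ⟨E, rfl⟩ := hf
      have hE := measurableSet_of_mem_codedSets E.2
      exact ⟨isCoded_indicator E.2, measurable_const.indicator hE,
        (memLp_const 1).indicator hE⟩
    | zero =>
      refine ⟨?_, measurable_const, MemLp.zero⟩
      exact ⟨fun _ => 0, measurable_const, ⟨0, fun _ => le_rfl⟩, fun _ => 0, measurable_const,
        fun _ => rfl⟩
    | add f g _ _ hf hg => exact ⟨hf.1.add hg.1, hf.2.1.add hg.2.1, hf.2.2.add hg.2.2⟩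
    | smul c f _ hf => exact ⟨hf.1.smul c, hf.2.1.const_smul c, hf.2.2.const_smul c⟩
  obtain ⟨g, hg, hgε⟩ := exists_lintegral_sub_lt_of_orthogonal ρ V (fun g hg => (hV g hg).2.2)
    (fun f hfm hf2 horth => by
      refine ae_eq_zero_of_forall_piSystem ρ (hf2.integrable (by norm_num)) generateFrom_codedSets
        isPiSystem_codedSets univ_mem_codedSets fun E hE => ?_
      have h := horth _ (Submodule.subset_span ⟨⟨E, hE⟩, rfl⟩)
      rw [← integral_indicator (measurableSet_of_mem_codedSets hE), ← h]
      congr 1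
      funext x
      by_cases hx : x ∈ E <;> simp [hx]) hF hε
  exact ⟨g, (hV g hg).1, (hV g hg).2.1, hgε⟩

end Observations

/-! ### Universal approximation through sum encodings. -/

section UniversalApproximation

variable {N d₁ d₂ d₃ k : ℕ} {act : ℝ → ℝ}

lemma abs_clamp_sub_clamp_le (lo hi s t : ℝ) :
    |max lo (min s hi) - max lo (min t hi)| ≤ |s - t| := by
  have h1 := abs_max_sub_max_le_abs (min s hi) (min t hi) lo
  have h2 := abs_min_sub_min_le_max s hi t hi
  rw [sub_self, abs_zero, max_eq_left (abs_nonneg _)] at h2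
  rw [max_comm lo, max_comm lo]
  exact h1.trans h2

/-- A measurable feature of the vehicles is approximated by a network, in such a way that the sums
over the vehicles converge almost surely. -/
lemma exists_tendsto_esc (hact : IsActivation act) (ρ : Measure (Obs N d₁ d₂ × (Fin k → ℝ)))
    [IsFiniteMeasure ρ] {h : (Fin d₁ → ℝ) → ℕ} (hh : Measurable h) (hb : ∃ b, ∀ x, h x ≤ b) :
    ∃ φ : ℕ → MLP d₁ d₃, ∀ᵐ x ∂ρ, Tendsto (fun n => esc act (φ n) x.1) atTop
      (𝓝 (Fin.append (fun _ => (code h x.1.1 : ℝ)) x.1.2)) := by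
  obtain ⟨b, hb⟩ := hb
  -- The intensity measure of the vehicles: an `L¹` error of the feature under `ζ` bounds the
  -- expected error of the sum over the vehicles.
  let ζ : Measure (Fin d₁ → ℝ) := (ρ.map fun x => x.1.1).bind (countKernel N d₁)
  have hproj : Measurable fun x : Obs N d₁ d₂ × (Fin k → ℝ) => x.1.1 :=
    measurable_fst.comp measurable_fst
  have hζ : ∀ f : (Fin d₁ → ℝ) → ℝ≥0∞, Measurable f →
      ∫⁻ x, f x ∂ζ = ∫⁻ x, (x.1.1.1.map f).sum ∂ρ := by
    intro f hf
    rw [Measure.lintegral_bind (countKernel N d₁).measurable.aemeasurable hf.aemeasurable,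
      lintegral_map hf.lintegral_kernel hproj]
    simp only [lintegral_countKernel]
  have hmeas : Measurable fun y => (h y : ℝ) := (measurable_of_countable _).comp hh
  have hmem : MemLp (fun y => (h y : ℝ)) 2 ζ := by
    refine MemLp.of_bound hmeas.aestronglyMeasurable b (ae_of_all _ fun y => ?_)
    rw [Real.norm_natCast]
    exact_mod_cast hb y
  have hex : ∀ n : ℕ, ∃ g ∈ shallowNets act d₁, ∫⁻ y, ‖g y - h y‖ₑ ∂ζ < ((n : ℝ≥0∞) + 1)⁻¹ :=
    fun n => exists_shallowNets_lintegral_lt hact ζ hmem (ENNReal.inv_ne_zero.2 (by finiteness))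
  choose g hg hgε using hex
  have hgc : ∀ n, Continuous (g n) := fun n => continuous_of_mem_shallowNets hact.1 (hg n)
  -- All feature coordinates carry the same scalar function.
  have hnet : ∀ n, ∃ net : MLP d₁ d₃, ∀ x, net.eval act x = fun _ => g n x := fun n =>
    exists_shallow (fun x _ => g n x) fun _ => hg n
  choose net hnet using hnet
  let S : ℕ → Obs N d₁ d₂ × (Fin k → ℝ) → ℝ := fun n x => (x.1.1.1.map (g n)).sum
  let S' : Obs N d₁ d₂ × (Fin k → ℝ) → ℝ := fun x => code h x.1.1
  have hS : ∀ n, Measurable (S n) := fun n =>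
    (measurable_multiset_sum (hgc n).measurable).comp hproj
  have hS' : Measurable S' :=
    (measurable_of_countable fun n : ℕ => (n : ℝ)).comp ((measurable_code hh).comp hproj)
  have hle : ∀ n, eLpNorm (S n - S') 1 ρ ≤ ((n : ℝ≥0∞) + 1)⁻¹ := by
    intro n
    rw [eLpNorm_one_eq_lintegral_enorm]
    refine le_trans ?_ (hgε n).le
    have hm : Measurable fun y => ‖g n y - h y‖ₑ := ((hgc n).measurable.sub hmeas).enorm
    rw [hζ _ hm]
    refine lintegral_mono fun x => ?_
    simp only [S, S', Pi.sub_apply, cast_code]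
    generalize x.1.1.1 = X
    induction X using Multiset.induction_on with
    | empty => simp
    | cons a X ih =>
      simp only [Multiset.map_cons, Multiset.sum_cons, add_sub_add_comm]
      exact (enorm_add_le _ _).trans (by gcongr)
  have hlim : Tendsto (fun n => eLpNorm (S n - S') 1 ρ) atTop (𝓝 0) := by
    refine tendsto_of_tendsto_of_tendsto_of_le_of_le tendsto_const_nhds ?_ (fun _ => zero_le) hle
    have := ENNReal.tendsto_inv_nat_nhds_zero.comp (tendsto_add_atTop_nat 1)
    refine this.congr fun n => ?_
    simp
  -- Almost sure convergence needs a subsequence of the mean convergence.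
  obtain ⟨ns, -, hns⟩ := (tendstoInMeasure_of_tendsto_eLpNorm one_ne_zero
    (fun n => (hS n).aestronglyMeasurable) hS'.aestronglyMeasurable hlim).exists_seq_tendsto_ae
  refine ⟨fun n => net (ns n), ?_⟩
  filter_upwards [hns] with x hx
  refine tendsto_append (tendsto_pi_nhds.2 fun i => ?_)
  simp only [multiset_sum_apply, hnet]
  exact hx

/-- Universal approximation by value networks of observation encodings: bounded functions are
approximated in mean by networks with almost the same bounds. -/
theorem exists_valueOut_approx (hact : IsActivation act) (hd : 0 < d₃)
    (ρ : Measure (Obs N d₁ d₂ × (Fin k → ℝ))) [IsProbabilityMeasure ρ]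
    {F : Fin 2 → Obs N d₁ d₂ × (Fin k → ℝ) → ℝ} (hF : ∀ j, Measurable (F j))
    {lo hi : Fin 2 → ℝ} (hlt : ∀ j, lo j < hi j) (hlo : ∀ j x, lo j ≤ F j x)
    (hhi : ∀ j x, F j x ≤ hi j) {ε : ℝ} (hε : 0 < ε) :
    ∃ (θ : MLP (d₃ + d₂ + k) 2) (φ : MLP d₁ d₃), ∀ j,
      (∀ x : Obs N d₁ d₂ × (Fin k → ℝ), lo j - ε ≤ valueOut act θ φ x j ∧
        valueOut act θ φ x j ≤ hi j + ε) ∧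
      ∫⁻ x, ‖valueOut act θ φ x j - F j x‖ₑ ∂ρ ≤ ENNReal.ofReal ε := by
  -- Four errors share `ε`: reduction to a code, approximation on encodings by one hidden layer, the
  -- network truncation, and the feature network.
  set ε' : ℝ := ε / 4 with hε'
  have hε'0 : 0 < ε' := by positivity
  have hne : ENNReal.ofReal ε' ≠ 0 := by simpa using hε'0
  have hmem : ∀ j, MemLp (F j) 2 ρ := fun j =>
    MemLp.of_bound (hF j).aestronglyMeasurable (max |lo j| |hi j|) (ae_of_all _ fun x =>
      abs_le_max_abs_abs (hlo j x) (hhi j x))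
  choose g hgc hgm hgε using fun j => exists_isCoded_lintegral_lt ρ (hmem j) hne
  obtain ⟨h, hm, hb, G, hG, hgG⟩ : ∃ h : (Fin d₁ → ℝ) → ℕ, Measurable h ∧ (∃ b, ∀ x, h x ≤ b) ∧
      ∃ G : Fin 2 → ℕ × (Fin d₂ → ℝ) × (Fin k → ℝ) → ℝ, (∀ j, Measurable (G j)) ∧
        ∀ j x, g j x = G j (coded h x) := by
    obtain ⟨h, hm, hb, G₁, G₂, m₁, m₂, e₁, e₂⟩ := (hgc 0).exists_common (hgc 1)
    refine ⟨h, hm, hb, ![G₁, G₂], fun j => ?_, fun j => ?_⟩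
    · fin_cases j
      exacts [m₁, m₂]
    · fin_cases j
      exacts [e₁, e₂]
  let cl : Fin 2 → ℝ → ℝ := fun j t => max (lo j) (min t (hi j))
  have hcl : ∀ j, Measurable (cl j) := fun j =>
    measurable_const.max (measurable_id.min measurable_const)
  have hclF : ∀ j x, cl j (F j x) = F j x := fun j x => by
    simp only [cl]; rw [min_eq_left (hhi j x), max_eq_right (hlo j x)]
  -- The integer code is read from the first feature coordinate; the floor makes the decoding a
  -- total measurable map.
  let decode : (Fin (d₃ + d₂ + k) → ℝ) → ℕ × (Fin d₂ → ℝ) × (Fin k → ℝ) := fun s =>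
    (⌊s (Fin.castAdd k (Fin.castAdd d₂ ⟨0, hd⟩))⌋₊, fun j => s (Fin.castAdd k (Fin.natAdd d₃ j)),
      fun j => s (Fin.natAdd (d₃ + d₂) j))
  have hdecode : Measurable decode := by
    refine (Nat.measurable_floor.comp (measurable_pi_apply _)).prodMk
      ((measurable_pi_lambda _ fun j => measurable_pi_apply _).prodMk
        (measurable_pi_lambda _ fun j => measurable_pi_apply _))
  -- The ideal encoding, carrying the exact code, which the feature networks reach only in the
  -- limit.
  let Ψ : Obs N d₁ d₂ × (Fin k → ℝ) → Fin (d₃ + d₂ + k) → ℝ := fun x =>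
    Fin.append (Fin.append (fun _ => (code h x.1.1 : ℝ)) x.1.2) x.2
  have hΨ : Measurable Ψ := by
    refine measurable_append (measurable_append (measurable_pi_lambda _ fun _ => ?_)
      (measurable_snd.comp measurable_fst)) measurable_snd
    exact (measurable_of_countable fun n : ℕ => (n : ℝ)).comp
      ((measurable_code hm).comp (measurable_fst.comp measurable_fst))
  have hdΨ : ∀ x, decode (Ψ x) = coded h x := by
    intro x
    simp only [decode, Ψ, coded, Fin.append_left, Fin.append_right, Nat.floor_natCast]
  let T : Fin 2 → (Fin (d₃ + d₂ + k) → ℝ) → ℝ := fun j s => cl j (G j (decode s))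
  have hT : ∀ j, Measurable (T j) := fun j => (hcl j).comp ((hG j).comp hdecode)
  have hTmem : ∀ j, MemLp (T j) 2 (ρ.map Ψ) := fun j =>
    MemLp.of_bound (hT j).aestronglyMeasurable (max |lo j| |hi j|) (ae_of_all _ fun x =>
      abs_le_max_abs_abs (le_max_left _ _) (max_le (hlt j).le (min_le_right _ _)))
  have : IsProbabilityMeasure (ρ.map Ψ) := Measure.isProbabilityMeasure_map hΨ.aemeasurable
  choose q hq hqε using fun j => exists_shallowNets_lintegral_lt hact (ρ.map Ψ) (hTmem j) hne
  have hqc : ∀ j, Continuous (q j) := fun j => continuous_of_mem_shallowNets hact.1 (hq j)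
  choose c hc hcε using fun j => exists_clamp hact (hlt j) hε'0
  obtain ⟨θ, hθ⟩ : ∃ θ : MLP (d₃ + d₂ + k) 2, ∀ s, θ.eval act s = fun j => c j (q j s) := by
    refine exists_deep (fun s j => q j s) hq (fun y j => c j (y j)) fun j => ?_
    have := comp_affine_mem_shallowNets (n := 2) (hc j) (Pi.single j 1) 0
    simpa [Pi.single_apply] using this
  obtain ⟨φ, hφ⟩ := exists_tendsto_esc (d₃ := d₃) hact ρ hm hb
  have hbox : ∀ j s, lo j - ε ≤ θ.eval act s j ∧ θ.eval act s j ≤ hi j + ε := by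
    intro j s
    rw [hθ]
    have h1 := abs_le.1 (hcε j (q j s))
    have h2 : lo j ≤ max (lo j) (min (q j s) (hi j)) := le_max_left _ _
    have h3 : max (lo j) (min (q j s) (hi j)) ≤ hi j := max_le (hlt j).le (min_le_right _ _)
    constructor <;> linarith [h1.1, h1.2]
  have hθm : ∀ j, Measurable fun s => θ.eval act s j := fun j =>
    ((continuous_apply j).comp (continuous_mlp hact.1 θ)).measurable
  -- Now `θ` is fixed and continuous, unlike the decoding it imitates, so convergence of the
  -- encodings passes through it; its values stay in a box, which gives domination.
  have hlim : ∀ j, Tendsto (fun n => ∫⁻ x, ‖valueOut act θ (φ n) x j - θ.eval act (Ψ x) j‖ₑ ∂ρ)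
      atTop (𝓝 0) := by
    intro j
    have h0 : (0 : ℝ≥0∞) = ∫⁻ _, 0 ∂ρ := by simp
    rw [h0]
    refine tendsto_lintegral_of_dominated_convergence
      (fun _ => ENNReal.ofReal (hi j - lo j + 2 * ε)) (fun n => ?_) (fun n => ?_) (by simp) ?_
    · exact ((measurable_valueOut hact.1 θ (φ n) j).sub ((hθm j).comp hΨ)).enorm
    · refine ae_of_all _ fun x => ?_
      beta_reduce
      rw [Real.enorm_eq_ofReal_abs]
      refine ENNReal.ofReal_le_ofReal (abs_le.2 ?_)
      have h1 := hbox j (Fin.append (esc act (φ n) x.1) x.2)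
      have h2 := hbox j (Ψ x)
      simp only [valueOut]
      constructor <;> linarith [h1.1, h1.2, h2.1, h2.2]
    · filter_upwards [hφ] with x hx
      have h1 : Tendsto (fun n => Fin.append (esc act (φ n) x.1) x.2) atTop (𝓝 (Ψ x)) :=
        tendsto_append hx
      have h2 : Tendsto (fun n => valueOut act θ (φ n) x j) atTop (𝓝 (θ.eval act (Ψ x) j)) :=
        (((continuous_apply j).comp (continuous_mlp hact.1 θ)).tendsto _).comp h1
      have h3 := (h2.sub_const (θ.eval act (Ψ x) j)).enorm
      simpa using h3
  obtain ⟨n, hn⟩ : ∃ n, ∀ j, ∫⁻ x, ‖valueOut act θ (φ n) x j - θ.eval act (Ψ x) j‖ₑ ∂ρ <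
      ENNReal.ofReal ε' :=
    (eventually_all.2 fun j => (hlim j).eventually_lt_const (pos_iff_ne_zero.2 hne)).exists
  refine ⟨θ, φ n, fun j => ⟨fun x => hbox j _, ?_⟩⟩
  have hpt : ∀ x, ‖valueOut act θ (φ n) x j - F j x‖ₑ ≤
      ‖valueOut act θ (φ n) x j - θ.eval act (Ψ x) j‖ₑ + (ENNReal.ofReal ε' +
        (‖q j (Ψ x) - T j (Ψ x)‖ₑ + ‖g j x - F j x‖ₑ)) := by
    intro x
    simp only [Real.enorm_eq_ofReal_abs]
    rw [← ENNReal.ofReal_add (abs_nonneg _) (abs_nonneg _),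
      ← ENNReal.ofReal_add hε'0.le (by positivity), ← ENNReal.ofReal_add (by positivity) (by positivity)]
    refine ENNReal.ofReal_le_ofReal ?_
    have e1 : |θ.eval act (Ψ x) j - cl j (q j (Ψ x))| ≤ ε' := by rw [hθ]; exact hcε j _
    have e2 : |cl j (q j (Ψ x)) - cl j (T j (Ψ x))| ≤ |q j (Ψ x) - T j (Ψ x)| :=
      abs_clamp_sub_clamp_le _ _ _ _
    have e3 : |cl j (g j x) - cl j (F j x)| ≤ |g j x - F j x| := abs_clamp_sub_clamp_le _ _ _ _
    have e4 : cl j (T j (Ψ x)) = cl j (g j x) := by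
      simp only [T, hdΨ, ← hgG, cl]
      rw [min_eq_left (max_le (hlt j).le (min_le_right _ _)), max_eq_right (le_max_left _ _)]
    rw [e4] at e2
    rw [hclF] at e3
    have a1 := abs_sub_le (valueOut act θ (φ n) x j) (θ.eval act (Ψ x) j) (F j x)
    have a2 := abs_sub_le (θ.eval act (Ψ x) j) (cl j (q j (Ψ x))) (F j x)
    have a3 := abs_sub_le (cl j (q j (Ψ x))) (cl j (g j x)) (F j x)
    linarith
  have hq' : ∫⁻ x, ‖q j (Ψ x) - T j (Ψ x)‖ₑ ∂ρ < ENNReal.ofReal ε' := by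
    have := hqε j
    have hm : Measurable fun s => ‖q j s - T j s‖ₑ := ((hqc j).measurable.sub (hT j)).enorm
    rwa [lintegral_map hm hΨ] at this
  refine (lintegral_mono hpt).trans ?_
  have m1 : Measurable fun x => ‖valueOut act θ (φ n) x j - θ.eval act (Ψ x) j‖ₑ :=
    ((measurable_valueOut hact.1 θ (φ n) j).sub ((hθm j).comp hΨ)).enorm
  have m2 : Measurable fun x => ‖q j (Ψ x) - T j (Ψ x)‖ₑ :=
    (((hqc j).measurable.sub (hT j)).comp hΨ).enorm
  rw [lintegral_add_left m1, lintegral_add_left measurable_const, lintegral_add_left m2,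
    lintegral_const, measure_univ, mul_one]
  have e : ENNReal.ofReal ε = ENNReal.ofReal ε' + (ENNReal.ofReal ε' + (ENNReal.ofReal ε' +
      ENNReal.ofReal ε')) := by
    rw [← ENNReal.ofReal_add hε'0.le hε'0.le, ← ENNReal.ofReal_add hε'0.le (by positivity),
      ← ENNReal.ofReal_add hε'0.le (by positivity)]
    congr 1; rw [hε']; ring
  rw [e]
  gcongr
  exacts [(hn j).le, (hgε j).le]

end UniversalApproximation

/-! ### The discounted occupancy measure and its stability under one step. -/

section Occupancy

variable {O A : Type*} [MeasurableSpace O] [MeasurableSpace A] {ν : Measure A}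
  (env : Environment O A) (d₀ : Measure O) [IsProbabilityMeasure d₀] (π : Policy O ν) {γ : ℝ}

lemma trajLaw_eq_chain (x : O × A) : trajLaw env π x = chain (step env π) x := rfl

instance isProbabilityMeasure_marginal (t : ℕ) : IsProbabilityMeasure (marginal env d₀ π t) := by
  induction t with
  | zero => unfold marginal; infer_instance
  | succ t ih => unfold marginal; infer_instance

omit [IsProbabilityMeasure d₀] in
lemma lintegral_marginal_succ (t : ℕ) {f : O × A → ℝ≥0∞} (hf : Measurable f) :
    ∫⁻ x, f x ∂(marginal env d₀ π (t + 1)) =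
      ∫⁻ x, ∫⁻ y, f y ∂(step env π x) ∂(marginal env d₀ π t) := by
  rw [marginal, Measure.lintegral_bind (step env π).measurable.aemeasurable hf.aemeasurable]

omit [IsProbabilityMeasure d₀] in
lemma lintegral_occupancy (f : O × A → ℝ≥0∞) :
    ∫⁻ x, f x ∂(occupancy env d₀ π γ) =
      ∑' t, ENNReal.ofReal ((1 - γ) * γ ^ t) * ∫⁻ x, f x ∂(marginal env d₀ π t) := by
  rw [occupancy, lintegral_sum_measure]
  simp only [lintegral_smul_measure, smul_eq_mul]

lemma isProbabilityMeasure_occupancy (hγ0 : 0 < γ) (hγ1 : γ < 1) :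
    IsProbabilityMeasure (occupancy env d₀ π γ) := by
  constructor
  have h := lintegral_occupancy env d₀ π (γ := γ) fun _ => 1
  simp only [lintegral_const, measure_univ, mul_one, one_mul] at h
  have h1 : 0 ≤ 1 - γ := by linarith
  rw [h, ← ENNReal.ofReal_tsum_of_nonneg (fun t => by positivity)
    ((summable_geometric_of_lt_one hγ0.le hγ1).mul_left _), tsum_mul_left,
    tsum_geometric_of_lt_one hγ0.le hγ1, mul_inv_cancel₀ (by linarith), ENNReal.ofReal_one]

omit [IsProbabilityMeasure d₀] in
lemma ae_occupancy_iff (hγ0 : 0 < γ) (hγ1 : γ < 1) {p : O × A → Prop} :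
    (∀ᵐ x ∂(occupancy env d₀ π γ), p x) ↔ ∀ t, ∀ᵐ x ∂(marginal env d₀ π t), p x := by
  rw [occupancy, Measure.ae_sum_iff]
  refine forall_congr' fun t => Measure.ae_ennreal_smul_measure_iff ?_
  have h1 : 0 < 1 - γ := by linarith
  have : 0 < (1 - γ) * γ ^ t := by positivity
  simpa using this

omit [IsProbabilityMeasure d₀] in
-- One step turns the weight γᵗ into γ⁻¹γᵗ⁺¹ at time t + 1; the missing time-0 term only helps. This
-- replaces invariance throughout.
lemma bind_occupancy_le (hγ0 : 0 < γ) (hγ1 : γ < 1) :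
    (occupancy env d₀ π γ).bind (step env π) ≤
      ENNReal.ofReal γ⁻¹ • occupancy env d₀ π γ := by
  refine Measure.le_iff.2 fun s hs => ?_
  have hind : Measurable (s.indicator (1 : O × A → ℝ≥0∞)) := measurable_one.indicator hs
  have h1 : (occupancy env d₀ π γ).bind (step env π) s =
      ∑' t, ENNReal.ofReal ((1 - γ) * γ ^ t) * marginal env d₀ π (t + 1) s := by
    rw [Measure.bind_apply hs (step env π).measurable.aemeasurable, lintegral_occupancy]
    refine tsum_congr fun t => ?_
    rw [← lintegral_indicator_one (μ := marginal env d₀ π (t + 1)) hs,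
      lintegral_marginal_succ _ _ _ _ hind]
    simp only [lintegral_indicator_one hs]
  have h2 : occupancy env d₀ π γ s =
      ∑' t, ENNReal.ofReal ((1 - γ) * γ ^ t) * marginal env d₀ π t s := by
    rw [← lintegral_indicator_one hs, lintegral_occupancy]
    simp only [lintegral_indicator_one hs]
  rw [h1, Measure.smul_apply, h2, smul_eq_mul, ← ENNReal.tsum_mul_left]
  refine le_trans (le_of_eq ?_) (ENNReal.tsum_comp_le_tsum_of_injective Nat.succ_injective _)
  refine tsum_congr fun t => ?_
  have h3 : 0 ≤ 1 - γ := by linarith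
  rw [← mul_assoc, ← ENNReal.ofReal_mul (by positivity)]
  congr 2
  rw [Nat.succ_eq_add_one, pow_succ]
  field_simp

omit [IsProbabilityMeasure d₀] in
lemma ae_step_of_ae_occupancy (hγ0 : 0 < γ) (hγ1 : γ < 1) {p : O × A → Prop}
    (h : ∀ᵐ x ∂(occupancy env d₀ π γ), p x) :
    ∀ᵐ x ∂(occupancy env d₀ π γ), ∀ᵐ y ∂(step env π x), p y := by
  refine Measure.ae_ae_of_ae_comp (κ := step env π) ?_
  exact (Measure.absolutelyContinuous_of_le_smul (bind_occupancy_le env d₀ π hγ0 hγ1)).ae_le h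

/-- The law of a transition that starts from the occupancy measure. -/
noncomputable def transLaw (γ : ℝ) : Measure ((O × A) × (O × A)) :=
  occupancy env d₀ π γ ⊗ₘ step env π

lemma memLp_transLaw_snd (hγ0 : 0 < γ) (hγ1 : γ < 1) {f : O × A → ℝ} {p : ℝ≥0∞}
    (hf : MemLp f p (occupancy env d₀ π γ)) : MemLp (fun q => f q.2) p (transLaw env d₀ π γ) := by
  have := isProbabilityMeasure_occupancy env d₀ π hγ0 hγ1
  have h1 : MemLp f p ((transLaw env d₀ π γ).map Prod.snd) := by
    rw [← Measure.snd, transLaw, Measure.snd_compProd]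
    exact hf.of_measure_le_smul ENNReal.ofReal_ne_top (bind_occupancy_le env d₀ π hγ0 hγ1)
  exact h1.comp_of_map measurable_snd.aemeasurable

lemma memLp_transLaw_reward (hγ0 : 0 < γ) (hγ1 : γ < 1)
    (hr : MemLp env.reward 2 (occupancy env d₀ π γ ⊗ₘ env.trans)) :
    MemLp (fun q : (O × A) × (O × A) => env.reward (q.1, q.2.1)) 2 (transLaw env d₀ π γ) := by
  have := isProbabilityMeasure_occupancy env d₀ π hγ0 hγ1
  have h1 : (transLaw env d₀ π γ).map (Prod.map id Prod.fst) =
      occupancy env d₀ π γ ⊗ₘ env.trans := by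
    rw [transLaw, ← Measure.compProd_map measurable_fst]
    congr 1
    rw [← Kernel.fst_eq, step, Kernel.fst_compProd]
  rw [← h1] at hr
  exact hr.comp_of_map (by fun_prop)

omit [IsProbabilityMeasure d₀] in
-- Induction on `t` with `s` free: the Markov property moves one step from the trajectory to the
-- starting marginal.
lemma lintegral_chain_marginal (t s : ℕ) {f : O × A → ℝ≥0∞} (hf : Measurable f) :
    ∫⁻ x, ∫⁻ w, f (w t) ∂(chain (step env π) x) ∂(marginal env d₀ π s) =
      ∫⁻ x, f x ∂(marginal env d₀ π (s + t)) := by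
  induction t generalizing s with
  | zero => simp only [lintegral_chain_zero _ _ hf, add_zero]
  | succ t ih =>
    have h : ∀ x, ∫⁻ w, f (w (t + 1)) ∂(chain (step env π) x) =
        ∫⁻ y, ∫⁻ w, f (w t) ∂(chain (step env π) y) ∂(step env π x) := by
      intro x
      have hm : Measurable fun w : ℕ → O × A => f (w (t + 1)) := by fun_prop
      have hc : Measurable fun p : (O × A) × (ℕ → O × A) => consTraj x p.2 :=
        measurable_consTraj.comp (measurable_const.prodMk measurable_snd)
      rw [chain_eq_bind, lintegral_map hm hc]
      simp only [consTraj_succ]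
      rw [Measure.lintegral_compProd (by fun_prop)]
    simp only [h]
    have hm : Measurable fun y => ∫⁻ w, f (w t) ∂(chain (step env π) y) :=
      Measurable.lintegral_kernel (f := fun w : ℕ → O × A => f (w t)) (by fun_prop)
    rw [← lintegral_marginal_succ env d₀ π s hm, ih, add_right_comm, add_assoc]

omit [IsProbabilityMeasure d₀] in
/-- Discounted sums along trajectories are finite, almost everywhere in the starting point. -/
lemma ae_tsum_chain_lt_top (hγ0 : 0 < γ) (hγ1 : γ < 1) {f : O × A → ℝ≥0∞} (hf : Measurable f)
    (hfin : ∫⁻ x, f x ∂(occupancy env d₀ π γ) ≠ ∞) :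
    ∀ᵐ x ∂(occupancy env d₀ π γ),
      ∑' t, ENNReal.ofReal (γ ^ t) * ∫⁻ w, f (w t) ∂(chain (step env π) x) < ∞ := by
  rw [ae_occupancy_iff env d₀ π hγ0 hγ1]
  intro s
  have hm : ∀ t, Measurable fun x => ∫⁻ w, f (w t) ∂(chain (step env π) x) := fun t =>
    Measurable.lintegral_kernel (f := fun w : ℕ → O × A => f (w t)) (by fun_prop)
  refine ae_lt_top (Measurable.tsum fun t => (hm t).const_mul _) fun htop => hfin ?_
  rw [lintegral_tsum fun t => ((hm t).const_mul _).aemeasurable] at htop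
  have h1 : 0 < 1 - γ := by linarith
  have hc : ENNReal.ofReal ((1 - γ) * γ ^ s) ≠ 0 := by
    have : 0 < (1 - γ) * γ ^ s := by positivity
    simpa using this
  rw [lintegral_occupancy]
  refine top_le_iff.1 ?_
  -- Started from the time-`s` marginal and weighted accordingly, the discounted sum is the part of
  -- the occupancy integral from time `s` on.
  calc ∞ = ENNReal.ofReal ((1 - γ) * γ ^ s) * ∑' t, ∫⁻ x, ENNReal.ofReal (γ ^ t) *
        ∫⁻ w, f (w t) ∂(chain (step env π) x) ∂(marginal env d₀ π s) := by
        rw [htop, ENNReal.mul_top hc]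
    _ = ∑' t, ENNReal.ofReal ((1 - γ) * γ ^ (s + t)) *
        ∫⁻ x, f x ∂(marginal env d₀ π (s + t)) := by
        rw [← ENNReal.tsum_mul_left]
        refine tsum_congr fun t => ?_
        rw [lintegral_const_mul _ (hm t), lintegral_chain_marginal env d₀ π t s hf, ← mul_assoc,
          ← ENNReal.ofReal_mul (by positivity), pow_add, mul_assoc]
    _ ≤ _ := ENNReal.tsum_comp_le_tsum_of_injective (add_right_injective s)
        fun t => ENNReal.ofReal ((1 - γ) * γ ^ t) * ∫⁻ x, f x ∂(marginal env d₀ π t)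

end Occupancy

/-! ### Moments and divergences of Gaussian mixtures. -/

section Mixtures

open InformationTheory

variable {Y : Type*} [MeasurableSpace Y] {κ : Measure Y} [IsProbabilityMeasure κ] {μ : Y → ℝ}
  {τ : Y → ℝ≥0}

lemma mixture_moments (hμ : Measurable μ) (hτ : Measurable τ) (hμ2 : MemLp μ 2 κ)
    (hτ1 : Integrable (fun y => (τ y : ℝ)) κ) :
    IsProbabilityMeasure (κ.bind fun y => gaussianReal (μ y) (τ y)) ∧
    Integrable (fun z => z ^ 2) (κ.bind fun y => gaussianReal (μ y) (τ y)) ∧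
      ∫ z, z ∂(κ.bind fun y => gaussianReal (μ y) (τ y)) = ∫ y, μ y ∂κ ∧
      ∫ z, z ^ 2 ∂(κ.bind fun y => gaussianReal (μ y) (τ y)) = ∫ y, (μ y ^ 2 + τ y) ∂κ := by
  have hG : Measurable fun y => gaussianReal (μ y) (τ y) :=
    measurable_gaussianReal.comp (hμ.prodMk hτ)
  let G : Kernel Y ℝ := ⟨fun y => gaussianReal (μ y) (τ y), hG⟩
  have hGapp : ∀ y, G y = gaussianReal (μ y) (τ y) := fun _ => rfl
  have : IsMarkovKernel G := ⟨fun y => by rw [hGapp]; infer_instance⟩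
  change IsProbabilityMeasure (G ∘ₘ κ) ∧ Integrable (fun z => z ^ 2) (G ∘ₘ κ) ∧
    ∫ z, z ∂(G ∘ₘ κ) = _ ∧ ∫ z, z ^ 2 ∂(G ∘ₘ κ) = _
  have h2 : Integrable (fun z => z ^ 2) (G ∘ₘ κ) := by
    rw [Measure.integrable_comp_iff (by fun_prop)]
    refine ⟨ae_of_all _ fun y => integrable_sq_gaussianReal _ _, ?_⟩
    simp only [norm_pow, Real.norm_eq_abs, sq_abs, hGapp, integral_sq_gaussianReal]
    exact hμ2.integrable_sq.add hτ1
  have hcomp : ∀ {f : ℝ → ℝ}, Integrable f (G ∘ₘ κ) →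
      ∫ z, f z ∂(G ∘ₘ κ) = ∫ y, ∫ z, f z ∂(G y) ∂κ := by
    intro f hf
    rw [Measure.comp_eq_comp_const_apply] at hf ⊢
    rw [Kernel.integral_comp hf, Kernel.const_apply]
  refine ⟨inferInstance, h2, ?_, ?_⟩
  · rw [hcomp (integrable_of_integrable_sq h2)]
    simp only [hGapp, integral_id_gaussianReal]
  · rw [hcomp h2]
    simp only [hGapp, integral_sq_gaussianReal]

/-- Law of total variance: the variance of the means plus the mean of the variances, the latter
positive. -/
lemma mixture_variance_pos (hμ2 : MemLp μ 2 κ) (hτ1 : Integrable (fun y => (τ y : ℝ)) κ)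
    (hτ0 : ∀ᵐ y ∂κ, τ y ≠ 0) :
    0 < ∫ y, (μ y ^ 2 + τ y) ∂κ - (∫ y, μ y ∂κ) ^ 2 := by
  have h1 : 0 ≤ variance μ κ := variance_nonneg _ _
  rw [variance_eq_sub hμ2] at h1
  have h2 : 0 < ∫ y, (τ y : ℝ) ∂κ := by
    refine (integral_nonneg fun y => (τ y).2).lt_of_ne' fun h => ?_
    have h3 := (integral_eq_zero_iff_of_nonneg (fun y => (τ y).2) hτ1).1 h
    obtain ⟨y, h4, h5⟩ := (h3.and hτ0).exists
    exact h5 (NNReal.coe_eq_zero.1 h4)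
  rw [integral_add hμ2.integrable_sq hτ1]
  simp only [Pi.pow_apply] at h1
  linarith

/-- The expected divergence of the components of a Gaussian mixture from its moment projection. -/
lemma lintegral_gaussianKL_mixture (hμ2 : MemLp μ 2 κ)
    (hτ1 : Integrable (fun y => (τ y : ℝ)) κ) (hτ0 : ∀ᵐ y ∂κ, τ y ≠ 0)
    (hτl : Integrable (fun y => Real.log (τ y)) κ) {m v : ℝ} (hm : m = ∫ y, μ y ∂κ)
    (hv : v = ∫ y, (μ y ^ 2 + τ y) ∂κ - m ^ 2) :
    ∫⁻ y, ENNReal.ofReal (gaussianKL (μ y) (τ y) m v) ∂κ =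
      ENNReal.ofReal ((Real.log v - ∫ y, Real.log (τ y) ∂κ) / 2) ∧
    0 ≤ Real.log v - ∫ y, Real.log (τ y) ∂κ := by
  have hv0 : 0 < v := by rw [hv, hm]; exact mixture_variance_pos hμ2 hτ1 hτ0
  have hμ1 : Integrable μ κ := hμ2.integrable (by norm_num)
  have hsq := hμ2.integrable_sq
  -- The divergence with the logarithm of the quotient split. The quadratic part integrates to `v`,
  -- so after division by `v` it cancels the constant 1 and only logarithms survive.
  let f : Y → ℝ := fun y => (Real.log v - Real.log (τ y) +
    ((μ y ^ 2 + τ y) - 2 * m * μ y + m ^ 2) / v - 1) / 2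
  have hA : Integrable (fun y => μ y ^ 2 + (τ y : ℝ)) κ := hsq.add hτ1
  have hB : Integrable (fun y => (μ y ^ 2 + (τ y : ℝ)) - 2 * m * μ y) κ :=
    hA.sub (hμ1.const_mul _)
  have hC : Integrable (fun y => (μ y ^ 2 + (τ y : ℝ)) - 2 * m * μ y + m ^ 2) κ :=
    hB.add (integrable_const _)
  have hD : Integrable (fun y => Real.log v - Real.log (τ y)) κ := (integrable_const _).sub hτl
  have hE : Integrable (fun y => Real.log v - Real.log (τ y) +
    ((μ y ^ 2 + τ y) - 2 * m * μ y + m ^ 2) / v) κ := hD.add (hC.div_const _)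
  have hf : Integrable f κ := (hE.sub (integrable_const _)).div_const _
  have hfi : ∫ y, f y ∂κ = (Real.log v - ∫ y, Real.log (τ y) ∂κ) / 2 := by
    simp only [f]
    rw [integral_div, integral_sub hE (integrable_const _), integral_add hD (hC.div_const _),
      integral_sub (integrable_const _) hτl, integral_div, integral_add hB (integrable_const _),
      integral_sub hA (hμ1.const_mul _), integral_const_mul, ← hm]
    simp only [integral_const, probReal_univ, smul_eq_mul, one_mul]
    have : (∫ y, (μ y ^ 2 + (τ y : ℝ)) ∂κ) - 2 * m * m + m ^ 2 = v := by rw [hv]; ring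
    rw [this, div_self hv0.ne']
    ring
  have hfeq : ∀ᵐ y ∂κ, gaussianKL (μ y) (τ y) m v = f y := by
    filter_upwards [hτ0] with y hy
    have hy' : (0 : ℝ) < τ y := by positivity
    simp only [gaussianKL, f]
    rw [Real.log_div hv0.ne' hy'.ne']
    ring
  have hf0 : 0 ≤ᵐ[κ] f := by
    filter_upwards [hτ0, hfeq] with y hy he
    rw [← he]
    exact gaussianKL_nonneg (by positivity) hv0
  constructor
  · rw [← hfi, ofReal_integral_eq_lintegral_ofReal hf hf0]
    refine lintegral_congr_ae ?_
    filter_upwards [hfeq] with y hy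
    rw [hy]
  · have := integral_nonneg_of_ae hf0
    rw [hfi] at this
    linarith

end Mixtures

/-! ### Moment matching by minimizers of the expected divergence. -/

section Projection

open InformationTheory

variable {X : Type*} [MeasurableSpace X] {ρ : Measure X}

/-- Approximation of bounded measurable maps to the plane, in the mean and with values that stay
close to any given bounding box. -/
def ApproximatesBounded (𝒢 : Set (X → Fin 2 → ℝ)) (ρ : Measure X) : Prop :=
  ∀ F : Fin 2 → X → ℝ, (∀ j, Measurable (F j)) → ∀ lo hi : Fin 2 → ℝ, (∀ j, lo j < hi j) →
    (∀ j x, lo j ≤ F j x) → (∀ j x, F j x ≤ hi j) → ∀ ε : ℝ, 0 < ε → ∃ g ∈ 𝒢, ∀ j,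
      (∀ x, lo j - ε ≤ g x j ∧ g x j ≤ hi j + ε) ∧
        ∫⁻ x, ‖g x j - F j x‖ₑ ∂ρ ≤ ENNReal.ofReal ε

/-- A bound free of `m'` and `w`, used as dominating function for models that stay in a box. -/
lemma gaussianKL_le {m v m' w M a b : ℝ} (hv : 0 < v) (ha : 0 < a) (haw : a ≤ w) (hwb : w ≤ b)
    (hm' : |m'| ≤ M) :
    gaussianKL m v m' w ≤
      |Real.log a| + |Real.log b| + |Real.log v| + (v + 2 * m ^ 2 + 2 * M ^ 2) / a := by
  have hw : 0 < w := ha.trans_le haw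
  have h1 : (v + (m - m') ^ 2) / w ≤ (v + 2 * m ^ 2 + 2 * M ^ 2) / a := by
    have : m' ^ 2 ≤ M ^ 2 := sq_le_sq' (abs_le.1 hm').1 (abs_le.1 hm').2
    have h : (m - m') ^ 2 ≤ 2 * m ^ 2 + 2 * M ^ 2 := by nlinarith [sq_nonneg (m + m')]
    rw [add_assoc]
    gcongr
  have h2 : Real.log w ≤ |Real.log b| := (Real.log_le_log hw hwb).trans (le_abs_self _)
  have h3 : 0 ≤ (v + 2 * m ^ 2 + 2 * M ^ 2) / a := by positivity
  rw [gaussianKL, Real.log_div hw.ne' hv.ne']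
  have := neg_abs_le (Real.log v)
  have := abs_nonneg (Real.log a)
  have := abs_nonneg (Real.log b)
  have := abs_nonneg (Real.log v)
  linarith

@[fun_prop]
lemma measurable_gaussianKL {m v m' w : X → ℝ} (hm : Measurable m) (hv : Measurable v)
    (hm' : Measurable m') (hw : Measurable w) :
    Measurable fun x => gaussianKL (m x) (v x) (m' x) (w x) := by
  unfold gaussianKL
  fun_prop

/-- Where mean and deviation lie in a large box the target is kept, at zero divergence; elsewhere it
is replaced by the standard normal law, whose divergence is integrable and whose domain shrinks
away. -/
lemma exists_bounded_lintegral_gaussianKL_lt {m v : X → ℝ} (hm : Measurable m) (hv : Measurable v)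
    (hv0 : ∀ᵐ x ∂ρ, 0 < v x) (hm2 : MemLp m 2 ρ) (hv1 : Integrable v ρ)
    (hvl : Integrable (fun x => Real.log (v x)) ρ) {ε : ℝ≥0∞} (hε : 0 < ε) :
    ∃ (F : Fin 2 → X → ℝ) (n : ℝ), (∀ j, Measurable (F j)) ∧ 1 ≤ n ∧ (∀ x, |F 0 x| ≤ n) ∧
      (∀ x, 1 / n ≤ F 1 x ∧ F 1 x ≤ n) ∧
      ∫⁻ x, ENNReal.ofReal (gaussianKL (m x) (v x) (F 0 x) (F 1 x ^ 2)) ∂ρ < ε := by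
  let E : ℕ → Set X := fun n =>
    {x | |m x| ≤ (n : ℝ) + 1 ∧ 1 / ((n : ℝ) + 1) ≤ √(v x) ∧ √(v x) ≤ (n : ℝ) + 1}
  have hE : ∀ n, MeasurableSet (E n) := fun n =>
    (measurableSet_le hm.abs measurable_const).inter
      ((measurableSet_le measurable_const hv.sqrt).inter (measurableSet_le hv.sqrt measurable_const))
  let m' : ℕ → X → ℝ := fun n => (E n).piecewise m 0
  let s' : ℕ → X → ℝ := fun n => (E n).piecewise (fun x => √(v x)) 1
  have hm'm : ∀ n, Measurable (m' n) := fun n => hm.piecewise (hE n) measurable_const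
  have hs'm : ∀ n, Measurable (s' n) := fun n => hv.sqrt.piecewise (hE n) measurable_const
  let b : X → ℝ := fun x => |Real.log (v x)| + v x + m x ^ 2
  have hb : Integrable b ρ := (hvl.abs.add hv1).add hm2.integrable_sq
  have hmem : ∀ x, 0 < v x → ∀ᶠ n in atTop, x ∈ E n := by
    intro x hx
    have h1 : Tendsto (fun n : ℕ => (n : ℝ) + 1) atTop atTop :=
      tendsto_atTop_add_const_right _ _ tendsto_natCast_atTop_atTop
    have h2 : Tendsto (fun n : ℕ => 1 / ((n : ℝ) + 1)) atTop (𝓝 0) :=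
      tendsto_one_div_add_atTop_nhds_zero_nat
    filter_upwards [h1.eventually_ge_atTop |m x|, h1.eventually_ge_atTop √(v x),
      h2.eventually_le_const (Real.sqrt_pos.2 hx)] with n a b c
    exact ⟨a, c, b⟩
  have hlim : Tendsto (fun n => ∫⁻ x, ENNReal.ofReal
      (gaussianKL (m x) (v x) (m' n x) (s' n x ^ 2)) ∂ρ) atTop (𝓝 (∫⁻ _, 0 ∂ρ)) := by
    refine tendsto_lintegral_of_dominated_convergence (fun x => ENNReal.ofReal (b x)) ?_ ?_ ?_ ?_
    · intro n
      have := hm'm n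
      have := hs'm n
      fun_prop
    · intro n
      filter_upwards [hv0] with x hx
      refine ENNReal.ofReal_le_ofReal ?_
      have h1 := neg_abs_le (Real.log (v x))
      have h2 := abs_nonneg (Real.log (v x))
      by_cases hxE : x ∈ E n
      · simp only [m', s', Set.piecewise_eq_of_mem _ _ _ hxE, gaussianKL, Real.sq_sqrt hx.le,
          div_self hx.ne', Real.log_one, sub_self, b]
        have : (v x + 0 ^ 2) / v x = 1 := by rw [zero_pow two_ne_zero, add_zero, div_self hx.ne']
        rw [this]
        nlinarith [sq_nonneg (m x)]
      · simp only [m', s', Set.piecewise_eq_of_notMem _ _ _ hxE, gaussianKL, b, Pi.zero_apply,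
          Pi.one_apply, one_pow, one_div, Real.log_inv, sub_zero, div_one]
        nlinarith [sq_nonneg (m x)]
    · have : ∫⁻ x, ENNReal.ofReal (b x) ∂ρ < ∞ := hb.lintegral_lt_top
      exact this.ne
    · filter_upwards [hv0] with x hx
      refine tendsto_const_nhds.congr' ?_
      filter_upwards [hmem x hx] with n hn
      simp only [m', s', Set.piecewise_eq_of_mem _ _ _ hn, gaussianKL, Real.sq_sqrt hx.le,
        div_self hx.ne', Real.log_one, sub_self]
      simp [div_self hx.ne']
  rw [lintegral_zero] at hlim
  obtain ⟨n, hn⟩ := (hlim.eventually_lt_const hε).exists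
  have hn1 : (1 : ℝ) ≤ (n : ℝ) + 1 := by linarith [(Nat.cast_nonneg n : (0 : ℝ) ≤ n)]
  refine ⟨![m' n, s' n], n + 1, ?_, hn1, ?_, ?_, hn⟩
  · intro j
    fin_cases j
    · exact hm'm n
    · exact hs'm n
  · intro x
    by_cases hx : x ∈ E n
    · simpa [m', hx] using hx.1
    · simp only [Matrix.cons_val_zero, m', Set.piecewise_eq_of_notMem _ _ _ hx, Pi.zero_apply,
        abs_zero]
      linarith
  · intro x
    by_cases hx : x ∈ E n
    · simpa [s', hx] using hx.2
    · simp only [Matrix.cons_val_one, Matrix.cons_val_zero, s', Set.piecewise_eq_of_notMem _ _ _ hx,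
        Pi.one_apply]
      exact ⟨(div_le_one (by linarith)).2 hn1, hn1⟩

/-- Closeness in mean does not control the divergence near zero deviation; the box bounds on the
approximants do, by dominated convergence. -/
lemma exists_mem_lintegral_gaussianKL_lt [IsProbabilityMeasure ρ] {𝒢 : Set (X → Fin 2 → ℝ)}
    (h𝒢 : ∀ g ∈ 𝒢, ∀ j, Measurable fun x => g x j) (happ : ApproximatesBounded 𝒢 ρ)
    {m v : X → ℝ} (hm : Measurable m) (hv : Measurable v)
    (hv0 : ∀ᵐ x ∂ρ, 0 < v x) (hm2 : MemLp m 2 ρ) (hv1 : Integrable v ρ)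
    (hvl : Integrable (fun x => Real.log (v x)) ρ) {ε : ℝ≥0∞} (hε : 0 < ε) :
    ∃ g ∈ 𝒢, (∀ x, 0 < g x 1) ∧
      ∫⁻ x, ENNReal.ofReal (gaussianKL (m x) (v x) (g x 0) (g x 1 ^ 2)) ∂ρ < ε := by
  obtain ⟨F, n, hF, hn, h0, h1, hlt⟩ := exists_bounded_lintegral_gaussianKL_lt hm hv hv0 hm2 hv1 hvl hε
  have hn0 : 0 < n := by linarith
  -- Summable, so that mean convergence is almost sure, and at most half of `1 / n`, so that the
  -- deviations stay above `1 / (2 * n)`.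
  let e : ℕ → ℝ := fun j => (1 / n) / 2 * (1 / 2) ^ j
  have he0 : ∀ j, 0 < e j := fun j => by positivity
  have he1 : ∀ j, e j ≤ (1 / n) / 2 := fun j =>
    mul_le_of_le_one_right (by positivity) (pow_le_one₀ (by norm_num) (by norm_num))
  have hes : Summable e := summable_geometric_two.mul_left _
  have hn1 : 1 / n ≤ 1 := (div_le_one hn0).2 hn
  -- The upper bound for the deviation is `n + 1` because `1 / n < n` fails for `n = 1`.
  have key : ∀ i, ∃ g ∈ 𝒢, ∀ j, (∀ x, ![-n, 1 / n] j - e i ≤ g x j ∧ g x j ≤ ![n, n + 1] j + e i) ∧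
        ∫⁻ x, ‖g x j - F j x‖ₑ ∂ρ ≤ ENNReal.ofReal (e i) := by
    intro i
    refine happ F hF _ _ ?_ ?_ ?_ (e i) (he0 i)
    · intro j; fin_cases j <;> simp <;> linarith [one_div n]
    · intro j x; fin_cases j
      · exact (abs_le.1 (h0 x)).1
      · exact (h1 x).1
    · intro j x; fin_cases j
      · exact (abs_le.1 (h0 x)).2
      · exact (h1 x).2.trans (by simp)
  choose g hg hgj using key
  have hconv : ∀ j, ∀ᵐ x ∂ρ, Tendsto (fun i => g i x j) atTop (𝓝 (F j x)) := by
    intro j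
    have hmeas : ∀ i, Measurable fun x => ‖g i x j - F j x‖ₑ := fun i =>
      ((h𝒢 _ (hg i) j).sub (hF j)).enorm
    have hsum : ∫⁻ x, ∑' i, ‖g i x j - F j x‖ₑ ∂ρ ≠ ∞ := by
      rw [lintegral_tsum fun i => (hmeas i).aemeasurable]
      exact ne_top_of_le_ne_top hes.tsum_ofReal_ne_top (ENNReal.tsum_le_tsum fun i => (hgj i j).2)
    filter_upwards [ae_lt_top (Measurable.tsum hmeas) hsum] with x hx
    have := ENNReal.tendsto_atTop_zero_of_tsum_ne_top hx.ne
    rw [tendsto_iff_edist_tendsto_0]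
    simpa only [edist_eq_enorm_sub] using this
  have hbd0 : ∀ i x, |g i x 0| ≤ n + 1 := by
    intro i x
    have h := (hgj i 0).1 x
    simp only [Matrix.cons_val_zero] at h
    rw [abs_le]; constructor <;> linarith [h.1, h.2, he1 i]
  have hbd1 : ∀ i x, 1 / (2 * n) ≤ g i x 1 ∧ g i x 1 ≤ n + 2 := by
    intro i x
    have h := (hgj i 1).1 x
    simp only [Matrix.cons_val_one, Matrix.cons_val_zero] at h
    have : 1 / (2 * n) = 1 / n - 1 / n / 2 := by field_simp; norm_num
    rw [this]; constructor <;> linarith [h.1, h.2, he1 i]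
  have hlim : Tendsto (fun i => ∫⁻ x, ENNReal.ofReal
      (gaussianKL (m x) (v x) (g i x 0) (g i x 1 ^ 2)) ∂ρ) atTop
      (𝓝 (∫⁻ x, ENNReal.ofReal (gaussianKL (m x) (v x) (F 0 x) (F 1 x ^ 2)) ∂ρ)) := by
    let a : ℝ := (1 / (2 * n)) ^ 2
    let b : ℝ := (n + 2) ^ 2
    refine tendsto_lintegral_of_dominated_convergence (fun x => ENNReal.ofReal
      (|Real.log a| + |Real.log b| + |Real.log (v x)| +
        (v x + 2 * m x ^ 2 + 2 * (n + 1) ^ 2) / a)) ?_ ?_ ?_ ?_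
    · intro i
      have := h𝒢 _ (hg i) 0
      have := h𝒢 _ (hg i) 1
      fun_prop
    · intro i
      filter_upwards [hv0] with x hx
      refine ENNReal.ofReal_le_ofReal (gaussianKL_le hx (by positivity) ?_ ?_ (hbd0 i x))
      · exact pow_le_pow_left₀ (by positivity) (hbd1 i x).1 2
      · exact pow_le_pow_left₀ (le_trans (by positivity) (hbd1 i x).1) (hbd1 i x).2 2
    · have : Integrable (fun x => |Real.log a| + |Real.log b| + |Real.log (v x)| +
        (v x + 2 * m x ^ 2 + 2 * (n + 1) ^ 2) / a) ρ :=
        ((integrable_const _).add hvl.abs).add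
          (((hv1.add (hm2.integrable_sq.const_mul 2)).add (integrable_const _)).div_const _)
      exact this.lintegral_lt_top.ne
    · filter_upwards [hv0, hconv 0, hconv 1] with x hx hx0 hx1
      have hF1 : 0 < F 1 x := lt_of_lt_of_le (by positivity) (h1 x).1
      refine ENNReal.tendsto_ofReal ?_
      unfold gaussianKL
      refine Tendsto.div_const (Tendsto.sub_const (Tendsto.add ?_ ?_) _) _
      · exact ((hx1.pow 2).div_const _).log (by positivity)
      · exact (((tendsto_const_nhds.sub hx0).pow 2).const_add _).div (hx1.pow 2) (by positivity)
  obtain ⟨i, hi⟩ := (hlim.eventually_lt_const hlt).exists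
  exact ⟨g i, hg i, fun x => lt_of_lt_of_le (by positivity) (hbd1 i x).1, hi⟩

/-- A minimizer of the expected divergence over a class of Gaussian models that is rich enough
matches the first two moments. -/
theorem moments_of_isMinOn [IsProbabilityMeasure ρ] {𝒢 : Set (X → Fin 2 → ℝ)}
    (h𝒢 : ∀ g ∈ 𝒢, ∀ j, Measurable fun x => g x j) (happ : ApproximatesBounded 𝒢 ρ)
    {m v : X → ℝ} (hm : Measurable m) (hv : Measurable v)
    (hv0 : ∀ᵐ x ∂ρ, 0 < v x) (hm2 : MemLp m 2 ρ) (hv1 : Integrable v ρ)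
    (hvl : Integrable (fun x => Real.log (v x)) ρ)
    {B : X → Measure ℝ} (hB : ∀ᵐ x ∂ρ, IsProbabilityMeasure (B x) ∧
      Integrable (fun z => z ^ 2) (B x) ∧ ∫ z, z ∂(B x) = m x ∧ ∫ z, z ^ 2 ∂(B x) = m x ^ 2 + v x)
    {c : X → ℝ} (hc : Integrable c ρ)
    (hBc : ∀ᵐ x ∂ρ, klDiv (B x) (gaussianReal (m x) (v x).toNNReal) ≤ ENNReal.ofReal (c x))
    {g : X → Fin 2 → ℝ} (hg : g ∈ 𝒢)
    (hmin : ∀ g' ∈ 𝒢, ∫⁻ x, klDiv (B x) (gaussianReal (g x 0) (g x 1 ^ 2).toNNReal) ∂ρ ≤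
      ∫⁻ x, klDiv (B x) (gaussianReal (g' x 0) (g' x 1 ^ 2).toNNReal) ∂ρ) :
    ∀ᵐ x ∂ρ, g x 0 = m x ∧ g x 1 ^ 2 = v x := by
  classical
  -- At zero deviation the divergence is infinite, whereas division by zero in the formula would
  -- give a negative number, truncated to 0.
  let K : (X → Fin 2 → ℝ) → X → ℝ≥0∞ := fun g x =>
    if g x 1 = 0 then ∞ else ENNReal.ofReal (gaussianKL (m x) (v x) (g x 0) (g x 1 ^ 2))
  have hK : ∀ g ∈ 𝒢, Measurable (K g) := by
    intro g hg
    have h0 := h𝒢 g hg 0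
    have h1 := h𝒢 g hg 1
    exact Measurable.ite (h1 (measurableSet_singleton 0)) measurable_const (by fun_prop)
  set C := ∫⁻ x, klDiv (B x) (gaussianReal (m x) (v x).toNNReal) ∂ρ with hC
  have hCtop : C ≠ ∞ :=
    ((lintegral_mono_ae hBc).trans_lt hc.lintegral_lt_top).ne
  have hdecomp : ∀ g ∈ 𝒢, ∫⁻ x, klDiv (B x) (gaussianReal (g x 0) (g x 1 ^ 2).toNNReal) ∂ρ =
      C + ∫⁻ x, K g x ∂ρ := by
    intro g hg
    rw [hC, ← lintegral_add_right _ (hK g hg)]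
    refine lintegral_congr_ae ?_
    filter_upwards [hv0, hB, hBc] with x hx ⟨hP, h2, hmx, hvx⟩ hcx
    have hvne : (v x).toNNReal ≠ 0 := by simpa using hx
    rw [klDiv_gaussianReal_pythagoras h2 hvne hmx (by rw [hvx, Real.coe_toNNReal _ hx.le])
      (hcx.trans_lt ENNReal.ofReal_lt_top).ne (g x 0) (g x 1 ^ 2).toNNReal]
    congr 1
    by_cases h0 : g x 1 = 0
    · simp only [K, h0, if_true]
      rw [klDiv_eq_top_iff]
      intro hac
      exfalso
      rw [zero_pow two_ne_zero, Real.toNNReal_zero, gaussianReal_zero_var] at hac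
      have h3 : gaussianReal (m x) (v x).toNNReal {g x 0}ᶜ = 0 := hac (by simp)
      have := nullSingletonClass_gaussianReal (μ := m x) hvne
      have h4 : gaussianReal (m x) (v x).toNNReal {g x 0} = 0 := measure_singleton _
      have h5 := measure_add_measure_compl (μ := gaussianReal (m x) (v x).toNNReal)
        (measurableSet_singleton (g x 0))
      rw [h3, h4, measure_univ] at h5
      simp at h5
    · simp only [K, h0, if_false]
      have hw : (g x 1 ^ 2).toNNReal ≠ 0 := by
        simpa using h0
      rw [klDiv_gaussianReal _ hvne _ hw, Real.coe_toNNReal _ hx.le,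
        Real.coe_toNNReal _ (sq_nonneg _)]
  -- If the excess were positive, some model in the class would have a smaller one; the common part
  -- `C` is finite and cancels.
  have hzero : ∫⁻ x, K g x ∂ρ = 0 := by
    by_contra hne
    obtain ⟨g', hg', hpos, hlt⟩ := exists_mem_lintegral_gaussianKL_lt h𝒢 happ hm hv hv0 hm2 hv1 hvl
      (pos_iff_ne_zero.2 hne)
    have h := hmin g' hg'
    rw [hdecomp g hg, hdecomp g' hg', ENNReal.add_le_add_iff_left hCtop] at h
    have h' : ∫⁻ x, K g' x ∂ρ =
        ∫⁻ x, ENNReal.ofReal (gaussianKL (m x) (v x) (g' x 0) (g' x 1 ^ 2)) ∂ρ := by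
      refine lintegral_congr fun x => ?_
      simp only [K, (hpos x).ne', if_false]
    rw [h'] at h
    exact absurd h (not_le.2 hlt)
  rw [lintegral_eq_zero_iff (hK g hg)] at hzero
  filter_upwards [hzero, hv0] with x hx hvx
  by_cases h0 : g x 1 = 0
  · simp [K, h0] at hx
  · simp only [K, h0, if_false, Pi.zero_apply, ENNReal.ofReal_eq_zero] at hx
    exact gaussianKL_eq_zero hvx (by positivity) hx

end Projection

/-! ### Moment matching for kernels of Gaussian mixtures. -/

section Backup

open InformationTheory

variable {X Y : Type*} [MeasurableSpace X] [MeasurableSpace Y] {ρ : Measure X}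
  [IsProbabilityMeasure ρ] {κ : Kernel X Y} [IsMarkovKernel κ] {μ s : X × Y → ℝ}

/-- The fitted moments of a kernel of Gaussian mixtures. -/
theorem moments_of_isMinOn_mixture {𝒢 : Set (X → Fin 2 → ℝ)}
    (h𝒢 : ∀ g ∈ 𝒢, ∀ j, Measurable fun x => g x j) (happ : ApproximatesBounded 𝒢 ρ)
    (hμ : Measurable μ) (hs : Measurable s) (hμ2 : MemLp μ 2 (ρ ⊗ₘ κ)) (hs2 : MemLp s 2 (ρ ⊗ₘ κ))
    (hs0 : ∀ᵐ q ∂(ρ ⊗ₘ κ), s q ≠ 0) (hsl : Integrable (fun q => Real.log |s q|) (ρ ⊗ₘ κ))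
    {B : X → Measure ℝ}
    (hB : ∀ x, B x = (κ x).bind fun y => gaussianReal (μ (x, y)) (s (x, y) ^ 2).toNNReal)
    {g : X → Fin 2 → ℝ} (hg : g ∈ 𝒢)
    (hmin : ∀ g' ∈ 𝒢, ∫⁻ x, klDiv (B x) (gaussianReal (g x 0) (g x 1 ^ 2).toNNReal) ∂ρ ≤
      ∫⁻ x, klDiv (B x) (gaussianReal (g' x 0) (g' x 1 ^ 2).toNNReal) ∂ρ) :
    (∀ᵐ x ∂ρ, g x 0 = ∫ y, μ (x, y) ∂(κ x) ∧
      g x 0 ^ 2 + g x 1 ^ 2 = ∫ y, (μ (x, y) ^ 2 + s (x, y) ^ 2) ∂(κ x)) ∧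
    MemLp (fun x => g x 0) 2 ρ ∧ MemLp (fun x => g x 1) 2 ρ ∧ (∀ᵐ x ∂ρ, g x 1 ≠ 0) ∧
    Integrable (fun x => Real.log |g x 1|) ρ := by
  have hμs : Integrable (fun q => μ q ^ 2) (ρ ⊗ₘ κ) := hμ2.integrable_sq
  have hss : Integrable (fun q => s q ^ 2) (ρ ⊗ₘ κ) := hs2.integrable_sq
  have hsum : Integrable (fun q => μ q ^ 2 + s q ^ 2) (ρ ⊗ₘ κ) := hμs.add hss
  have hsl' : Integrable (fun q => Real.log (s q ^ 2)) (ρ ⊗ₘ κ) := by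
    have : (fun q => Real.log (s q ^ 2)) = fun q => 2 * Real.log |s q| := by
      funext q
      rw [← sq_abs, Real.log_pow]
      norm_num
    rw [this]
    exact hsl.const_mul 2
  have sect : ∀ {f : X × Y → ℝ}, Integrable f (ρ ⊗ₘ κ) →
      ∀ᵐ x ∂ρ, Integrable (fun y => f (x, y)) (κ x) := fun hf =>
    ((Measure.integrable_compProd_iff hf.aestronglyMeasurable).1 hf).1
  have sectI : ∀ {f : X × Y → ℝ}, Integrable f (ρ ⊗ₘ κ) →
      Integrable (fun x => ∫ y, f (x, y) ∂(κ x)) ρ := fun hf => 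
    Integrable.integral_compProd (κ := Kernel.const Unit ρ) (η := Kernel.prodMkLeft Unit κ)
      (a := ()) hf
  let m : X → ℝ := fun x => ∫ y, μ (x, y) ∂(κ x)
  let S : X → ℝ := fun x => ∫ y, (μ (x, y) ^ 2 + s (x, y) ^ 2) ∂(κ x)
  let v : X → ℝ := fun x => S x - m x ^ 2
  let l : X → ℝ := fun x => ∫ y, Real.log (s (x, y) ^ 2) ∂(κ x)
  have hm : Measurable m := (hμ.stronglyMeasurable.integral_kernel_prod_right' (κ := κ)).measurable
  have hS : Measurable S :=
    (((hμ.pow_const 2).add (hs.pow_const 2)).stronglyMeasurable.integral_kernel_prod_right'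
      (κ := κ)).measurable
  have hv : Measurable v := hS.sub (hm.pow_const 2)
  have hSi : Integrable S ρ := sectI hsum
  have hli : Integrable l ρ := sectI hsl'
  have hs0' : ∀ᵐ x ∂ρ, ∀ᵐ y ∂(κ x), s (x, y) ≠ 0 := Measure.ae_ae_of_ae_compProd hs0
  have hcoe : ∀ q, (((s q ^ 2).toNNReal : ℝ≥0) : ℝ) = s q ^ 2 := fun q =>
    Real.coe_toNNReal _ (sq_nonneg _)
  have good : ∀ᵐ x ∂ρ, MemLp (fun y => μ (x, y)) 2 (κ x) ∧
      Integrable (fun y => (((s (x, y) ^ 2).toNNReal : ℝ≥0) : ℝ)) (κ x) ∧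
      (∀ᵐ y ∂(κ x), (s (x, y) ^ 2).toNNReal ≠ 0) ∧
      Integrable (fun y => Real.log (((s (x, y) ^ 2).toNNReal : ℝ≥0) : ℝ)) (κ x) := by
    filter_upwards [sect hμs, sect hss, sect hsl', hs0'] with x h1 h2 h3 h4
    simp only [hcoe]
    refine ⟨(memLp_two_iff_integrable_sq
      (hμ.comp measurable_prodMk_left).aestronglyMeasurable).2 h1, h2, ?_, h3⟩
    filter_upwards [h4] with y hy
    simpa using hy
  have hSeq : ∀ x, S x = ∫ y, (μ (x, y) ^ 2 + (((s (x, y) ^ 2).toNNReal : ℝ≥0) : ℝ)) ∂(κ x) := by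
    intro x; simp only [hcoe, S]
  have hleq : ∀ x, l x = ∫ y, Real.log (((s (x, y) ^ 2).toNNReal : ℝ≥0) : ℝ) ∂(κ x) := by
    intro x; simp only [hcoe, l]
  have hv0 : ∀ᵐ x ∂ρ, 0 < v x := by
    filter_upwards [good] with x ⟨h1, h2, h3, h4⟩
    simp only [v, hSeq]
    exact mixture_variance_pos h1 h2 h3
  have hmS : ∀ᵐ x ∂ρ, m x ^ 2 ≤ S x := by
    filter_upwards [hv0] with x hx
    simp only [v] at hx
    linarith
  have hmsq : Integrable (fun x => m x ^ 2) ρ := by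
    refine hSi.mono' (by fun_prop) ?_
    filter_upwards [hmS] with x hx
    rwa [Real.norm_of_nonneg (sq_nonneg _)]
  have hm2 : MemLp m 2 ρ := (memLp_two_iff_integrable_sq hm.aestronglyMeasurable).2 hmsq
  have hv1 : Integrable v ρ := hSi.sub hmsq
  -- Besides making the parameter-free part of the objective finite, this yields the lower bound of
  -- `log v` by the mean log-variance `l` of the components.
  have hKL : ∀ᵐ x ∂ρ, klDiv (B x) (gaussianReal (m x) (v x).toNNReal) ≤
      ENNReal.ofReal ((Real.log (v x) - l x) / 2) ∧ 0 ≤ Real.log (v x) - l x := by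
    filter_upwards [good, hv0] with x ⟨h1, h2, h3, h4⟩ hx
    have h := lintegral_gaussianKL_mixture h1 h2 h3 h4 (m := m x) (v := v x) rfl
      (by simp only [v, hSeq])
    rw [← hleq] at h
    refine ⟨?_, h.2⟩
    rw [← h.1, hB]
    have h5 := klDiv_mixture_le (κ x) (μ := fun y => μ (x, y))
      (τ := fun y => (s (x, y) ^ 2).toNNReal) (by fun_prop) (by fun_prop) h3 (m x)
      (v := (v x).toNNReal) (by simpa using hx)
    rwa [Real.coe_toNNReal _ hx.le] at h5
  -- Squeezed between `l` and `v - 1`.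
  have hvl : Integrable (fun x => Real.log (v x)) ρ := by
    refine (hv1.add hli.abs).mono' hv.log.aestronglyMeasurable ?_
    filter_upwards [hKL, hv0] with x hx h0
    have h1 := Real.log_le_sub_one_of_pos h0
    have h2 := neg_abs_le (l x)
    have h3 := abs_nonneg (l x)
    simp only [Pi.add_apply, Real.norm_eq_abs]
    rw [abs_le]
    constructor <;> linarith [hx.2]
  have hmom : ∀ᵐ x ∂ρ, IsProbabilityMeasure (B x) ∧ Integrable (fun z => z ^ 2) (B x) ∧
      ∫ z, z ∂(B x) = m x ∧ ∫ z, z ^ 2 ∂(B x) = m x ^ 2 + v x := by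
    filter_upwards [good] with x ⟨h1, h2, h3, h4⟩
    have h := mixture_moments (μ := fun y => μ (x, y)) (τ := fun y => (s (x, y) ^ 2).toNNReal)
      (by fun_prop) (by fun_prop) h1 h2
    rw [← hB, ← hSeq] at h
    refine ⟨h.1, h.2.1, h.2.2.1, ?_⟩
    rw [h.2.2.2]
    simp only [v]
    ring
  have key := moments_of_isMinOn h𝒢 happ hm hv hv0 hm2 hv1 hvl hmom ((hvl.sub hli).div_const 2)
    (hKL.mono fun x hx => hx.1) hg hmin
  refine ⟨?_, ?_, ?_, ?_, ?_⟩
  · filter_upwards [key] with x hx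
    refine ⟨hx.1, ?_⟩
    rw [hx.1, hx.2]
    simp only [v, S]
    ring
  · exact hm2.ae_eq (key.mono fun x hx => hx.1.symm)
  · rw [memLp_two_iff_integrable_sq (h𝒢 g hg 1).aestronglyMeasurable]
    exact hv1.congr (key.mono fun x hx => hx.2.symm)
  · filter_upwards [key, hv0] with x hx h0 h
    rw [h, zero_pow two_ne_zero] at hx
    linarith [hx.2]
  · refine (hvl.div_const 2).congr ?_
    filter_upwards [key] with x hx
    rw [← hx.2, ← sq_abs, Real.log_pow]
    push_cast
    ring

end Backup

/-! ### Discounted returns along trajectories, dominated by the energy. -/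

section Trajectories

variable {X : Type*} {γ : ℝ} {u : X × X → ℝ} {q : X → ℝ}

/-- The discounted sum of the squares of the transition payoffs and of a state functional along a
trajectory. -/
noncomputable def energy (γ : ℝ) (u : X × X → ℝ) (q : X → ℝ) (w : ℕ → X) : ℝ≥0∞ :=
  ∑' t, ENNReal.ofReal (γ ^ t * (u (w t, w (t + 1)) ^ 2 + q (w t)))

/-- The discounted payoff of the first `i` transitions, plus a terminal payoff. -/
noncomputable def truncatedReturn (γ : ℝ) (u : X × X → ℝ) (Q : X → ℝ) (i : ℕ) (w : ℕ → X) : ℝ :=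
  ∑ t ∈ Finset.range i, γ ^ t * u (w t, w (t + 1)) + γ ^ i * Q (w i)

/-- The discounted payoff of a trajectory. -/
noncomputable def totalReturn (γ : ℝ) (u : X × X → ℝ) (w : ℕ → X) : ℝ :=
  ∑' t, γ ^ t * u (w t, w (t + 1))

lemma truncatedReturn_succ (Q : X → ℝ) (i : ℕ) (x : X) (w : ℕ → X) :
    truncatedReturn γ u Q (i + 1) (consTraj x w) = u (x, w 0) + γ * truncatedReturn γ u Q i w := by
  simp only [truncatedReturn, Finset.sum_range_succ', consTraj_succ, consTraj_zero, pow_zero,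
    one_mul, mul_add, Finset.mul_sum, pow_succ']
  simp only [mul_assoc]
  ring

section Pathwise

variable {w : ℕ → X}

lemma summable_of_energy (hγ0 : 0 < γ) (hq : ∀ x, 0 ≤ q x) (h : energy γ u q w ≠ ∞) :
    Summable fun t => γ ^ t * (u (w t, w (t + 1)) ^ 2 + q (w t)) := by
  have h1 := ENNReal.summable_toReal h
  refine h1.congr fun t => ?_
  exact ENNReal.toReal_ofReal (mul_nonneg (by positivity) (add_nonneg (sq_nonneg _) (hq _)))

lemma toReal_energy (hγ0 : 0 < γ) (hq : ∀ x, 0 ≤ q x) :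
    (energy γ u q w).toReal = ∑' t, γ ^ t * (u (w t, w (t + 1)) ^ 2 + q (w t)) := by
  rw [energy, ENNReal.tsum_toReal_eq fun t => ENNReal.ofReal_ne_top]
  refine tsum_congr fun t => ?_
  exact ENNReal.toReal_ofReal (mul_nonneg (by positivity) (add_nonneg (sq_nonneg _) (hq _)))

lemma summable_discounted_sq (hγ0 : 0 < γ) (hq : ∀ x, 0 ≤ q x) (h : energy γ u q w ≠ ∞)
    {f : X → ℝ} (hf : ∀ x, f x ^ 2 ≤ q x) : Summable fun t => γ ^ t * f (w t) ^ 2 := by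
  refine Summable.of_nonneg_of_le (fun t => by positivity) (fun t => ?_)
    (summable_of_energy hγ0 hq h)
  have := hf (w t)
  have := sq_nonneg (u (w t, w (t + 1)))
  gcongr
  linarith

/-- Uses |b| ≤ 1 + b² and the summability of the weights. -/
lemma summable_discounted (hγ0 : 0 < γ) (hγ1 : γ < 1) {b : ℕ → ℝ}
    (h : Summable fun t => γ ^ t * b t ^ 2) : Summable fun t => γ ^ t * b t := by
  refine Summable.of_norm_bounded
    (((summable_geometric_of_lt_one hγ0.le hγ1).add h)) fun t => ?_
  have h1 : 0 < γ ^ t := by positivity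
  rw [norm_mul, Real.norm_of_nonneg h1.le, Real.norm_eq_abs]
  have : |b t| ≤ 1 + b t ^ 2 := by
    rw [← sq_abs]; nlinarith [sq_nonneg (|b t| - 1), abs_nonneg (b t)]
  nlinarith

lemma summable_payoff (hγ0 : 0 < γ) (hγ1 : γ < 1) (hq : ∀ x, 0 ≤ q x)
    (h : energy γ u q w ≠ ∞) : Summable fun t => γ ^ t * u (w t, w (t + 1)) := by
  refine summable_discounted hγ0 hγ1 ?_
  refine Summable.of_nonneg_of_le (fun t => by positivity) (fun t => ?_)
    (summable_of_energy hγ0 hq h)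
  have := hq (w t)
  gcongr
  linarith

lemma discounted_sq_le_energy (hγ0 : 0 < γ) (hγ1 : γ < 1) (hq : ∀ x, 0 ≤ q x)
    (h : energy γ u q w ≠ ∞) {f : X → ℝ} (hf : ∀ x, f x ^ 2 ≤ q x) (i : ℕ) :
    (γ ^ i * f (w i)) ^ 2 ≤ (energy γ u q w).toReal := by
  rw [toReal_energy hγ0 hq]
  have h0 : ∀ t, 0 ≤ γ ^ t * (u (w t, w (t + 1)) ^ 2 + q (w t)) := fun t =>
    mul_nonneg (by positivity) (add_nonneg (sq_nonneg _) (hq _))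
  refine le_trans ?_ ((summable_of_energy hγ0 hq h).le_tsum i fun t _ => h0 t)
  have h1 : γ ^ i ≤ 1 := pow_le_one₀ hγ0.le hγ1.le
  have h2 : 0 < γ ^ i := by positivity
  have h3 := hf (w i)
  have h4 := sq_nonneg (u (w i, w (i + 1)))
  have h5 := sq_nonneg (f (w i))
  calc (γ ^ i * f (w i)) ^ 2 = γ ^ i * (γ ^ i * f (w i) ^ 2) := by ring
    _ ≤ γ ^ i * (1 * f (w i) ^ 2) := by gcongr
    _ ≤ _ := by gcongr; linarith

/-- Cauchy-Schwarz with weights γᵗ. The bound does not depend on `i`, so the energy dominates all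
truncations at once. -/
lemma sq_truncatedReturn_le (hγ0 : 0 < γ) (hγ1 : γ < 1) (hq : ∀ x, 0 ≤ q x)
    (h : energy γ u q w ≠ ∞) {Q : X → ℝ} (hQ : ∀ x, Q x ^ 2 ≤ q x) (i : ℕ) :
    truncatedReturn γ u Q i w ^ 2 ≤ (2 / (1 - γ) + 2) * (energy γ u q w).toReal := by
  have h1 : 0 < 1 - γ := by linarith
  have hb := discounted_sq_le_energy hγ0 hγ1 hq h hQ i
  have ha : (∑ t ∈ Finset.range i, γ ^ t * u (w t, w (t + 1))) ^ 2 ≤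
      (1 / (1 - γ)) * (energy γ u q w).toReal := by
    refine (Finset.sum_sq_le_sum_mul_sum_of_sq_le_mul (Finset.range i)
      (f := fun t => γ ^ t) (g := fun t => γ ^ t * u (w t, w (t + 1)) ^ 2)
      (fun t _ => by positivity) (fun t _ => by positivity) (fun t _ => le_of_eq (by ring))).trans ?_
    refine mul_le_mul ?_ ?_ (Finset.sum_nonneg fun t _ => by positivity) (by positivity)
    · rw [one_div, ← tsum_geometric_of_lt_one hγ0.le hγ1]
      exact (summable_geometric_of_lt_one hγ0.le hγ1).sum_le_tsum _ fun t _ => by positivity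
    · rw [toReal_energy hγ0 hq]
      have h0 : ∀ t, 0 ≤ γ ^ t * (u (w t, w (t + 1)) ^ 2 + q (w t)) := fun t =>
        mul_nonneg (by positivity) (add_nonneg (sq_nonneg _) (hq _))
      refine le_trans (Finset.sum_le_sum fun t _ => ?_)
        ((summable_of_energy hγ0 hq h).sum_le_tsum (Finset.range i) fun t _ => h0 t)
      have := hq (w t)
      gcongr
      linarith
  have e : (2 / (1 - γ) + 2) * (energy γ u q w).toReal =
      2 * ((1 / (1 - γ)) * (energy γ u q w).toReal) + 2 * (energy γ u q w).toReal := by ring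
  rw [e, truncatedReturn]
  nlinarith [sq_nonneg (∑ t ∈ Finset.range i, γ ^ t * u (w t, w (t + 1)) - γ ^ i * Q (w i))]

lemma tendsto_discounted (hγ0 : 0 < γ) (hγ1 : γ < 1) (hq : ∀ x, 0 ≤ q x)
    (h : energy γ u q w ≠ ∞) {f : X → ℝ} (hf : ∀ x, f x ^ 2 ≤ q x) :
    Tendsto (fun i => γ ^ i * f (w i)) atTop (𝓝 0) :=
  (summable_discounted hγ0 hγ1 (summable_discounted_sq hγ0 hq h hf)).tendsto_atTop_zero

lemma tendsto_truncatedReturn (hγ0 : 0 < γ) (hγ1 : γ < 1) (hq : ∀ x, 0 ≤ q x)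
    (h : energy γ u q w ≠ ∞) {Q : X → ℝ} (hQ : ∀ x, Q x ^ 2 ≤ q x) :
    Tendsto (fun i => truncatedReturn γ u Q i w) atTop (𝓝 (totalReturn γ u w)) := by
  have h1 := (summable_payoff hγ0 hγ1 hq h).hasSum.tendsto_sum_nat
  simpa [truncatedReturn, totalReturn] using h1.add (tendsto_discounted hγ0 hγ1 hq h hQ)

end Pathwise

variable [MeasurableSpace X] (P : Kernel X X) [IsMarkovKernel P]

@[fun_prop]
lemma measurable_truncatedReturn (hu : Measurable u) {Q : X → ℝ} (hQ : Measurable Q) (i : ℕ) :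
    Measurable (truncatedReturn γ u Q i) := by
  unfold truncatedReturn
  fun_prop

lemma measurable_energy (hu : Measurable u) (hq : Measurable q) : Measurable (energy γ u q) := by
  unfold energy
  exact Measurable.tsum fun t => by fun_prop

/-- Averaging over each next state turns the transition payoffs into a function of the current
state, the form required by `ae_tsum_chain_lt_top`. -/
lemma lintegral_energy (hγ0 : 0 < γ) (hu : Measurable u) (hq : Measurable q) (x : X) :
    ∫⁻ w, energy γ u q w ∂(chain P x) =
      ∑' t, ENNReal.ofReal (γ ^ t) * ∫⁻ w, (∫⁻ y, ENNReal.ofReal (u (w t, y) ^ 2 + q (w t))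
        ∂(P (w t))) ∂(chain P x) := by
  unfold energy
  rw [lintegral_tsum fun t => by fun_prop]
  refine tsum_congr fun t => ?_
  have h0 : 0 ≤ γ ^ t := by positivity
  simp only [ENNReal.ofReal_mul h0]
  rw [lintegral_const_mul _ (by fun_prop)]
  congr 1
  exact lintegral_chain_succ P x t (F := fun p => ENNReal.ofReal
    (u (p.1 ⟨t, Finset.mem_Iic.2 le_rfl⟩, p.2) ^ 2 + q (p.1 ⟨t, Finset.mem_Iic.2 le_rfl⟩)))
    (by fun_prop)

section FiniteEnergy

variable {P} {x : X} (hγ0 : 0 < γ) (hγ1 : γ < 1) (hu : Measurable u) (hqm : Measurable q)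
  (hq : ∀ x, 0 ≤ q x) (hx : ∫⁻ w, energy γ u q w ∂(chain P x) ≠ ∞)

include hu hqm hx in
lemma ae_energy_ne_top : ∀ᵐ w ∂(chain P x), energy γ u q w ≠ ∞ :=
  (ae_lt_top (measurable_energy hu hqm) hx).mono fun _ h => h.ne

include hu hqm hx in
lemma integrable_energy : Integrable (fun w => (energy γ u q w).toReal) (chain P x) :=
  integrable_toReal_of_lintegral_ne_top (measurable_energy hu hqm).aemeasurable hx

include hγ0 hγ1 hu hqm hq hx

lemma memLp_truncatedReturn {Q : X → ℝ} (hQm : Measurable Q) (hQ : ∀ x, Q x ^ 2 ≤ q x) (i : ℕ) :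
    MemLp (truncatedReturn γ u Q i) 2 (chain P x) := by
  rw [memLp_two_iff_integrable_sq (by fun_prop)]
  refine ((integrable_energy hu hqm hx).const_mul (2 / (1 - γ) + 2)).mono' (by fun_prop) ?_
  filter_upwards [ae_energy_ne_top hu hqm hx] with w hw
  rw [Real.norm_of_nonneg (sq_nonneg _)]
  exact sq_truncatedReturn_le hγ0 hγ1 hq hw hQ i

lemma integrable_discounted_sq {f : X → ℝ} (hfm : Measurable f) (hf : ∀ x, f x ^ 2 ≤ q x) (i : ℕ) :
    Integrable (fun w => (γ ^ i * f (w i)) ^ 2) (chain P x) := by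
  have hm : Measurable fun w : ℕ → X => (γ ^ i * f (w i)) ^ 2 := by fun_prop
  refine (integrable_energy hu hqm hx).mono' hm.aestronglyMeasurable ?_
  filter_upwards [ae_energy_ne_top hu hqm hx] with w hw
  rw [Real.norm_of_nonneg (sq_nonneg _)]
  exact discounted_sq_le_energy hγ0 hγ1 hq hw hf i

lemma tendsto_integral_truncatedReturn {Q : X → ℝ} (hQm : Measurable Q)
    (hQ : ∀ x, Q x ^ 2 ≤ q x) :
    Tendsto (fun i => ∫ w, truncatedReturn γ u Q i w ∂(chain P x)) atTop
      (𝓝 (∫ w, totalReturn γ u w ∂(chain P x))) := by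
  refine tendsto_integral_of_dominated_convergence
    (fun w => 1 + (2 / (1 - γ) + 2) * (energy γ u q w).toReal) (fun i => by fun_prop)
    ((integrable_const _).add ((integrable_energy hu hqm hx).const_mul _)) (fun i => ?_) ?_
  · filter_upwards [ae_energy_ne_top hu hqm hx] with w hw
    have := sq_truncatedReturn_le hγ0 hγ1 hq hw hQ i
    rw [Real.norm_eq_abs]
    rw [← sq_abs] at this
    nlinarith [sq_nonneg (|truncatedReturn γ u Q i w| - 1), abs_nonneg (truncatedReturn γ u Q i w)]
  · filter_upwards [ae_energy_ne_top hu hqm hx] with w hw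
    exact tendsto_truncatedReturn hγ0 hγ1 hq hw hQ

lemma tendsto_integral_sq_truncatedReturn {Q σ : X → ℝ} (hQm : Measurable Q)
    (hQ : ∀ x, Q x ^ 2 ≤ q x) (hσm : Measurable σ) (hσ : ∀ x, σ x ^ 2 ≤ q x) :
    Tendsto (fun i => ∫ w, (truncatedReturn γ u Q i w ^ 2 + (γ ^ i * σ (w i)) ^ 2) ∂(chain P x))
      atTop (𝓝 (∫ w, totalReturn γ u w ^ 2 ∂(chain P x))) := by
  refine tendsto_integral_of_dominated_convergence
    (fun w => (2 / (1 - γ) + 2) * (energy γ u q w).toReal + (energy γ u q w).toReal)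
    (fun i => by fun_prop)
    (((integrable_energy hu hqm hx).const_mul _).add (integrable_energy hu hqm hx)) (fun i => ?_) ?_
  · filter_upwards [ae_energy_ne_top hu hqm hx] with w hw
    rw [Real.norm_of_nonneg (by positivity)]
    exact add_le_add (sq_truncatedReturn_le hγ0 hγ1 hq hw hQ i)
      (discounted_sq_le_energy hγ0 hγ1 hq hw hσ i)
  · filter_upwards [ae_energy_ne_top hu hqm hx] with w hw
    simpa using ((tendsto_truncatedReturn hγ0 hγ1 hq hw hQ).pow 2).add
      ((tendsto_discounted hγ0 hγ1 hq hw hσ).pow 2)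

end FiniteEnergy

end Trajectories

/-! ### Unrolling the moment recursion along the chain. -/

section Recursion

variable {X : Type*} [MeasurableSpace X] {ρ : Measure X} {P : Kernel X X} [IsMarkovKernel P]
  {γ : ℝ} {u : X × X → ℝ} {q : X → ℝ}

lemma integral_chain_eq (x : X) {f : (ℕ → X) → ℝ} (hfm : Measurable f)
    (hf : Integrable f (chain P x)) :
    ∫ w, f w ∂(chain P x) = ∫ y, ∫ w, f (consTraj x w) ∂(chain P y) ∂(P x) := by
  have hm : Measurable fun p : X × (ℕ → X) => consTraj x p.2 :=
    measurable_consTraj.comp (measurable_const.prodMk measurable_snd)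
  rw [chain_eq_bind] at hf ⊢
  rw [integrable_map_measure hfm.aestronglyMeasurable hm.aemeasurable] at hf
  rw [integral_map hm.aemeasurable hfm.aestronglyMeasurable]
  exact Measure.integral_compProd hf

lemma ae_payoff_chain_zero (hu : Measurable u) (x y : X) :
    ∀ᵐ w ∂(chain P y), u (x, w 0) = u (x, y) :=
  chain_ae_zero P y (p := fun z => u (x, z) = u (x, y))
    (measurableSet_eq_fun (by fun_prop) measurable_const) rfl

/-- The iterated Bellman recursion for first and second moments, unrolled along trajectories. -/
theorem moments_eq_integral_chain (hγ0 : 0 < γ) (hγ1 : γ < 1) (hu : Measurable u)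
    (hqm : Measurable q) (hq : ∀ x, 0 ≤ q x)
    (hen : ∀ᵐ x ∂ρ, ∫⁻ w, energy γ u q w ∂(chain P x) ≠ ∞)
    (hstep : ∀ p : X → Prop, (∀ᵐ x ∂ρ, p x) → ∀ᵐ x ∂ρ, ∀ᵐ y ∂(P x), p y)
    {Q σ : ℕ → X → ℝ} (hQm : Measurable (Q 0)) (hQ : ∀ x, Q 0 x ^ 2 ≤ q x)
    (hσm : Measurable (σ 0)) (hσ : ∀ x, σ 0 x ^ 2 ≤ q x)
    (hrec : ∀ i, ∀ᵐ x ∂ρ, Q (i + 1) x = ∫ y, (u (x, y) + γ * Q i y) ∂(P x) ∧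
      Q (i + 1) x ^ 2 + σ (i + 1) x ^ 2 =
        ∫ y, ((u (x, y) + γ * Q i y) ^ 2 + (γ * σ i y) ^ 2) ∂(P x)) (i : ℕ) :
    ∀ᵐ x ∂ρ, Q i x = ∫ w, truncatedReturn γ u (Q 0) i w ∂(chain P x) ∧
      Q i x ^ 2 + σ i x ^ 2 =
        ∫ w, (truncatedReturn γ u (Q 0) i w ^ 2 + (γ ^ i * σ 0 (w i)) ^ 2) ∂(chain P x) := by
  induction i with
  | zero =>
    refine ae_of_all _ fun x => ?_
    simp only [truncatedReturn, Finset.range_zero, Finset.sum_empty, pow_zero, one_mul, zero_add]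
    have h1 : ∀ᵐ w ∂(chain P x), Q 0 (w 0) = Q 0 x :=
      chain_ae_zero P x (p := fun z => Q 0 z = Q 0 x) (measurableSet_eq_fun hQm measurable_const) rfl
    have h2 : ∀ᵐ w ∂(chain P x), σ 0 (w 0) = σ 0 x :=
      chain_ae_zero P x (p := fun z => σ 0 z = σ 0 x) (measurableSet_eq_fun hσm measurable_const) rfl
    constructor
    · rw [integral_congr_ae h1]
      simp
    · have h3 : (fun w : ℕ → X => Q 0 (w 0) ^ 2 + σ 0 (w 0) ^ 2) =ᵐ[chain P x]
          fun _ => Q 0 x ^ 2 + σ 0 x ^ 2 := by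
        filter_upwards [h1, h2] with w e1 e2
        rw [e1, e2]
      rw [integral_congr_ae h3]
      simp
  | succ i ih =>
    -- The induction hypothesis holds only almost everywhere; `hstep` makes it available at almost
    -- every successor.
    filter_upwards [hrec i, hen, hstep _ (ih.and hen)] with x ⟨hr1, hr2⟩ hx hy
    have hR := memLp_truncatedReturn hγ0 hγ1 hu hqm hq hx hQm hQ (i + 1)
    have hS := integrable_discounted_sq hγ0 hγ1 hu hqm hq hx hσm hσ (i + 1)
    have hSm : Measurable fun w : ℕ → X => (γ ^ (i + 1) * σ 0 (w (i + 1))) ^ 2 := by fun_prop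
    constructor
    · rw [hr1, integral_chain_eq x (by fun_prop) (hR.integrable (by norm_num))]
      refine integral_congr_ae ?_
      filter_upwards [hy] with y ⟨⟨hy1, hy2⟩, hye⟩
      have h1 := memLp_truncatedReturn hγ0 hγ1 hu hqm hq hye hQm hQ i
      have h2 : (fun w => truncatedReturn γ u (Q 0) (i + 1) (consTraj x w)) =ᵐ[chain P y]
          fun w => u (x, y) + γ * truncatedReturn γ u (Q 0) i w := by
        filter_upwards [ae_payoff_chain_zero hu x y] with w hw
        rw [truncatedReturn_succ, hw]
      rw [integral_congr_ae h2, integral_add (integrable_const _)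
        ((h1.integrable (by norm_num)).const_mul _), integral_const_mul, ← hy1]
      simp
    · have hRS : Integrable (fun w => truncatedReturn γ u (Q 0) (i + 1) w ^ 2 +
        (γ ^ (i + 1) * σ 0 (w (i + 1))) ^ 2) (chain P x) := hR.integrable_sq.add hS
      rw [hr2, integral_chain_eq x (by fun_prop) hRS]
      refine integral_congr_ae ?_
      filter_upwards [hy] with y ⟨⟨hy1, hy2⟩, hye⟩
      have h1 := memLp_truncatedReturn hγ0 hγ1 hu hqm hq hye hQm hQ i
      have h1' := h1.integrable (q := 2) (by norm_num)
      have h2 := integrable_discounted_sq hγ0 hγ1 hu hqm hq hye hσm hσ i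
      -- After expansion the cross term needs the first moment at step `i`, and the factor of γ² is
      -- the second-moment combination at step `i`.
      have h3 : (fun w => truncatedReturn γ u (Q 0) (i + 1) (consTraj x w) ^ 2 +
          (γ ^ (i + 1) * σ 0 (consTraj x w (i + 1))) ^ 2) =ᵐ[chain P y]
          fun w => (u (x, y) ^ 2 + 2 * γ * u (x, y) * truncatedReturn γ u (Q 0) i w) +
            γ ^ 2 * (truncatedReturn γ u (Q 0) i w ^ 2 + (γ ^ i * σ 0 (w i)) ^ 2) := by
        filter_upwards [ae_payoff_chain_zero hu x y] with w hw
        rw [truncatedReturn_succ, hw, consTraj_succ]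
        ring
      have h4 : Integrable (fun w => u (x, y) ^ 2 +
          2 * γ * u (x, y) * truncatedReturn γ u (Q 0) i w) (chain P y) :=
        (integrable_const _).add (h1'.const_mul _)
      have h5 : Integrable (fun w => truncatedReturn γ u (Q 0) i w ^ 2 + (γ ^ i * σ 0 (w i)) ^ 2)
        (chain P y) := h1.integrable_sq.add h2
      rw [integral_congr_ae h3, integral_add h4 (h5.const_mul _),
        integral_add (integrable_const _) (h1'.const_mul _), integral_const_mul,
        integral_const_mul, ← hy1, ← hy2]
      simp only [integral_const, probReal_univ, smul_eq_mul, one_mul]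
      ring

end Recursion

/-! ### The soft return as a discounted sum of transition payoffs. -/

section SoftReturn

variable {O A : Type*} [MeasurableSpace O] [MeasurableSpace A] {ν : Measure A}
  (env : Environment O A) (π : Policy O ν) (γ α : ℝ)

/-- The payoff of a transition: its reward, and the discounted entropy bonus at its end point. -/
noncomputable def payoff (p : (O × A) × (O × A)) : ℝ :=
  env.reward (p.1, p.2.1) - γ * (α * Real.log (π.density p.2))

@[fun_prop]
lemma measurable_payoff : Measurable (payoff env π γ α) := by
  have := env.measurable_reward
  have := π.measurable_density
  unfold payoff
  fun_prop

variable {env π γ α}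

/-- The entropy term at time t + 1 is charged, with one more factor γ, to the transition starting at
time t. The absent entropy term at time 0 makes the reindexing exact; finite energy gives the
summability needed to rearrange. -/
lemma softReturn_eq_totalReturn (hγ0 : 0 < γ) (hγ1 : γ < 1) {q : O × A → ℝ} (hq : ∀ x, 0 ≤ q x)
    (hql : ∀ x, (α * Real.log (π.density x)) ^ 2 ≤ q x) {w : ℕ → O × A}
    (h : energy γ (payoff env π γ α) q w ≠ ∞) :
    softReturn env π γ α w = totalReturn γ (payoff env π γ α) w := by
  have h1 := summable_payoff hγ0 hγ1 hq h
  have h2 := summable_discounted hγ0 hγ1 (summable_discounted_sq hγ0 hq h hql)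
  set b : ℕ → ℝ := fun t => γ ^ t * (α * Real.log (π.density (w t))) with hb
  have h3 : Summable fun t => b (t + 1) := (summable_nat_add_iff 1).2 h2
  let b' : ℕ → ℝ := fun t => γ ^ t * if t = 0 then 0 else α * Real.log (π.density (w t))
  have h4 : ∀ t, b' (t + 1) = b (t + 1) := fun t => by simp [b', hb]
  have h5 : Summable b' := (summable_nat_add_iff 1).1 (h3.congr fun t => (h4 t).symm)
  have h6 : ∑' t, b' t = ∑' t, b (t + 1) := by
    rw [h5.tsum_eq_zero_add]
    simp only [h4]
    simp [b']
  let a : ℕ → ℝ := fun t => γ ^ t * payoff env π γ α (w t, w (t + 1)) + b (t + 1)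
  have h7 : ∀ t, γ ^ t * (env.reward (w t, (w (t + 1)).1) -
      if t = 0 then 0 else α * Real.log (π.density (w t))) = a t - b' t := by
    intro t
    simp only [a, b', hb, payoff, pow_succ]
    ring
  rw [softReturn, tsum_congr h7, (h1.add h3).tsum_sub h5, h1.tsum_add h3, h6, totalReturn]
  ring

end SoftReturn

/-! ### Convergence of Gaussian laws from convergence of their parameters. -/

section GaussianConvergence

/-- One standard normal source for all parameters, including `s = 0` and negative `s`; it reduces
convergence to pointwise convergence and provides couplings. -/
lemma gaussianReal_eq_map (m s : ℝ) :
    gaussianReal m (s ^ 2).toNNReal = (gaussianReal 0 1).map fun z => m + s * z := by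
  have h := gaussianReal_map_const_mul (μ := 0) (v := 1) s
  have h2 := gaussianReal_map_const_add (μ := s * 0) (v := NNReal.mk (s ^ 2) (sq_nonneg s) * 1) m
  rw [← h, Measure.map_map (by fun_prop) (by fun_prop)] at h2
  have e : (s ^ 2).toNNReal = NNReal.mk (s ^ 2) (sq_nonneg s) * 1 := by
    rw [mul_one]; exact Real.toNNReal_of_nonneg (sq_nonneg s)
  rw [e, ← zero_add m, ← mul_zero s, ← h2, mul_zero, zero_add]
  rfl

lemma tendsto_integral_gaussianReal {m : ℕ → ℝ} {s : ℕ → ℝ} {m₀ s₀ : ℝ}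
    (hm : Tendsto m atTop (𝓝 m₀)) (hs : Tendsto s atTop (𝓝 s₀))
    (f : BoundedContinuousFunction ℝ ℝ) :
    Tendsto (fun i => ∫ z, f z ∂(gaussianReal (m i) (s i ^ 2).toNNReal)) atTop
      (𝓝 (∫ z, f z ∂(gaussianReal m₀ (s₀ ^ 2).toNNReal))) := by
  have hmap : ∀ m s : ℝ, ∫ z, f z ∂(gaussianReal m (s ^ 2).toNNReal) =
      ∫ z, f (m + s * z) ∂(gaussianReal 0 1) := by
    intro m s
    rw [gaussianReal_eq_map, integral_map (by fun_prop) f.continuous.aestronglyMeasurable]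
  simp only [hmap]
  refine tendsto_integral_of_dominated_convergence (fun _ => ‖f‖) (fun i => ?_)
    (integrable_const _) (fun i => ae_of_all _ fun z => f.norm_coe_le_norm _)
    (ae_of_all _ fun z => ?_)
  · exact (f.continuous.comp (by fun_prop)).aestronglyMeasurable
  · exact (f.continuous.tendsto _).comp (hm.add (hs.mul_const z))

/-- Couples both laws through the same standard normal variable `z`; the distance is then at most
the parameter error times 1 + |z|. -/
lemma wasserstein_gaussianReal_le {p : ℝ} (hp : 1 ≤ p) (m s m₀ s₀ : ℝ) :
    wasserstein p (gaussianReal m (s ^ 2).toNNReal) (gaussianReal m₀ (s₀ ^ 2).toNNReal) ≤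
      ENNReal.ofReal (|m - m₀| + |s - s₀|) *
        (∫⁻ z, ENNReal.ofReal (1 + |z|) ^ p ∂(gaussianReal 0 1)) ^ (1 / p) := by
  have hp0 : 0 < p := by linarith
  set δ := |m - m₀| + |s - s₀| with hδ
  let T : ℝ → ℝ × ℝ := fun z => (m + s * z, m₀ + s₀ * z)
  have hT : Measurable T := by fun_prop
  have hc : ((gaussianReal 0 1).map T).fst = gaussianReal m (s ^ 2).toNNReal ∧
      ((gaussianReal 0 1).map T).snd = gaussianReal m₀ (s₀ ^ 2).toNNReal := by
    rw [Measure.fst, Measure.snd, Measure.map_map measurable_fst hT,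
      Measure.map_map measurable_snd hT, gaussianReal_eq_map, gaussianReal_eq_map]
    exact ⟨rfl, rfl⟩
  have hle : ∫⁻ z, edist z.1 z.2 ^ p ∂((gaussianReal 0 1).map T) ≤
      ENNReal.ofReal δ ^ p * ∫⁻ z, ENNReal.ofReal (1 + |z|) ^ p ∂(gaussianReal 0 1) := by
    rw [lintegral_map (by fun_prop) hT, ← lintegral_const_mul _ (by fun_prop)]
    refine lintegral_mono fun z => ?_
    rw [← ENNReal.mul_rpow_of_nonneg _ _ hp0.le, ← ENNReal.ofReal_mul (by positivity)]
    refine ENNReal.rpow_le_rpow ?_ hp0.le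
    rw [edist_dist, Real.dist_eq]
    refine ENNReal.ofReal_le_ofReal ?_
    have e : (T z).1 - (T z).2 = (m - m₀) + (s - s₀) * z := by simp only [T]; ring
    rw [e]
    refine (abs_add_le _ _).trans ?_
    rw [abs_mul, hδ]
    nlinarith [abs_nonneg (m - m₀), abs_nonneg (s - s₀), abs_nonneg z,
      mul_nonneg (abs_nonneg (m - m₀)) (abs_nonneg z)]
  unfold wasserstein
  calc _ ≤ (ENNReal.ofReal δ ^ p *
        ∫⁻ z, ENNReal.ofReal (1 + |z|) ^ p ∂(gaussianReal 0 1)) ^ (1 / p) :=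
        ENNReal.rpow_le_rpow ((iInf₂_le ((gaussianReal 0 1).map T) hc).trans hle) (by positivity)
    _ = _ := by
        rw [ENNReal.mul_rpow_of_nonneg _ _ (by positivity), ← ENNReal.rpow_mul,
          mul_one_div_cancel hp0.ne', ENNReal.rpow_one]

lemma tendsto_wasserstein_gaussianReal {p : ℝ} (hp : 1 ≤ p) {m : ℕ → ℝ} {s : ℕ → ℝ} {m₀ s₀ : ℝ}
    (hm : Tendsto m atTop (𝓝 m₀)) (hs : Tendsto s atTop (𝓝 s₀)) :
    Tendsto (fun i => wasserstein p (gaussianReal (m i) (s i ^ 2).toNNReal)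
      (gaussianReal m₀ (s₀ ^ 2).toNNReal)) atTop (𝓝 0) := by
  have hp0 : 0 < p := by linarith
  have hK : ∫⁻ z, ENNReal.ofReal (1 + |z|) ^ p ∂(gaussianReal 0 1) < ∞ := by
    have h0 : MemLp (fun z : ℝ => |z|) (ENNReal.ofReal p) (gaussianReal 0 1) := by
      have := (memLp_id_gaussianReal' (μ := 0) (v := 1) (ENNReal.ofReal p)
        ENNReal.ofReal_ne_top).norm
      exact this
    have h1 : MemLp (fun z : ℝ => 1 + |z|) (ENNReal.ofReal p) (gaussianReal 0 1) :=
      (memLp_const (1 : ℝ)).add h0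
    have hpne : ENNReal.ofReal p ≠ 0 := (ENNReal.ofReal_pos.2 hp0).ne'
    have h2 := lintegral_rpow_enorm_lt_top_of_eLpNorm_lt_top (f := fun z : ℝ => 1 + |z|) hpne
      ENNReal.ofReal_ne_top h1.2
    rw [ENNReal.toReal_ofReal hp0.le] at h2
    refine lt_of_le_of_lt (lintegral_mono fun z => ?_) h2
    rw [Real.enorm_eq_ofReal (by positivity)]
  have hδ : Tendsto (fun i => |m i - m₀| + |s i - s₀|) atTop (𝓝 0) := by
    have h1 := (hm.sub_const m₀).abs.add (hs.sub_const s₀).abs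
    simpa using h1
  have hlim := ENNReal.Tendsto.mul_const (ENNReal.tendsto_ofReal hδ)
    (Or.inr (ENNReal.rpow_ne_top_of_nonneg (by positivity : 0 ≤ 1 / p) hK.ne))
  rw [ENNReal.ofReal_zero, zero_mul] at hlim
  exact tendsto_of_tendsto_of_tendsto_of_le_of_le tendsto_const_nhds hlim (fun _ => zero_le)
    fun i => wasserstein_gaussianReal_le hp _ _ _ _

end GaussianConvergence

/-! ### One step of policy evaluation with network models. -/

section PolicyEvaluation

variable {N d₁ d₂ d₃ k : ℕ}

lemma encodedReturn_eq (act : ℝ → ℝ) (θ : MLP (d₃ + d₂ + k) 2) (φ : MLP d₁ d₃)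
    (x : Obs N d₁ d₂ × (Fin k → ℝ)) :
    encodedReturn act θ φ x =
      gaussianReal (valueMean act θ φ x) (valueStd act θ φ x ^ 2).toNNReal := by
  rw [encodedReturn, Real.toNNReal_of_nonneg (sq_nonneg _)]
  rfl

/-- The models that the networks can represent. -/
def valueModels (N d₁ d₂ d₃ k : ℕ) (act : ℝ → ℝ) :
    Set (Obs N d₁ d₂ × (Fin k → ℝ) → Fin 2 → ℝ) :=
  Set.range fun p : MLP (d₃ + d₂ + k) 2 × MLP d₁ d₃ => valueOut act p.1 p.2

lemma measurable_of_mem_valueModels {act : ℝ → ℝ} (hact : Continuous act)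
    {g : Obs N d₁ d₂ × (Fin k → ℝ) → Fin 2 → ℝ} (hg : g ∈ valueModels N d₁ d₂ d₃ k act)
    (j : Fin 2) : Measurable fun x => g x j := by
  obtain ⟨p, rfl⟩ := hg
  exact measurable_valueOut hact _ _ _

lemma approximatesBounded_valueModels {act : ℝ → ℝ} (hact : IsActivation act) (hd : 0 < d₃)
    (ρ : Measure (Obs N d₁ d₂ × (Fin k → ℝ))) [IsProbabilityMeasure ρ] :
    ApproximatesBounded (valueModels N d₁ d₂ d₃ k act) ρ := by
  intro F hF lo hi hlt hlo hhi ε hε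
  obtain ⟨θ, φ, h⟩ := exists_valueOut_approx hact hd ρ hF hlt hlo hhi hε
  exact ⟨_, ⟨(θ, φ), rfl⟩, h⟩

section OneStep

variable {O A : Type*} [MeasurableSpace O] [MeasurableSpace A] {ν : Measure A}

/-- Given the transition, the backup is an affine image of a Gaussian, so the backup is a Gaussian
mixture. -/
lemma backup_gaussianReal (env : Environment O A) (π : Policy O ν) (γ α : ℝ) (Q σ : O × A → ℝ)
    (x : O × A) :
    backup env π γ α (fun y => gaussianReal (Q y) (σ y ^ 2).toNNReal) x =
      (step env π x).bind fun y => gaussianReal (payoff env π γ α (x, y) + γ * Q y)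
        ((γ * σ y) ^ 2).toNNReal := by
  unfold backup
  congr 1
  funext y
  beta_reduce
  rw [gaussianReal_eq_map, gaussianReal_eq_map, Measure.map_map (by fun_prop) (by fun_prop)]
  congr 1
  funext z
  simp only [Function.comp, payoff]
  ring

end OneStep

variable {act : ℝ → ℝ} {ν : Measure (Fin k → ℝ)} {env : Environment (Obs N d₁ d₂) (Fin k → ℝ)}
  {d₀ : Measure (Obs N d₁ d₂)} [IsProbabilityMeasure d₀] {π : Policy (Obs N d₁ d₂) ν} {γ α : ℝ}

lemma memLp_payoff (hγ0 : 0 < γ) (hγ1 : γ < 1)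
    (hr : MemLp env.reward 2 (occupancy env d₀ π γ ⊗ₘ env.trans))
    (hlog : MemLp (fun x => Real.log (π.density x)) 2 (occupancy env d₀ π γ)) :
    MemLp (payoff env π γ α) 2 (transLaw env d₀ π γ) :=
  (memLp_transLaw_reward env d₀ π hγ0 hγ1 hr).sub
    (((memLp_transLaw_snd env d₀ π hγ0 hγ1 hlog).const_mul α).const_mul γ)

/-- One step of approximate policy evaluation: the moments are those of the Bellman backup. -/
lemma moments_of_isMinOn_objective (hact : IsActivation act) (hd : 0 < d₃)
    (hγ0 : 0 < γ) (hγ1 : γ < 1)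
    (hr : MemLp env.reward 2 (occupancy env d₀ π γ ⊗ₘ env.trans))
    (hlog : MemLp (fun x => Real.log (π.density x)) 2 (occupancy env d₀ π γ))
    {old new : MLP (d₃ + d₂ + k) 2 × MLP d₁ d₃}
    (hQ : MemLp (valueMean (N := N) act old.1 old.2) 2 (occupancy env d₀ π γ))
    (hσ : MemLp (valueStd (N := N) act old.1 old.2) 2 (occupancy env d₀ π γ))
    (hσ0 : ∀ᵐ x ∂(occupancy env d₀ π γ), valueStd act old.1 old.2 x ≠ 0)
    (hσl : Integrable (fun x => Real.log |valueStd act old.1 old.2 x|) (occupancy env d₀ π γ))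
    (hmin : IsMinOn (objective act env d₀ π γ α old) Set.univ new) :
    (∀ᵐ x ∂(occupancy env d₀ π γ),
      valueMean act new.1 new.2 x =
        ∫ y, (payoff env π γ α (x, y) + γ * valueMean act old.1 old.2 y) ∂(step env π x) ∧
      valueMean act new.1 new.2 x ^ 2 + valueStd act new.1 new.2 x ^ 2 =
        ∫ y, ((payoff env π γ α (x, y) + γ * valueMean act old.1 old.2 y) ^ 2 +
          (γ * valueStd act old.1 old.2 y) ^ 2) ∂(step env π x)) ∧
    MemLp (valueMean (N := N) act new.1 new.2) 2 (occupancy env d₀ π γ) ∧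
    MemLp (valueStd (N := N) act new.1 new.2) 2 (occupancy env d₀ π γ) ∧
    (∀ᵐ x ∂(occupancy env d₀ π γ), valueStd act new.1 new.2 x ≠ 0) ∧
    Integrable (fun x => Real.log |valueStd act new.1 new.2 x|) (occupancy env d₀ π γ) := by
  have := isProbabilityMeasure_occupancy env d₀ π hγ0 hγ1
  have hQm : Measurable (valueMean (N := N) act old.1 old.2) := measurable_valueOut hact.1 _ _ 0
  have hσm : Measurable (valueStd (N := N) act old.1 old.2) := measurable_valueOut hact.1 _ _ 1
  have hσ0' : ∀ᵐ p ∂(transLaw env d₀ π γ), γ * valueStd act old.1 old.2 p.2 ≠ 0 := by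
    have h := ae_step_of_ae_occupancy env d₀ π hγ0 hγ1 hσ0
    refine (Measure.ae_compProd_iff ?_).2 (h.mono fun x hx => hx.mono fun y hy =>
      mul_ne_zero hγ0.ne' hy)
    exact (measurableSet_eq_fun (by fun_prop) measurable_const).compl
  -- The discount only adds the constant `Real.log |γ|`, as long as the deviation is nonzero.
  have hσl' : Integrable (fun p : (Obs N d₁ d₂ × (Fin k → ℝ)) × (Obs N d₁ d₂ × (Fin k → ℝ)) =>
      Real.log |γ * valueStd act old.1 old.2 p.2|) (transLaw env d₀ π γ) := by
    have h1 : Integrable (fun p : (Obs N d₁ d₂ × (Fin k → ℝ)) × (Obs N d₁ d₂ × (Fin k → ℝ)) =>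
        Real.log |valueStd act old.1 old.2 p.2|) (transLaw env d₀ π γ) :=
      memLp_one_iff_integrable.1
        (memLp_transLaw_snd env d₀ π hγ0 hγ1 (memLp_one_iff_integrable.2 hσl))
    have : IsProbabilityMeasure (transLaw env d₀ π γ) := by unfold transLaw; infer_instance
    refine ((integrable_const (Real.log |γ|)).add h1).congr ?_
    filter_upwards [hσ0'] with p hp
    rw [Pi.add_apply, abs_mul, Real.log_mul (abs_ne_zero.2 hγ0.ne')
      (abs_ne_zero.2 (right_ne_zero_of_mul hp))]
  have hmeas : Measurable (payoff env π γ α) := measurable_payoff env π γ α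
  refine moments_of_isMinOn_mixture (κ := step env π)
    (μ := fun p => payoff env π γ α p + γ * valueMean act old.1 old.2 p.2)
    (s := fun p => γ * valueStd act old.1 old.2 p.2)
    (B := backup env π γ α (encodedReturn act old.1 old.2)) (g := valueOut act new.1 new.2)
    (𝒢 := valueModels N d₁ d₂ d₃ k act)
    (fun g hg j => measurable_of_mem_valueModels hact.1 hg j)
    (approximatesBounded_valueModels hact hd _) (by fun_prop) (by fun_prop)
    ((memLp_payoff hγ0 hγ1 hr hlog).add
      ((memLp_transLaw_snd env d₀ π hγ0 hγ1 hQ).const_mul γ))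
    ((memLp_transLaw_snd env d₀ π hγ0 hγ1 hσ).const_mul γ) hσ0' hσl' (fun x => ?_)
    ⟨new, rfl⟩ ?_
  · rw [← backup_gaussianReal]
    congr 1
    funext y
    exact encodedReturn_eq _ _ _ _
  · rintro g' ⟨p, rfl⟩
    have h := hmin (Set.mem_univ p)
    simp only [Set.mem_ofPred_eq, objective, encodedReturn_eq act new.1, encodedReturn_eq act p.1]
      at h
    exact h

end PolicyEvaluation

end EDPE

/-! ### The convergence theorem. -/

open EDPE
theorem lemma3 {N d₁ d₂ d₃ k : ℕ} (hd : N * d₁ + 1 ≤ d₃)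
    (act : ℝ → ℝ) (hact : IsActivation act)
    (ν : Measure (Fin k → ℝ)) [SigmaFinite ν]
    (env : Environment (Obs N d₁ d₂) (Fin k → ℝ))
    (d₀ : Measure (Obs N d₁ d₂)) [IsProbabilityMeasure d₀]
    (π : Policy (Obs N d₁ d₂) ν)
    (γ α : ℝ) (hγ0 : 0 < γ) (hγ1 : γ < 1)
    -- rewards and log-densities of the policy are square integrable
    (hr : MemLp env.reward 2 (occupancy env d₀ π γ ⊗ₘ env.trans))
    (hlog : MemLp (fun x => Real.log (π.density x)) 2 (occupancy env d₀ π γ))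
    -- the random returns are Gaussian
    (hgauss : ∀ᵐ x ∂(occupancy env d₀ π γ),
      ∃ (m : ℝ) (v : ℝ≥0), trueReturn env π γ α x = gaussianReal m v)
    -- the iterates
    (θ : ℕ → MLP (d₃ + d₂ + k) 2) (φ : ℕ → MLP d₁ d₃)
    -- the initial model is nondegenerate, with integrable second moment and log-scale
    (hmean : MemLp (valueMean (N := N) act (θ 0) (φ 0)) 2 (occupancy env d₀ π γ))
    (hstd : MemLp (valueStd (N := N) act (θ 0) (φ 0)) 2 (occupancy env d₀ π γ))
    (hstd_ne : ∀ᵐ x ∂(occupancy env d₀ π γ), valueStd act (θ 0) (φ 0) x ≠ 0)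
    (hstd_log : Integrable (fun x => Real.log |valueStd act (θ 0) (φ 0) x|)
      (occupancy env d₀ π γ))
    (hmin : ∀ i, IsMinOn (objective act env d₀ π γ α (θ i, φ i)) Set.univ
      (θ (i + 1), φ (i + 1))) :
    ∀ᵐ x ∂(occupancy env d₀ π γ),
      (∀ f : BoundedContinuousFunction ℝ ℝ,
        Tendsto (fun i => ∫ z, f z ∂(encodedReturn act (θ i) (φ i) x)) atTop
          (𝓝 (∫ z, f z ∂(trueReturn env π γ α x)))) ∧
      ∀ p : ℝ, 1 ≤ p →
        Tendsto (fun i => wasserstein p (encodedReturn act (θ i) (φ i) x)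
          (trueReturn env π γ α x)) atTop (𝓝 0) := by
  have hd' : 0 < d₃ := by omega
  have hoc := isProbabilityMeasure_occupancy env d₀ π hγ0 hγ1
  set ρ := occupancy env d₀ π γ
  -- The regularity assumed of the initial model is inherited by every iterate, so the one-step
  -- result applies at each stage.
  have hall : ∀ i, MemLp (valueMean (N := N) act (θ i) (φ i)) 2 ρ ∧
      MemLp (valueStd (N := N) act (θ i) (φ i)) 2 ρ ∧
      (∀ᵐ x ∂ρ, valueStd act (θ i) (φ i) x ≠ 0) ∧
      Integrable (fun x => Real.log |valueStd act (θ i) (φ i) x|) ρ := by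
    intro i
    induction i with
    | zero => exact ⟨hmean, hstd, hstd_ne, hstd_log⟩
    | succ i ih =>
      exact (moments_of_isMinOn_objective (old := (θ i, φ i))
        (new := (θ (i + 1), φ (i + 1))) hact hd' hγ0 hγ1 hr hlog ih.1 ih.2.1 ih.2.2.1 ih.2.2.2
        (hmin i)).2
  have hrec := fun i => (moments_of_isMinOn_objective (old := (θ i, φ i))
        (new := (θ (i + 1), φ (i + 1))) hact hd' hγ0 hγ1 hr hlog (hall i).1
    (hall i).2.1 (hall i).2.2.1 (hall i).2.2.2 (hmin i)).1
  have hQm : Measurable (valueMean (N := N) (d₂ := d₂) act (θ 0) (φ 0)) :=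
    measurable_valueOut hact.1 _ _ 0
  have hσm : Measurable (valueStd (N := N) (d₂ := d₂) act (θ 0) (φ 0)) :=
    measurable_valueOut hact.1 _ _ 1
  have hπm := π.measurable_density
  have hu := measurable_payoff env π γ α
  -- A single function above the squares of the initial mean, the initial deviation and the entropy
  -- term, so that one energy controls every limit below.
  let q : Obs N d₁ d₂ × (Fin k → ℝ) → ℝ := fun x => valueMean act (θ 0) (φ 0) x ^ 2 +
    valueStd act (θ 0) (φ 0) x ^ 2 + (α * Real.log (π.density x)) ^ 2
  have hq : ∀ x, 0 ≤ q x := fun x => by positivity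
  have hqQ : ∀ x, valueMean act (θ 0) (φ 0) x ^ 2 ≤ q x := fun x => by
    have := sq_nonneg (valueStd act (θ 0) (φ 0) x)
    have := sq_nonneg (α * Real.log (π.density x))
    simp only [q]; linarith
  have hqσ : ∀ x, valueStd act (θ 0) (φ 0) x ^ 2 ≤ q x := fun x => by
    have := sq_nonneg (valueMean act (θ 0) (φ 0) x)
    have := sq_nonneg (α * Real.log (π.density x))
    simp only [q]; linarith
  have hql : ∀ x, (α * Real.log (π.density x)) ^ 2 ≤ q x := fun x => by
    have := sq_nonneg (valueMean act (θ 0) (φ 0) x)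
    have := sq_nonneg (valueStd act (θ 0) (φ 0) x)
    simp only [q]; linarith
  have hqm : Measurable q := by fun_prop
  have hqi : Integrable q ρ :=
    (hmean.integrable_sq.add hstd.integrable_sq).add (hlog.const_mul α).integrable_sq
  have hen : ∀ᵐ x ∂ρ, ∫⁻ w, energy γ (payoff env π γ α) q w ∂(chain (step env π) x) ≠ ∞ := by
    have hf : Measurable fun p => ENNReal.ofReal (payoff env π γ α p ^ 2 + q p.1) := by fun_prop
    have hfin : ∫⁻ x, ∫⁻ y, ENNReal.ofReal (payoff env π γ α (x, y) ^ 2 + q x) ∂(step env π x) ∂ρ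
        ≠ ∞ := by
      rw [← Measure.lintegral_compProd hf]
      have h1 : Integrable (fun p : (Obs N d₁ d₂ × (Fin k → ℝ)) × (Obs N d₁ d₂ × (Fin k → ℝ)) =>
          q p.1) (ρ ⊗ₘ step env π) := by
        have h2 : Integrable q ((ρ ⊗ₘ step env π).map Prod.fst) := by
          rwa [← Measure.fst, Measure.fst_compProd]
        exact h2.comp_measurable measurable_fst
      exact ((memLp_payoff hγ0 hγ1 hr hlog).integrable_sq.add h1).lintegral_lt_top.ne
    have hfm : Measurable fun x => ∫⁻ y, ENNReal.ofReal (payoff env π γ α (x, y) ^ 2 + q x)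
        ∂(step env π x) := hf.lintegral_kernel_prod_right' (κ := step env π)
    filter_upwards [ae_tsum_chain_lt_top env d₀ π hγ0 hγ1 hfm hfin] with x hx
    rw [lintegral_energy _ hγ0 hu hqm]
    exact hx.ne
  have hmom := moments_eq_integral_chain (ρ := ρ) (P := step env π) hγ0 hγ1 hu hqm hq hen
    (fun p hp => ae_step_of_ae_occupancy env d₀ π hγ0 hγ1 hp)
    (Q := fun i => valueMean act (θ i) (φ i)) (σ := fun i => valueStd act (θ i) (φ i))
    hQm hqQ hσm hqσ hrec
  filter_upwards [ae_all_iff.2 hmom, hen, hgauss] with x hx hxe ⟨m, v, hmv⟩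
  have hfinite := ae_energy_ne_top hu hqm hxe
  -- Obtained as an almost sure limit of truncated returns.
  have htot : AEMeasurable (totalReturn γ (payoff env π γ α)) (chain (step env π) x) :=
    aemeasurable_of_tendsto_metrizable_ae atTop
      (fun i => (measurable_truncatedReturn hu hQm i).aemeasurable)
      (hfinite.mono fun w hw => tendsto_truncatedReturn hγ0 hγ1 hq hw hqQ)
  have hsoft : trueReturn env π γ α x =
      (chain (step env π) x).map (totalReturn γ (payoff env π γ α)) := by
    rw [trueReturn, trajLaw_eq_chain]
    exact Measure.map_congr
      (hfinite.mono fun w hw => softReturn_eq_totalReturn hγ0 hγ1 hq hql hw)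
  -- Gaussianity of the true return enters here: its parameters are the moments to which the
  -- iterates converge.
  have hm1 : ∫ w, totalReturn γ (payoff env π γ α) w ∂(chain (step env π) x) = m := by
    have h := integral_map (f := fun z : ℝ => z) htot (by fun_prop)
    rw [← hsoft, hmv, integral_id_gaussianReal] at h
    exact h.symm
  have hm2 : ∫ w, totalReturn γ (payoff env π γ α) w ^ 2 ∂(chain (step env π) x) = m ^ 2 + v := by
    have h := integral_map (f := fun z : ℝ => z ^ 2) htot (by fun_prop)
    rw [← hsoft, hmv, integral_sq_gaussianReal] at h
    exact h.symm
  have hlim1 : Tendsto (fun i => valueMean act (θ i) (φ i) x) atTop (𝓝 m) := by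
    have h := tendsto_integral_truncatedReturn hγ0 hγ1 hu hqm hq hxe hQm hqQ
    rw [hm1] at h
    exact h.congr fun i => (hx i).1.symm
  -- The networks fix the deviation only up to sign, which may vary with `i`, so its absolute value
  -- is what converges.
  have hlim2 : Tendsto (fun i => |valueStd act (θ i) (φ i) x|) atTop (𝓝 √v) := by
    have h := tendsto_integral_sq_truncatedReturn hγ0 hγ1 hu hqm hq hxe hQm hqQ hσm hqσ
    rw [hm2] at h
    have h' := (h.congr fun i => (hx i).2.symm).sub (hlim1.pow 2)
    simp only [add_sub_cancel_left] at h'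
    simpa only [Real.sqrt_sq_eq_abs] using h'.sqrt
  have henc : ∀ i, encodedReturn act (θ i) (φ i) x = gaussianReal (valueMean act (θ i) (φ i) x)
      (|valueStd act (θ i) (φ i) x| ^ 2).toNNReal := fun i => by
    rw [encodedReturn_eq, sq_abs]
  have htrue : trueReturn env π γ α x = gaussianReal m (√v ^ 2).toNNReal := by
    rw [hmv, Real.sq_sqrt v.coe_nonneg, Real.toNNReal_coe]
  simp only [henc, htrue]
  exact ⟨fun f => tendsto_integral_gaussianReal hlim1 hlim2 f,
    fun p hp => tendsto_wasserstein_gaussianReal hp hlim1 hlim2⟩
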